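/- **Setting.** Let $\mathcal P,\mathcal Q$ be finite sets of real polynomials in $n$ variables (constraints $p=0$ for $p\in\mathcal P$, $q\ge 0$ for $q\in\mathcal Q$), and let $S$ be a nonempty set of real points satisfying all of them. For $d\ge 0$ let $\mathbf v$ be the vector of all monomials of degree at most $d$ and let $M_S=\mathbb E_{\alpha\in S}[\mathbf v(\alpha)\mathbf v(\alpha)^T]$, where $\alpha$ is uniform on $S$ (uniform counting measure if $S$ is finite, normalized surface measure if $S$ is the unit sphere). $S$ is *$(\delta,k,\epsilon)$-rich for $(\mathcal P,\mathcal Q)$ up to degree $d$* if (i) every nonzero eigenvalue of $M_S$ is at least $\delta$; (ii) for every $c$ with $M_Sc=0$ there are polynomials $\lambda_p$ with $c^T\mathbf v=\sum_{p\in\mathcal P}\lambda_p p$ and $\deg(\lambda_p p)\le k$ for all $p$; (iii) $q(\alpha)>\epsilon$ for all $q\in\mathcal Q$, $\alpha\in S$. For a constant $c\in\mathbb N$, $S$ is *$c$-rich up to degree $d$* if it is $(\delta,k,\epsilon)$-rich up to degree $d$ for some $\delta,\epsilon>0$ and $k$ with $1/\delta,\,1/\epsilon\le 2^{c\,(n^d)^c}$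 and $k\le c\,d$. A *sum-of-squares proof of $r$ from $(\mathcal P,\mathcal Q)$ of degree at most $D$* is an identity $r=\sum_i h_i^2+\sum_{q\in\mathcal Q}\big(\sum_j s_{q,j}^2\big)q+\sum_{p\in\mathcal P}\lambda_p p$ in which all $h_i^2$, $s_{q,j}^2q$, $\lambda_pp$ have degree at most $D$. The system *has $c$-small proofs in degree $d$* if for every $B\ge1$ and every $r$ whose coefficients are at most $B$ in absolute value, if $r$ has a sum-of-squares proof of degree at most $d$, then it has one of degree at most $c\,d$ in which all coefficients of all $h_i,s_{q,j},\lambda_p$ are at most $B\cdot 2^{c\,(n^d)^c}$ in absolute value and each of the sums $\sum_i h_i^2$, $\sum_j s_{q,j}^2$ has at most $c\,(n^d)^c$ terms. **Statement.** There is an absolute constant $c\in\mathbb N$ such that the following hold for all $n\geq 1$ and $d\geq 0$ as indicated ("number of variables" is the $n$ in the definitions above). * **Max-CSP** $\mathcal P=\{x_i^2-x_i: i\in[n]\}$, $\mathcal Q=\emptyset$: for all $d$, the solution set is $c$-rich up to degree $d$; if $n\ge2$ the system has $c$-small proofs in degree $d$. * **Max-Clique** $\mathcal P=\{x_i^2-x_i: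 i\in[n]\}\cup\{x_ix_j: i\ne j,\ (i,j)\notin E\}$, $\mathcal Q=\emptyset$, for any simple graph $G=([n],E)$: the same. * **Balanced Separator.** For $\eta\ge 0$ let $\mathcal P=\{x_i^2-x_i: i\in[n]\}$ and $\mathcal Q_\eta=\{2n/3+\eta-\sum_ix_i,\ \sum_ix_i-n/3+\eta\}$. (a) If $d\le n/3$ and $n\ne 3d+1$, then the solution set of $(\mathcal P,\mathcal Q_0)$ is $c$-rich up to degree $d$ for the perturbed system $(\mathcal P,\mathcal Q_{1/2})$; if moreover $n\ge2$, then $(\mathcal P,\mathcal Q_{1/2})$ has $c$-small proofs in degree $d$. (b) If $d\le n/3-2$, then some set of solutions of $(\mathcal P,\mathcal Q_0)$ is $c$-rich up to degree $d$ for $(\mathcal P,\mathcal Q_0)$ itself, and $(\mathcal P,\mathcal Q_0)$ has $c$-small proofs in degree $d$. * **Matching.** For $n\ge2$ even, with one variable $x_e$ per edge $e$ of the complete graph on $[n]$ (so $\binom n2$ variables), $\mathcal P=\{x_e^2-x_e\}\cup\{\sum_{e\ni v}x_e-1: v\in[n]\}\cup\{x_ex_f: e\ne f\text{ share a vertex}\}$,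 $\mathcal Q=\emptyset$: for all $d$, the solution set is $c$-rich up to degree $d$; if $n\ge4$ the system has $c$-small proofs in degree $d$. * **Max-Bisection.** For $n\ge2$ even, $\mathcal P=\{x_i^2-x_i: i\in[n]\}\cup\{\sum_ix_i-n/2\}$, $\mathcal Q=\emptyset$: for all $d$, the solution set is $c$-rich up to degree $d$ and the system has $c$-small proofs in degree $d$. * **Unit-Vector** $\mathcal P=\{\sum_ix_i^2-1\}$, $\mathcal Q=\emptyset$: for all $d$, the solution set (the unit sphere) is $c$-rich up to degree $d$; if $n\ge2$ the system has $c$-small proofs in degree $d$. -/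

import Mathlib

noncomputable section

open MeasureTheory
open scoped Classical

namespace SoS

/-- A finite system of polynomial constraints in the variables `σ`:
`p = 0` for `p ∈ eqs` and `q ≥ 0` for `q ∈ ineqs`. -/
structure PolySystem (σ : Type) where
  eqs : Finset (MvPolynomial σ ℝ)
  ineqs : Finset (MvPolynomial σ ℝ)

/-- The real points that satisfy all constraints. -/
def PolySystem.solutions {σ : Type} (sys : PolySystem σ) : Set (σ → ℝ) :=
  {α | (∀ p ∈ sys.eqs, MvPolynomial.eval α p = 0) ∧ ∀ q ∈ sys.ineqs, 0 ≤ MvPolynomial.eval α q}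

/-! ### Proofs -/

/-- `r` has a derivation `r = ∑ λ_p p` from `P` of degree at most `k`. -/
def HasDerivation {σ : Type} (P : Finset (MvPolynomial σ ℝ)) (r : MvPolynomial σ ℝ) (k : ℕ) :
    Prop :=
  ∃ lam : MvPolynomial σ ℝ → MvPolynomial σ ℝ,
    r = ∑ p ∈ P, lam p * p ∧ ∀ p ∈ P, (lam p * p).totalDegree ≤ k

/-- A sum-of-squares proof of non-negativity of `r`:
`r = ∑ h² + ∑_q (∑ s²) q + ∑_p λ_p p`. -/
structure SoSProof {σ : Type} (sys : PolySystem σ) (r : MvPolynomial σ ℝ) where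
  h : List (MvPolynomial σ ℝ)
  s : MvPolynomial σ ℝ → List (MvPolynomial σ ℝ)
  lam : MvPolynomial σ ℝ → MvPolynomial σ ℝ
  identity : r = (h.map (fun f => f ^ 2)).sum
    + ∑ q ∈ sys.ineqs, ((s q).map (fun f => f ^ 2)).sum * q
    + ∑ p ∈ sys.eqs, lam p * p

/-- All coefficients of `p` in the monomial basis have absolute value at most `B`. -/
def CoeffsLE {σ : Type} (p : MvPolynomial σ ℝ) (B : ℝ) : Prop :=
  ∀ m, |MvPolynomial.coeff m p| ≤ B

/-- The proof has degree at most `d`. -/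
def SoSProof.DegreeLE {σ : Type} {sys : PolySystem σ} {r : MvPolynomial σ ℝ}
    (π : SoSProof sys r) (d : ℕ) : Prop :=
  (∀ f ∈ π.h, (f ^ 2).totalDegree ≤ d) ∧
  (∀ q ∈ sys.ineqs, ∀ f ∈ π.s q, (f ^ 2 * q).totalDegree ≤ d) ∧
  (∀ p ∈ sys.eqs, (π.lam p * p).totalDegree ≤ d)

/-- Every polynomial appearing in the proof has coefficients of absolute value at most `B`. -/
def SoSProof.CoeffsLE {σ : Type} {sys : PolySystem σ} {r : MvPolynomial σ ℝ}
    (π : SoSProof sys r) (B : ℝ) : Prop :=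
  (∀ f ∈ π.h, SoS.CoeffsLE f B) ∧
  (∀ q ∈ sys.ineqs, ∀ f ∈ π.s q, SoS.CoeffsLE f B) ∧
  (∀ p ∈ sys.eqs, SoS.CoeffsLE (π.lam p) B)

/-- Each sum of squares in the proof has at most `L` summands. -/
def SoSProof.LengthLE {σ : Type} {sys : PolySystem σ} {r : MvPolynomial σ ℝ}
    (π : SoSProof sys r) (L : ℕ) : Prop :=
  π.h.length ≤ L ∧ ∀ q ∈ sys.ineqs, (π.s q).length ≤ L

/-! ### Rich sets of solutions -/

/-- Exponents of the monomials of degree at most `d`. -/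
abbrev Mon (σ : Type) (d : ℕ) : Type := {m : σ →₀ ℕ // m.degree ≤ d}

instance {σ : Type} [Fintype σ] (d : ℕ) : Finite (Mon σ d) := by
  refine Finite.of_injective
    (fun (m : Mon σ d) (i : σ) => (⟨m.1 i, ?_⟩ : Fin (d + 1))) ?_
  · exact Nat.lt_succ_of_le ((Finsupp.le_degree i m.1).trans m.2)
  · intro a b hab
    ext i
    simpa using congrArg Fin.val (congrFun hab i)

instance {σ : Type} [Fintype σ] (d : ℕ) : Fintype (Mon σ d) := Fintype.ofFinite _

/-- The value of the monomial `x^m` at `α`. -/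
def monEval {σ : Type} [Fintype σ] (α : σ → ℝ) (m : σ →₀ ℕ) : ℝ := ∏ i, α i ^ m i

/-- The moment matrix `E_{α ∼ μ} [v(α) v(α)ᵀ]`, where `v` is the vector of all monomials of degree
at most `d`. -/
def momentMatrix {σ : Type} [Fintype σ] (μ : Measure (σ → ℝ)) (d : ℕ) :
    Matrix (Mon σ d) (Mon σ d) ℝ :=
  Matrix.of fun a b => ∫ α, monEval α a.1 * monEval α b.1 ∂μ

/-- The polynomial `cᵀ v`. -/
def polyOf {σ : Type} [Fintype σ] {d : ℕ} (c : Mon σ d → ℝ) : MvPolynomial σ ℝ :=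
  ∑ m, MvPolynomial.monomial m.1 (c m)

/-- Every nonzero eigenvalue of the moment matrix is at least `δ`. -/
def SpectrallyRich {σ : Type} [Fintype σ] (μ : Measure (σ → ℝ)) (d : ℕ) (δ : ℝ) : Prop :=
  ∀ t : ℝ, Module.End.HasEigenvalue (Matrix.toLin' (momentMatrix μ d)) t → t ≠ 0 → δ ≤ t

/-- Every zero eigenvector of the moment matrix, seen as a polynomial, has a derivation of degree
at most `k` from the equality constraints. -/
def IsComplete {σ : Type} [Fintype σ] (sys : PolySystem σ) (μ : Measure (σ → ℝ)) (d k : ℕ) :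
    Prop :=
  ∀ c : Mon σ d → ℝ, (momentMatrix μ d).mulVec c = 0 → HasDerivation sys.eqs (polyOf c) k

/-- Every point of `S` satisfies every inequality constraint with slack more than `ε`. -/
def IsRobust {σ : Type} (sys : PolySystem σ) (S : Set (σ → ℝ)) (ε : ℝ) : Prop :=
  ∀ q ∈ sys.ineqs, ∀ α ∈ S, ε < MvPolynomial.eval α q

/-- `S` is a nonempty set of solutions that is `(δ, k, ε)`-rich for `sys` up to degree `d`, where
`μ` is the uniform distribution on `S`. -/
structure IsRich {σ : Type} [Fintype σ] (sys : PolySystem σ) (S : Set (σ → ℝ))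
    (μ : Measure (σ → ℝ)) (d : ℕ) (δ : ℝ) (k : ℕ) (ε : ℝ) : Prop where
  nonempty : S.Nonempty
  subset : S ⊆ sys.solutions
  spectral : SpectrallyRich μ d δ
  complete : IsComplete sys μ d k
  robust : IsRobust sys S ε

/-- The polynomial `c x ^ c` at `x = n ^ d`. For `x ≥ 1` such polynomials dominate all
polynomials. -/
def polySize (c n d : ℕ) : ℕ := c * (n ^ d) ^ c

/-- `S` is rich up to degree `d`, with the asymptotic bounds `1/δ, 1/ε = 2^{poly(n^d)}` and
`k = O(d)` witnessed by the constant `c`; here `n` is the number of variables. -/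
def RichUpTo {σ : Type} [Fintype σ] (c : ℕ) (sys : PolySystem σ) (S : Set (σ → ℝ))
    (μ : Measure (σ → ℝ)) (d : ℕ) : Prop :=
  ∃ (δ ε : ℝ) (k : ℕ), 0 < δ ∧ 0 < ε ∧
    1 / δ ≤ 2 ^ polySize c (Fintype.card σ) d ∧
    1 / ε ≤ 2 ^ polySize c (Fintype.card σ) d ∧
    k ≤ c * d ∧ IsRich sys S μ d δ k ε

/-- Every SoS proof of degree `d` from `sys` can be replaced by one of degree `O(d)` with
polynomially many squares and with coefficients bounded by `2^{poly(n^d)}` times the size of the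
coefficients of the polynomial that is proved nonnegative. -/
def SmallProofs {σ : Type} [Fintype σ] (c : ℕ) (sys : PolySystem σ) (d : ℕ) : Prop :=
  ∀ (r : MvPolynomial σ ℝ) (B : ℝ), 1 ≤ B → CoeffsLE r B →
    (∃ π : SoSProof sys r, π.DegreeLE d) →
    ∃ π : SoSProof sys r, π.DegreeLE (c * d) ∧
      π.CoeffsLE (B * 2 ^ polySize c (Fintype.card σ) d) ∧
      π.LengthLE (polySize c (Fintype.card σ) d)

/-! ### The constraint systems -/

/-- `x_i² - x_i` for all `i`. -/
def booleanEqs (σ : Type) [Fintype σ] : Finset (MvPolynomial σ ℝ) :=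
  Finset.univ.image fun i => MvPolynomial.X i ^ 2 - MvPolynomial.X i

def maxCSP (n : ℕ) : PolySystem (Fin n) where
  eqs := booleanEqs (Fin n)
  ineqs := ∅

def maxClique {n : ℕ} (G : SimpleGraph (Fin n)) : PolySystem (Fin n) where
  eqs := booleanEqs (Fin n) ∪
    (Finset.univ.filter fun e : Fin n × Fin n => e.1 ≠ e.2 ∧ ¬ G.Adj e.1 e.2).image
      fun e => MvPolynomial.X e.1 * MvPolynomial.X e.2
  ineqs := ∅

/-- The inequalities `2n/3 - ∑ x_i ≥ 0` and `∑ x_i - n/3 ≥ 0`, both relaxed by `η`. -/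
def balancedSeparator (n : ℕ) (η : ℝ) : PolySystem (Fin n) where
  eqs := booleanEqs (Fin n)
  ineqs := {MvPolynomial.C (2 * (n : ℝ) / 3 + η) - ∑ i, MvPolynomial.X i,
    ∑ i, MvPolynomial.X i - MvPolynomial.C ((n : ℝ) / 3 - η)}

/-- The edges of the complete graph on `n` vertices. -/
abbrev Edge (n : ℕ) : Type := {e : Sym2 (Fin n) // ¬ e.IsDiag}

/-- One variable per edge of the complete graph; the solutions are the perfect matchings. -/
def matching (n : ℕ) : PolySystem (Edge n) where
  eqs := booleanEqs (Edge n) ∪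
    (Finset.univ.image fun v : Fin n =>
      ∑ e ∈ Finset.univ.filter (fun e : Edge n => v ∈ e.1), MvPolynomial.X e - 1) ∪
    (Finset.univ.filter fun p : Edge n × Edge n =>
        p.1 ≠ p.2 ∧ ∃ v, v ∈ p.1.1 ∧ v ∈ p.2.1).image
      fun p => MvPolynomial.X p.1 * MvPolynomial.X p.2
  ineqs := ∅

def maxBisection (n : ℕ) : PolySystem (Fin n) where
  eqs := booleanEqs (Fin n) ∪ {∑ i, MvPolynomial.X i - MvPolynomial.C ((n : ℝ) / 2)}
  ineqs := ∅

def unitVector (n : ℕ) : PolySystem (Fin n) where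
  eqs := {∑ i, MvPolynomial.X i ^ 2 - 1}
  ineqs := ∅

/-- Normalized surface measure on the Euclidean unit sphere of `ℝⁿ`. -/
def sphereUniform (n : ℕ) : Measure (Fin n → ℝ) :=
  let ν := (volume : Measure (EuclideanSpace ℝ (Fin n))).toSphere
  ((ν Set.univ)⁻¹ • ν).map fun x i => x.1 i

end SoS

end

noncomputable section

open MeasureTheory
open scoped Classical

namespace SoS

set_option linter.unusedSectionVars false

/-! ### Linear systems with integer coefficients -/

/-! Richness yields small proofs by rebuilding a given proof in two stages. On S, which lies in the
cube [-1,1]^n, r is at most N·B, where N is the number of monomials of degree at most d. Hence Σ h²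
is at most N·B there, and each Σ s² is at most N·B/ε because q exceeds ε. By completeness every
square may be replaced, modulo derivations of low degree, by the square of a polynomial whose
coefficient vector is orthogonal to the kernel of M_S. There M_S is at least δ, so the expectation
of the sum over S bounds the trace of its Gram matrix G. Factoring G = RᵀR gives N squares with
bounded coefficients (`exists_bounded_squares`). The rest of r is a combination of the equations,
and its multipliers solve a linear system with an integer matrix. Such a system has a bounded
solution by Cramer's rule (`exists_bounded_solution`, `exists_bounded_derivation`). The two stages
meet in `smallProofs_core`.

The same Cramer bound gives δ: if L·M_S is an integer matrix with entries at most L, its nonzero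
eigenvalues cannot be too small (`one_le_abs_eigenvalue_mul`). For Boolean S one takes L = |S|; for
the sphere L = ∏_{j<d} (n+2j) clears the denominators of all moments of degree at most 2d, which are
found from Gaussian integrals in polar coordinates. With one variable the allowed bound does not
grow with d, and the eigenvalues are estimated directly.

Completeness is specific to each system. In the Boolean cases it starts from multilinear reduction.
Max-Clique: monomials on non-cliques are derivable, and Möbius inversion at the indicators of
cliques kills the others. Balanced Separator: a multilinear polynomial of degree d that vanishes on
d+1 consecutive slices is zero, by alternating sums over subcubes (`eq_zero_of_vanish_slices`).
Max-Bisection: multiplying by the linear constraint makes the polynomial homogeneous, and the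
inclusion maps between slices are injective in the lower half of the cube
(`eq_zero_of_vanish_slice`). Matching: the average of a vanishing polynomial over the permutations
of the vertices is zero, so it suffices to derive h - πh. This reduces to transpositions, and for
these to the same problem with two more vertices fixed (`locallyComplete`). Sphere: modulo the
equation a polynomial is a sum of two homogeneous ones of opposite parity; comparing antipodal
points shows that both vanish on the sphere, hence identically (`unitVector_complete`). -/

/-- The factor by which solving an integer linear system with `M` rows, `N` columns and entries of
absolute value at most `a` can blow up the right-hand side. -/
def cramerBound (M N : ℕ) (a : ℝ) : ℝ :=
  (N + 1) * N.factorial * ((M + 1) * a ^ 2) ^ N * ((M + 1) * a)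

/-- Cramer's rule for the normal equations AᵀA x = Aᵀb. The Gram matrix is integral and nonsingular,
so its determinant is at least 1 in absolute value and dividing by it costs nothing. Only the
entries of the adjugate need an upper bound. -/
lemma exists_bounded_solution_of_injective {m n : Type*} [Fintype m] [Fintype n]
    (A : Matrix m n ℤ) {a β : ℝ} (ha : 1 ≤ a) (hA : ∀ i j, |(A i j : ℝ)| ≤ a)
    (hinj : ∀ x : n → ℝ, (A.map (Int.cast : ℤ → ℝ)).mulVec x = 0 → x = 0)
    (b : m → ℝ) (hb : ∀ i, |b i| ≤ β) (hβ : 0 ≤ β) (x : n → ℝ)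
    (hx : (A.map (Int.cast : ℤ → ℝ)).mulVec x = b) (j : n) :
    |x j| ≤ cramerBound (Fintype.card m) (Fintype.card n) a * β := by
  set R := A.map (Int.cast : ℤ → ℝ) with hR
  set M : ℝ := (Fintype.card m : ℝ) with hM
  set N : ℕ := Fintype.card n with hN
  set G : Matrix n n ℤ := A.transpose * A with hG
  have hGR : G.map (Int.cast : ℤ → ℝ) = R.transpose * R := by
    ext i k; simp [hG, hR, Matrix.mul_apply]
  have hGdet : G.det ≠ 0 := by
    intro h0
    have h1 : (R.transpose * R).det = 0 := by
      rw [← hGR]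
      have := (Int.castRingHom ℝ).map_det G
      simp only [h0, map_zero] at this
      exact this.symm
    obtain ⟨v, hv, hv0⟩ := Matrix.exists_mulVec_eq_zero_iff.2 h1
    apply hv
    apply hinj
    have h2 : v ∈ LinearMap.ker (R.transpose * R).mulVecLin :=
      LinearMap.mem_ker.2 (by rw [Matrix.mulVecLin_apply]; exact hv0)
    rw [Matrix.ker_mulVecLin_transpose_mul_self] at h2
    simpa using h2
  have hM0 : 0 ≤ M := by positivity
  have hGent : ∀ i k, |(G i k : ℝ)| ≤ (M + 1) * a ^ 2 := by
    intro i k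
    have : (G i k : ℝ) = ∑ l, (A l i : ℝ) * A l k := by simp [hG, Matrix.mul_apply]
    rw [this]
    calc _ ≤ ∑ l, |(A l i : ℝ) * A l k| := Finset.abs_sum_le_sum_abs _ _
      _ ≤ ∑ l : m, a ^ 2 := by
        refine Finset.sum_le_sum fun l _ => ?_
        rw [abs_mul, pow_two]
        exact mul_le_mul (hA _ _) (hA _ _) (abs_nonneg _) (by linarith)
      _ = M * a ^ 2 := by simp [hM]
      _ ≤ _ := by gcongr; linarith
  have h1le : 1 ≤ (M + 1) * a ^ 2 := by
    have : 1 ≤ a ^ 2 := one_le_pow₀ ha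
    nlinarith
  have hadj : ∀ i k, |(G.adjugate i k : ℝ)| ≤ N.factorial * ((M + 1) * a ^ 2) ^ N := by
    intro i k
    -- An adjugate entry is the determinant after one row is replaced by a unit vector. Since
    -- (M+1)a² ≥ 1, the same bound covers the entries of that row.
    have h := Matrix.det_le (A := (G.map (Int.cast : ℤ → ℝ)).updateRow k (Pi.single i 1))
      (abv := AbsoluteValue.abs) (x := (M + 1) * a ^ 2) (by
        intro p q
        by_cases hp : p = k
        · subst hp
          simp only [Matrix.updateRow_self, AbsoluteValue.abs_apply, Pi.single_apply]
          split_ifs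
          · simpa using h1le
          · simp; linarith
        · simp only [Matrix.updateRow_ne hp]
          exact hGent p q)
    rw [← Matrix.adjugate_apply] at h
    have h3 : (G.map (Int.cast : ℤ → ℝ)).adjugate i k = (G.adjugate i k : ℝ) := by
      have := (Int.castRingHom ℝ).map_adjugate G
      have := congrFun (congrFun this i) k
      simpa using this.symm
    rw [h3] at h
    simpa [nsmul_eq_mul] using h
  have hsys : (G.map (Int.cast : ℤ → ℝ)).mulVec x = R.transpose.mulVec b := by
    rw [hGR, ← Matrix.mulVec_mulVec, hx]
  have hsol : ((G.det : ℝ)) * x j = ((G.adjugate.map (Int.cast : ℤ → ℝ)).mulVec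
      (R.transpose.mulVec b)) j := by
    rw [← hsys, Matrix.mulVec_mulVec]
    have : G.adjugate.map (Int.cast : ℤ → ℝ) * G.map (Int.cast : ℤ → ℝ) =
        (G.det : ℝ) • (1 : Matrix n n ℝ) := by
      ext i k
      have h := congrArg (Int.cast : ℤ → ℝ) (congrFun (congrFun (Matrix.adjugate_mul G) i) k)
      simpa [Matrix.mul_apply, Matrix.one_apply] using h
    rw [this, Matrix.smul_mulVec, Matrix.one_mulVec]
    simp
  have hrhs : ∀ k, |R.transpose.mulVec b k| ≤ (M + 1) * a * β := by
    intro k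
    calc |R.transpose.mulVec b k| = |∑ l, (A l k : ℝ) * b l| := by
          simp [Matrix.mulVec, dotProduct, hR]
      _ ≤ ∑ l, |(A l k : ℝ) * b l| := Finset.abs_sum_le_sum_abs _ _
      _ ≤ ∑ l : m, a * β := by
        refine Finset.sum_le_sum fun l _ => ?_
        rw [abs_mul]
        exact mul_le_mul (hA _ _) (hb _) (abs_nonneg _) (by linarith)
      _ = M * (a * β) := by simp [hM]
      _ ≤ _ := by nlinarith [mul_nonneg (by linarith : 0 ≤ a) hβ]
  have hdet1 : (1 : ℝ) ≤ |(G.det : ℝ)| := by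
    have := Int.one_le_abs hGdet
    exact_mod_cast this
  calc |x j| ≤ |(G.det : ℝ)| * |x j| := by nlinarith [abs_nonneg (x j)]
    _ = |(G.det : ℝ) * x j| := (abs_mul _ _).symm
    _ = |∑ k, (G.adjugate j k : ℝ) * (R.transpose.mulVec b k)| := by
        rw [hsol]; simp [Matrix.mulVec, dotProduct]
    _ ≤ ∑ k, |(G.adjugate j k : ℝ) * (R.transpose.mulVec b k)| := Finset.abs_sum_le_sum_abs _ _
    _ ≤ ∑ k : n, (N.factorial * ((M + 1) * a ^ 2) ^ N) * ((M + 1) * a * β) := by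
        refine Finset.sum_le_sum fun l _ => ?_
        rw [abs_mul]
        exact mul_le_mul (hadj _ _) (hrhs _) (abs_nonneg _) (by positivity)
    _ = N * ((N.factorial * ((M + 1) * a ^ 2) ^ N) * ((M + 1) * a * β)) := by simp [hN]
    _ ≤ (N + 1) * ((N.factorial * ((M + 1) * a ^ 2) ^ N) * ((M + 1) * a * β)) := by
        have : 0 ≤ (N.factorial * ((M + 1) * a ^ 2) ^ N) * ((M + 1) * a * β) := by positivity
        nlinarith
    _ = _ := by rw [cramerBound]; ring

lemma cramerBound_mono {M N N' : ℕ} {a : ℝ} (ha : 1 ≤ a) (h : N ≤ N') :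
    cramerBound M N a ≤ cramerBound M N' a := by
  have h1 : 1 ≤ ((M : ℝ) + 1) * a ^ 2 := by
    have : 1 ≤ a ^ 2 := one_le_pow₀ ha
    have : (0 : ℝ) ≤ M := by positivity
    nlinarith
  unfold cramerBound
  gcongr

lemma cramerBound_nonneg {M N : ℕ} {a : ℝ} (ha : 0 ≤ a) : 0 ≤ cramerBound M N a := by
  unfold cramerBound; positivity

/-- A solvable linear system with integer coefficients has a solution that is bounded in terms of
the right-hand side. -/
theorem exists_bounded_solution {m n : Type*} [Fintype m] [Fintype n]
    (A : Matrix m n ℤ) {a β : ℝ} (ha : 1 ≤ a) (hA : ∀ i j, |(A i j : ℝ)| ≤ a)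
    (b : m → ℝ) (hb : ∀ i, |b i| ≤ β) (hβ : 0 ≤ β)
    (hsol : ∃ x, (A.map (Int.cast : ℤ → ℝ)).mulVec x = b) :
    ∃ x, (A.map (Int.cast : ℤ → ℝ)).mulVec x = b ∧
      ∀ j, |x j| ≤ cramerBound (Fintype.card m) (Fintype.card n) a * β := by
  obtain ⟨x₀, hx₀⟩ := hsol
  set R := A.map (Int.cast : ℤ → ℝ) with hR
  -- A maximal independent set of columns spans the same space and makes the system injective; the
  -- unknowns of the other columns are set to zero.
  obtain ⟨J, e, he, hspan, hli⟩ := exists_linearIndependent' ℝ (fun j : n => R.col j)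
  let _ : Fintype J := Fintype.ofInjective e he
  have hbspan : b ∈ Submodule.span ℝ (Set.range ((fun j : n => R.col j) ∘ e)) := by
    rw [hspan, ← hx₀, ← Matrix.mulVecLin_apply]
    change _ ∈ Submodule.span ℝ (Set.range R.col)
    rw [← Matrix.range_mulVecLin]
    exact LinearMap.mem_range_self _ _
  obtain ⟨y, hy⟩ := (Submodule.mem_span_range_iff_exists_fun ℝ).1 hbspan
  set AJ : Matrix m J ℤ := A.submatrix id e with hAJ
  have hAJy : ∀ z : J → ℝ, (AJ.map (Int.cast : ℤ → ℝ)).mulVec z = ∑ j, z j • R.col (e j) := by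
    intro z
    ext i
    simp [hAJ, Matrix.mulVec, dotProduct, hR, mul_comm]
  have hbound := exists_bounded_solution_of_injective AJ ha (fun i j => hA i _)
    (by
      intro z hz
      rw [hAJy] at hz
      funext j
      exact (Fintype.linearIndependent_iff.1 hli) z hz j) b hb hβ y (by rw [hAJy, ← hy]; rfl)
  refine ⟨Function.extend e y 0, ?_, ?_⟩
  · rw [← hy]
    ext i
    simp only [Matrix.mulVec, dotProduct, Finset.sum_apply, Pi.smul_apply, smul_eq_mul]
    refine (Fintype.sum_of_injective e he _ _ ?_ ?_).symm
    · intro j hj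
      rw [Function.extend_apply' _ _ _ (by simpa using hj)]
      simp
    · intro j
      rw [he.extend_apply]
      simp [mul_comm]
  · intro j
    have hle : Fintype.card J ≤ Fintype.card n := Fintype.card_le_of_injective e he
    have h1 := cramerBound_mono (M := Fintype.card m) ha hle
    have h2 : 0 ≤ cramerBound (Fintype.card m) (Fintype.card n) a :=
      cramerBound_nonneg (by linarith)
    by_cases h : ∃ k, e k = j
    · obtain ⟨k, rfl⟩ := h
      rw [he.extend_apply]
      refine (hbound k).trans ?_
      gcongr
    · rw [Function.extend_apply' _ _ _ h]
      simp only [Pi.zero_apply, abs_zero]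
      positivity

/-- Nonzero eigenvalues of symmetric integer matrices are bounded away from zero. -/
theorem one_le_abs_eigenvalue_mul {n : Type*} [Fintype n] (A : Matrix n n ℤ)
    (hsymm : A.IsSymm) {a : ℝ} (ha : 1 ≤ a) (hA : ∀ i j, |(A i j : ℝ)| ≤ a)
    (t : ℝ) (ht : t ≠ 0) (c : n → ℝ) (hc : c ≠ 0)
    (hct : (A.map (Int.cast : ℤ → ℝ)).mulVec c = t • c) :
    1 ≤ |t| * (Fintype.card n * cramerBound (Fintype.card n) (Fintype.card n) a) := by
  set R := A.map (Int.cast : ℤ → ℝ) with hR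
  set K := cramerBound (Fintype.card n) (Fintype.card n) a with hK
  obtain ⟨i₀, hi₀⟩ := Function.ne_iff.1 hc
  obtain ⟨i, -, hi⟩ := Finset.exists_max_image Finset.univ (fun i => |c i|) ⟨i₀, Finset.mem_univ _⟩
  have hipos : 0 < |c i| := (abs_pos.2 hi₀).trans_le (hi i₀ (Finset.mem_univ _))
  -- The eigenvector c is in the range of A, with preimage t⁻¹c, but y is another preimage whose
  -- bound does not involve t. Then c·c = c·Ay = t(c·y) forces |t| to be large.
  obtain ⟨y, hy, hyb⟩ := exists_bounded_solution A ha hA c (β := |c i|)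
    (fun j => hi j (Finset.mem_univ _)) (abs_nonneg _)
    ⟨t⁻¹ • c, by rw [Matrix.mulVec_smul, hct, smul_smul, inv_mul_cancel₀ ht, one_smul]⟩
  have hRs : R.transpose = R := by
    rw [hR, ← Matrix.transpose_map, hsymm.eq]
  have key : c ⬝ᵥ c = t * (c ⬝ᵥ y) := by
    calc c ⬝ᵥ c = c ⬝ᵥ R.mulVec y := by rw [hy]
      _ = (R.mulVec c) ⬝ᵥ y := by
        rw [Matrix.dotProduct_mulVec, ← Matrix.mulVec_transpose, hRs]
      _ = t * (c ⬝ᵥ y) := by rw [hct, smul_dotProduct, smul_eq_mul]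
  have hlow : |c i| ^ 2 ≤ c ⬝ᵥ c := by
    have : |c i| ^ 2 = c i * c i := by rw [sq_abs, sq]
    rw [this]
    exact Finset.single_le_sum (f := fun j => c j * c j) (fun j _ => mul_self_nonneg _)
      (Finset.mem_univ i)
  have hup : |c ⬝ᵥ y| ≤ Fintype.card n * K * |c i| ^ 2 := by
    calc |c ⬝ᵥ y| ≤ ∑ j, |c j * y j| := Finset.abs_sum_le_sum_abs _ _
      _ ≤ ∑ j : n, |c i| * (K * |c i|) := by
        refine Finset.sum_le_sum fun l _ => ?_
        rw [abs_mul]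
        exact mul_le_mul (hi l (Finset.mem_univ _)) (hyb _) (abs_nonneg _) (abs_nonneg _)
      _ = _ := by simp only [Finset.sum_const, Finset.card_univ, nsmul_eq_mul]; ring
  have h3 : |c i| ^ 2 ≤ |t| * (Fintype.card n * K) * |c i| ^ 2 := by
    calc |c i| ^ 2 ≤ |c ⬝ᵥ c| := hlow.trans (le_abs_self _)
      _ = |t| * |c ⬝ᵥ y| := by rw [key, abs_mul]
      _ ≤ |t| * (Fintype.card n * K * |c i| ^ 2) := by gcongr
      _ = _ := by ring
  have h4 : 0 < |c i| ^ 2 := by positivity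
  by_contra hlt
  push Not at hlt
  nlinarith

variable {σ : Type} [Fintype σ]

/-! ### Moment matrices -/

lemma monEval_add (α : σ → ℝ) (a b : σ →₀ ℕ) :
    monEval α (a + b) = monEval α a * monEval α b := by
  simp [monEval, pow_add, Finset.prod_mul_distrib]

lemma eval_monomial_eq (α : σ → ℝ) (m : σ →₀ ℕ) (c : ℝ) :
    MvPolynomial.eval α (MvPolynomial.monomial m c) = c * monEval α m := by
  rw [MvPolynomial.eval_monomial, Finsupp.prod_fintype _ _ (by simp)]
  rfl

lemma eval_polyOf {d : ℕ} (c : Mon σ d → ℝ) (α : σ → ℝ) :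
    MvPolynomial.eval α (polyOf c) = ∑ m, c m * monEval α m.1 := by
  simp [polyOf, map_sum, eval_monomial_eq]

lemma coeff_polyOf {d : ℕ} (c : Mon σ d → ℝ) (m : σ →₀ ℕ) :
    MvPolynomial.coeff m (polyOf c) = if h : m.degree ≤ d then c ⟨m, h⟩ else 0 := by
  rw [polyOf, MvPolynomial.coeff_sum]
  simp only [MvPolynomial.coeff_monomial]
  split_ifs with h
  · rw [Finset.sum_eq_single (⟨m, h⟩ : Mon σ d)]
    · simp
    · intro b _ hb
      rw [if_neg]
      intro h2
      exact hb (Subtype.ext h2)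
    · simp
  · refine Finset.sum_eq_zero fun b _ => ?_
    rw [if_neg]
    rintro rfl
    exact h b.2

lemma totalDegree_le_iff {p : MvPolynomial σ ℝ} {d : ℕ} :
    p.totalDegree ≤ d ↔ ∀ m, MvPolynomial.coeff m p ≠ 0 → m.degree ≤ d := by
  rw [MvPolynomial.totalDegree, Finset.sup_le_iff]
  simp only [MvPolynomial.mem_support_iff]
  rfl

lemma totalDegree_polyOf_le {d : ℕ} (c : Mon σ d → ℝ) : (polyOf c).totalDegree ≤ d := by
  rw [totalDegree_le_iff]
  intro m hm
  rw [coeff_polyOf] at hm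
  by_contra h
  simp [h] at hm

lemma polyOf_coeff {d : ℕ} {p : MvPolynomial σ ℝ} (hp : p.totalDegree ≤ d) :
    polyOf (fun m : Mon σ d => MvPolynomial.coeff m.1 p) = p := by
  ext m
  rw [coeff_polyOf]
  split_ifs with h
  · rfl
  · by_contra h2
    exact h (totalDegree_le_iff.1 hp m (Ne.symm h2))

lemma polyOf_sub {d : ℕ} (c c' : Mon σ d → ℝ) : polyOf (c - c') = polyOf c - polyOf c' := by
  ext m
  simp only [MvPolynomial.coeff_sub, coeff_polyOf]
  split_ifs <;> simp

/-- `μ` is a probability measure on `S ⊆ [-1, 1]^σ` such that polynomials that vanish almost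
everywhere vanish on `S`. -/
structure Carries (μ : Measure (σ → ℝ)) (S : Set (σ → ℝ)) : Prop where
  prob : IsProbabilityMeasure μ
  mem : ∀ᵐ α ∂μ, α ∈ S
  le_one : ∀ α ∈ S, ∀ i, |α i| ≤ 1
  full : ∀ p : MvPolynomial σ ℝ, (∀ᵐ α ∂μ, MvPolynomial.eval α p = 0) →
    ∀ α ∈ S, MvPolynomial.eval α p = 0

lemma abs_monEval_le_one {α : σ → ℝ} (hα : ∀ i, |α i| ≤ 1) (m : σ →₀ ℕ) : |monEval α m| ≤ 1 := by
  rw [monEval, Finset.abs_prod]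
  refine Finset.prod_le_one (fun _ _ => abs_nonneg _) fun i _ => ?_
  rw [abs_pow]
  exact pow_le_one₀ (abs_nonneg _) (hα i)

lemma abs_eval_le {p : MvPolynomial σ ℝ} {d : ℕ} (hp : p.totalDegree ≤ d) {B : ℝ}
    (hB : CoeffsLE p B) {α : σ → ℝ} (hα : ∀ i, |α i| ≤ 1) :
    |MvPolynomial.eval α p| ≤ Fintype.card (Mon σ d) * B := by
  rw [← polyOf_coeff hp, eval_polyOf]
  calc _ ≤ ∑ m : Mon σ d, |MvPolynomial.coeff m.1 p * monEval α m.1| :=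
        Finset.abs_sum_le_sum_abs _ _
    _ ≤ ∑ m : Mon σ d, B := by
        refine Finset.sum_le_sum fun m _ => ?_
        rw [abs_mul]
        have h1 := abs_monEval_le_one hα m.1
        have h2 := hB m.1
        nlinarith [abs_nonneg (monEval α m.1), abs_nonneg (MvPolynomial.coeff m.1 p)]
    _ = _ := by simp

lemma exists_coeffsLE (p : MvPolynomial σ ℝ) : ∃ B : ℝ, 0 ≤ B ∧ CoeffsLE p B := by
  refine ⟨∑ m ∈ p.support, |MvPolynomial.coeff m p|, by positivity, fun m => ?_⟩
  by_cases hm : m ∈ p.support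
  · exact Finset.single_le_sum (f := fun m => |MvPolynomial.coeff m p|)
      (fun _ _ => abs_nonneg _) hm
  · rw [MvPolynomial.notMem_support_iff.1 hm, abs_zero]
    positivity

variable {μ : Measure (σ → ℝ)} {S : Set (σ → ℝ)}

lemma Carries.integrable (h : Carries μ S) (p : MvPolynomial σ ℝ) :
    Integrable (fun α => MvPolynomial.eval α p) μ := by
  have := h.prob
  obtain ⟨B, -, hB⟩ := exists_coeffsLE p
  refine Integrable.of_bound (C := Fintype.card (Mon σ p.totalDegree) * B) ?_ ?_
  · exact (MvPolynomial.continuous_eval p).aestronglyMeasurable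
  · filter_upwards [h.mem] with α hα
    exact abs_eval_le le_rfl hB (h.le_one α hα)

lemma Carries.integrable_monEval_mul (h : Carries μ S) (a b : σ →₀ ℕ) :
    Integrable (fun α => monEval α a * monEval α b) μ := by
  have := h.integrable (MvPolynomial.monomial (a + b) 1)
  simpa only [eval_monomial_eq, one_mul, monEval_add] using this

lemma Carries.mulVec_apply (h : Carries μ S) {d : ℕ} (c : Mon σ d → ℝ) (m : Mon σ d) :
    (momentMatrix μ d).mulVec c m = ∫ α, monEval α m.1 * MvPolynomial.eval α (polyOf c) ∂μ := by
  simp only [Matrix.mulVec, dotProduct, momentMatrix, Matrix.of_apply, eval_polyOf,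
    Finset.mul_sum]
  rw [integral_finsetSum]
  · refine Finset.sum_congr rfl fun i _ => ?_
    rw [← integral_mul_const]
    congr 1
    funext α
    ring
  · intro i _
    refine ((h.integrable_monEval_mul m.1 i.1).const_mul (c i)).congr ?_
    filter_upwards with α
    ring

lemma Carries.dotProduct_mulVec (h : Carries μ S) {d : ℕ} (c c' : Mon σ d → ℝ) :
    c' ⬝ᵥ (momentMatrix μ d).mulVec c =
      ∫ α, MvPolynomial.eval α (polyOf c') * MvPolynomial.eval α (polyOf c) ∂μ := by
  simp only [dotProduct, h.mulVec_apply]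
  simp only [eval_polyOf c', Finset.sum_mul]
  rw [integral_finsetSum]
  · refine Finset.sum_congr rfl fun i _ => ?_
    rw [← integral_const_mul]
    congr 1
    funext α
    ring
  · intro i _
    refine ((h.integrable (MvPolynomial.monomial i.1 (c' i) * polyOf c))).congr ?_
    filter_upwards with α
    rw [map_mul, eval_monomial_eq]

lemma Carries.integral_sq_nonneg (p : MvPolynomial σ ℝ) :
    0 ≤ ∫ α, MvPolynomial.eval α p * MvPolynomial.eval α p ∂μ :=
  integral_nonneg fun _ => mul_self_nonneg _

lemma Carries.eq_zero_of_integral_sq (h : Carries μ S) {p : MvPolynomial σ ℝ}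
    (hp : ∫ α, MvPolynomial.eval α p * MvPolynomial.eval α p ∂μ = 0) :
    ∀ α ∈ S, MvPolynomial.eval α p = 0 := by
  refine h.full p ?_
  rw [integral_eq_zero_iff_of_nonneg (fun _ => mul_self_nonneg _)] at hp
  · filter_upwards [hp] with α hα
    simpa using hα
  · simpa only [map_mul] using h.integrable (p * p)

/-- The quadratic form of the moment matrix at c is the expectation of the square of `polyOf c`. A
kernel vector is therefore a polynomial that vanishes on S, which turns completeness into a question
about vanishing polynomials. -/
lemma Carries.eq_zero_of_mulVec (h : Carries μ S) {d : ℕ} {c : Mon σ d → ℝ}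
    (hc : (momentMatrix μ d).mulVec c = 0) : ∀ α ∈ S, MvPolynomial.eval α (polyOf c) = 0 := by
  refine h.eq_zero_of_integral_sq ?_
  rw [← h.dotProduct_mulVec, hc, dotProduct_zero]

lemma hasEigenvalue_iff {ι : Type*} [Fintype ι] [DecidableEq ι] (A : Matrix ι ι ℝ) (t : ℝ) :
    Module.End.HasEigenvalue (Matrix.toLin' A) t ↔ ∃ c, c ≠ 0 ∧ A.mulVec c = t • c := by
  constructor
  · intro h
    obtain ⟨c, hc⟩ := h.exists_hasEigenvector
    exact ⟨c, hc.2, by simpa using hc.apply_eq_smul⟩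
  · rintro ⟨c, hc0, hc⟩
    exact Module.End.hasEigenvalue_of_hasEigenvector (x := c)
      ⟨Module.End.mem_eigenspace_iff.2 (by simpa using hc), hc0⟩

lemma dotProduct_self_pos' {ι : Type*} [Fintype ι] {c : ι → ℝ} (hc : c ≠ 0) : 0 < c ⬝ᵥ c := by
  refine lt_of_le_of_ne (Finset.sum_nonneg fun i _ => mul_self_nonneg _) ?_
  intro h
  exact hc (dotProduct_self_eq_zero.1 h.symm)

lemma Carries.eigenvalue_nonneg (h : Carries μ S) {d : ℕ} {c : Mon σ d → ℝ} {t : ℝ} (hc : c ≠ 0)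
    (hct : (momentMatrix μ d).mulVec c = t • c) : 0 ≤ t := by
  have h1 := h.dotProduct_mulVec c c
  rw [hct, dotProduct_smul, smul_eq_mul] at h1
  have h2 := Carries.integral_sq_nonneg (μ := μ) (polyOf c)
  rw [← h1] at h2
  exact nonneg_of_mul_nonneg_left h2 (dotProduct_self_pos' hc)

lemma mon_zero_val {σ : Type} (a : Mon σ 0) : a.1 = 0 :=
  (Finsupp.degree_eq_zero_iff _).1 (Nat.le_zero.1 a.2)

lemma Carries.momentMatrix_zero (h : Carries μ S) : momentMatrix μ 0 = 1 := by
  have := h.prob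
  ext a b
  have hab : a = b := Subtype.ext ((mon_zero_val a).trans (mon_zero_val b).symm)
  subst hab
  simp [momentMatrix, monEval, mon_zero_val a]

/-- Degree zero is separate because n^0 = 1: the allowed bound 2^c is then constant, whereas the
general estimate depends on |S|, which can be as large as 2^n. -/
lemma Carries.spectrallyRich_zero (h : Carries μ S) : SpectrallyRich μ 0 1 := by
  intro t ht _
  obtain ⟨c, hc, hct⟩ := (hasEigenvalue_iff _ _).1 ht
  rw [h.momentMatrix_zero, Matrix.one_mulVec] at hct
  obtain ⟨i, hi⟩ := Function.ne_iff.1 hc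
  have := congrFun hct i
  simp only [Pi.smul_apply, smul_eq_mul] at this
  have h2 : (1 - t) * c i = 0 := by linarith
  rcases mul_eq_zero.1 h2 with h3 | h3
  · linarith
  · exact absurd h3 hi

/-- If `L` times the moment matrix is integral, then its nonzero eigenvalues are bounded below. -/
lemma Carries.spectrallyRich_of_integral (h : Carries μ S) (d L : ℕ) (hL : 1 ≤ L)
    (hinteg : ∀ m : σ →₀ ℕ, m.degree ≤ 2 * d → ∃ z : ℤ, (z : ℝ) = L * ∫ α, monEval α m ∂μ) :
    SpectrallyRich μ d (1 / (L * (Fintype.card (Mon σ d) *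
      cramerBound (Fintype.card (Mon σ d)) (Fintype.card (Mon σ d)) L))) := by
  intro t ht ht0
  have := h.prob
  obtain ⟨c, hc, hct⟩ := (hasEigenvalue_iff _ _).1 ht
  have hdeg : ∀ a b : Mon σ d, (a.1 + b.1).degree ≤ 2 * d := by
    intro a b
    have := a.2
    have := b.2
    rw [map_add]
    omega
  choose! z hz using hinteg
  -- This is L times the moment matrix. Its entries are at most L because monomials are bounded by 1
  -- on S.
  set A : Matrix (Mon σ d) (Mon σ d) ℤ := Matrix.of fun a b => z (a.1 + b.1) with hA
  have hAM : A.map (Int.cast : ℤ → ℝ) = (L : ℝ) • momentMatrix μ d := by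
    ext a b
    simp only [hA, Matrix.map_apply, Matrix.of_apply, Matrix.smul_apply, smul_eq_mul, momentMatrix,
      ← monEval_add]
    exact hz _ (hdeg a b)
  have hLr : (1 : ℝ) ≤ L := by exact_mod_cast hL
  have hAle : ∀ a b, |(A a b : ℝ)| ≤ L := by
    intro a b
    have h1 : (A a b : ℝ) = L * ∫ α, monEval α (a.1 + b.1) ∂μ := hz _ (hdeg a b)
    have h2 : ‖∫ α, monEval α (a.1 + b.1) ∂μ‖ ≤ 1 * μ.real Set.univ := by
      refine norm_integral_le_of_norm_le_const ?_
      filter_upwards [h.mem] with α hα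
      exact abs_monEval_le_one (h.le_one α hα) _
    simp only [probReal_univ, mul_one, Real.norm_eq_abs] at h2
    rw [h1, abs_mul, abs_of_nonneg (by linarith : (0 : ℝ) ≤ L)]
    nlinarith
  have key := one_le_abs_eigenvalue_mul A
    (by
      ext a b
      simp only [hA, Matrix.transpose_apply, Matrix.of_apply]
      rw [add_comm]) hLr hAle (L * t) (mul_ne_zero (by linarith) ht0) c hc
    (by rw [hAM, Matrix.smul_mulVec, hct, smul_smul])
  have ht1 := h.eigenvalue_nonneg hc hct
  rw [abs_of_nonneg (by positivity)] at key
  set X := (Fintype.card (Mon σ d) *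
      cramerBound (Fintype.card (Mon σ d)) (Fintype.card (Mon σ d)) L) with hX
  have hX0 : 0 ≤ X := by
    have := cramerBound_nonneg (M := Fintype.card (Mon σ d)) (N := Fintype.card (Mon σ d))
      (a := L) (by linarith)
    positivity
  have hXpos : 0 < L * X := by
    rcases hX0.lt_or_eq with h0 | h0
    · positivity
    · rw [← h0] at key
      simp at key
      linarith
  rw [div_le_iff₀ hXpos]
  linarith

/-! ### The space of derivable polynomials -/

/-- The polynomials that have a derivation of degree at most `k`. -/
def derivs {σ : Type} (P : Finset (MvPolynomial σ ℝ)) (k : ℕ) :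
    Submodule ℝ (MvPolynomial σ ℝ) where
  carrier := {r | HasDerivation P r k}
  add_mem' := by
    rintro a b ⟨l, ha, hla⟩ ⟨l', hb, hlb⟩
    refine ⟨l + l', ?_, fun p hp => ?_⟩
    · rw [ha, hb, ← Finset.sum_add_distrib]
      exact Finset.sum_congr rfl fun p _ => by simp [add_mul]
    · rw [Pi.add_apply, add_mul]
      exact (MvPolynomial.totalDegree_add _ _).trans (max_le (hla p hp) (hlb p hp))
  zero_mem' := ⟨0, by simp, by simp⟩
  smul_mem' := by
    rintro t a ⟨l, ha, hla⟩
    refine ⟨t • l, ?_, fun p hp => ?_⟩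
    · rw [ha, Finset.smul_sum]
      exact Finset.sum_congr rfl fun p _ => by simp
    · rw [Pi.smul_apply, smul_mul_assoc]
      exact (MvPolynomial.totalDegree_smul_le _ _).trans (hla p hp)

section Derivs

variable {σ : Type} {P : Finset (MvPolynomial σ ℝ)} {k l : ℕ}

lemma derivs_mono (h : k ≤ l) : derivs P k ≤ derivs P l := by
  rintro r ⟨lam, h1, h2⟩
  exact ⟨lam, h1, fun p hp => (h2 p hp).trans h⟩

lemma mul_mem_derivs_of_mem {p : MvPolynomial σ ℝ} (hp : p ∈ P) (g : MvPolynomial σ ℝ)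
    (hg : (g * p).totalDegree ≤ k) : g * p ∈ derivs P k := by
  refine ⟨fun q => if q = p then g else 0, ?_, fun q _ => ?_⟩
  · rw [Finset.sum_eq_single p]
    · simp
    · intro q _ hq
      simp [hq]
    · exact fun h => absurd hp h
  · dsimp only
    split_ifs with h
    · rwa [h]
    · simp

lemma mul_mem_derivs {r : MvPolynomial σ ℝ} (hr : r ∈ derivs P k) (g : MvPolynomial σ ℝ)
    (hg : g.totalDegree + k ≤ l) : g * r ∈ derivs P l := by
  obtain ⟨lam, h1, h2⟩ := hr
  refine ⟨fun p => g * lam p, ?_, fun p hp => ?_⟩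
  · rw [h1, Finset.mul_sum]
    exact Finset.sum_congr rfl fun p _ => by ring
  · have := h2 p hp
    rw [mul_assoc]
    exact (MvPolynomial.totalDegree_mul _ _).trans (by omega)

lemma eval_eq_zero_of_mem_derivs {r : MvPolynomial σ ℝ} (hr : r ∈ derivs P k) {α : σ → ℝ}
    (hα : ∀ p ∈ P, MvPolynomial.eval α p = 0) : MvPolynomial.eval α r = 0 := by
  obtain ⟨lam, h1, -⟩ := hr
  rw [h1, map_sum]
  exact Finset.sum_eq_zero fun p hp => by rw [map_mul, hα p hp, mul_zero]

end Derivs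

/-! ### Size estimates -/

/-- A monomial of degree at most d is a product of d factors, each of which is a variable or 1. -/
lemma card_mon_le (σ : Type) [Fintype σ] (d : ℕ) :
    Fintype.card (Mon σ d) ≤ (Fintype.card σ + 1) ^ d := by
  have hsurj : ∀ m : Mon σ d, ∃ f : Fin d → Option σ,
      m.1 = ∑ i, (f i).elim 0 (fun j => Finsupp.single j 1) := by
    suffices H : ∀ (d : ℕ) (m : σ →₀ ℕ), m.degree ≤ d → ∃ f : Fin d → Option σ,
        m = ∑ i, (f i).elim 0 (fun j => Finsupp.single j 1) from fun m => H d m.1 m.2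
    intro d
    induction d with
    | zero =>
      intro m hm
      refine ⟨fun _ => none, ?_⟩
      simpa [Finsupp.degree_eq_zero_iff] using hm
    | succ d ih =>
      intro m hm
      by_cases h0 : m = 0
      · refine ⟨fun _ => none, ?_⟩
        simp [h0]
      · obtain ⟨j, hj⟩ := Finsupp.ne_iff.1 h0
        have hle : Finsupp.single j 1 ≤ m := by
          rw [Finsupp.single_le_iff]
          simp only [Finsupp.coe_zero, Pi.zero_apply] at hj
          omega
        obtain ⟨m', hm'⟩ := exists_add_of_le hle
        obtain ⟨f, hf⟩ := ih m' (by
          rw [hm', map_add, Finsupp.degree_single] at hm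
          omega)
        refine ⟨Fin.cons (some j) f, ?_⟩
        rw [Fin.sum_univ_succ]
        simp only [Fin.cons_zero, Fin.cons_succ, ← hf]
        exact hm'
  choose f hf using hsurj
  have : Function.Injective f := fun a b hab => Subtype.ext (by rw [hf a, hf b, hab])
  calc _ ≤ Fintype.card (Fin d → Option σ) := Fintype.card_le_of_injective f this
    _ = _ := by simp

/-! ### Spectral decomposition of real symmetric matrices -/

lemma exists_orthogonal_diagonalization {ι : Type*} [Fintype ι] (M : Matrix ι ι ℝ)
    (hM : M.IsHermitian) : ∃ (U : Matrix ι ι ℝ) (ev : ι → ℝ), U.transpose * U = 1 ∧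
      U * U.transpose = 1 ∧ M = U * Matrix.diagonal ev * U.transpose := by
  refine ⟨hM.eigenvectorUnitary, hM.eigenvalues, ?_, ?_, ?_⟩
  · exact Unitary.coe_star_mul_self hM.eigenvectorUnitary
  · exact Unitary.coe_mul_star_self hM.eigenvectorUnitary
  · have h := hM.spectral_theorem
    rw [Unitary.conjStarAlgAut_apply] at h
    exact h

lemma hasEigenvalue_of_diagonalization {ι : Type*} [Fintype ι] {M U : Matrix ι ι ℝ} {ev : ι → ℝ}
    (h1 : U.transpose * U = 1) (hM : M = U * Matrix.diagonal ev * U.transpose) (i : ι) :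
    ∃ c, c ≠ 0 ∧ M.mulVec c = ev i • c := by
  have hinj : ∀ v, U.transpose.mulVec (U.mulVec v) = v := fun v => by
    rw [Matrix.mulVec_mulVec, h1, Matrix.one_mulVec]
  refine ⟨U.mulVec (Pi.single i 1), ?_, ?_⟩
  · intro h
    have := hinj (Pi.single i 1)
    rw [h, Matrix.mulVec_zero] at this
    have := congrFun this i
    simp at this
  · rw [hM, ← Matrix.mulVec_mulVec, hinj, ← Matrix.mulVec_mulVec, ← Matrix.mulVec_smul]
    congr 1
    ext j
    simp only [Matrix.mulVec_diagonal, Pi.single_apply, Pi.smul_apply, smul_eq_mul, mul_ite, mul_one,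
      mul_zero]
    split_ifs with h
    · rw [h]
    · rfl

/-- Every vector agrees modulo the kernel of `M` with one on which `M` is at least `δ`. -/
lemma exists_sub_mem_ker {ι : Type*} [Fintype ι] (M : Matrix ι ι ℝ) (hM : M.IsHermitian) {δ : ℝ}
    (hδ : ∀ t, (∃ c, c ≠ 0 ∧ M.mulVec c = t • c) → t ≠ 0 → δ ≤ t) (c : ι → ℝ) :
    ∃ c', M.mulVec c' = M.mulVec c ∧ δ * (c' ⬝ᵥ c') ≤ c' ⬝ᵥ M.mulVec c' := by
  obtain ⟨U, ev, h1, h2, h3⟩ := exists_orthogonal_diagonalization M hM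
  have hev := fun i => hδ (ev i) (hasEigenvalue_of_diagonalization h1 h3 i)
  set a := U.transpose.mulVec c with ha
  -- In eigencoordinates, the components of c along the kernel are dropped.
  set b : ι → ℝ := fun i => if ev i = 0 then 0 else a i with hb
  have hMv : ∀ v, M.mulVec v = U.mulVec ((Matrix.diagonal ev).mulVec (U.transpose.mulVec v)) := by
    intro v
    rw [h3, Matrix.mulVec_mulVec, Matrix.mulVec_mulVec, Matrix.mul_assoc]
  have hUb : U.transpose.mulVec (U.mulVec b) = b := by
    rw [Matrix.mulVec_mulVec, h1, Matrix.one_mulVec]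
  have hdot : ∀ v w : ι → ℝ, U.mulVec v ⬝ᵥ U.mulVec w = v ⬝ᵥ w := by
    intro v w
    rw [Matrix.dotProduct_mulVec, ← Matrix.mulVec_transpose, Matrix.mulVec_mulVec, h1,
      Matrix.one_mulVec]
  have hD : (Matrix.diagonal ev).mulVec b = (Matrix.diagonal ev).mulVec a := by
    ext i
    simp only [Matrix.mulVec_diagonal, hb]
    split_ifs with h
    · rw [h]; simp
    · rfl
  refine ⟨U.mulVec b, ?_, ?_⟩
  · rw [hMv, hMv c, hUb, hD]
  · rw [hMv, hUb, hdot, hdot, dotProduct, dotProduct, Finset.mul_sum]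
    refine Finset.sum_le_sum fun i _ => ?_
    rw [Matrix.mulVec_diagonal]
    by_cases h : ev i = 0
    · simp [hb, h]
    · nlinarith [hev i h, mul_self_nonneg (b i)]

lemma exists_transpose_mul_self {ι : Type*} [Fintype ι] (G : Matrix ι ι ℝ) (hG : G.PosSemidef) :
    ∃ R : Matrix ι ι ℝ, G = R.transpose * R := by
  obtain ⟨U, ev, h1, h2, h3⟩ := exists_orthogonal_diagonalization G hG.1
  have hev : ∀ i, 0 ≤ ev i := by
    intro i
    obtain ⟨c, hc, hct⟩ := hasEigenvalue_of_diagonalization h1 h3 i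
    have h4 := hG.dotProduct_mulVec_nonneg c
    rw [hct] at h4
    simp only [star_trivial, dotProduct_smul, smul_eq_mul] at h4
    exact nonneg_of_mul_nonneg_left h4 (dotProduct_self_pos' hc)
  refine ⟨Matrix.diagonal (fun i => Real.sqrt (ev i)) * U.transpose, ?_⟩
  rw [Matrix.transpose_mul, Matrix.transpose_transpose, Matrix.diagonal_transpose, Matrix.mul_assoc,
    ← Matrix.mul_assoc (Matrix.diagonal _) (Matrix.diagonal _), Matrix.diagonal_mul_diagonal, h3,
    Matrix.mul_assoc]
  simp only [Real.mul_self_sqrt (hev _)]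

variable {σ : Type} [Fintype σ] {μ : Measure (σ → ℝ)} {S : Set (σ → ℝ)}

/-! ### Expectations of polynomials -/

/-- The expectation of a polynomial, as a linear functional. -/
def Carries.expect (h : Carries μ S) : MvPolynomial σ ℝ →ₗ[ℝ] ℝ where
  toFun p := ∫ α, MvPolynomial.eval α p ∂μ
  map_add' p q := by
    simp only [map_add]
    exact integral_add (h.integrable p) (h.integrable q)
  map_smul' t p := by
    simp only [MvPolynomial.smul_eval, RingHom.id_apply, smul_eq_mul]
    exact integral_const_mul _ _

lemma Carries.expect_mono (h : Carries μ S) {p q : MvPolynomial σ ℝ}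
    (hpq : ∀ α ∈ S, MvPolynomial.eval α p ≤ MvPolynomial.eval α q) :
    h.expect p ≤ h.expect q := by
  refine integral_mono_ae (h.integrable p) (h.integrable q) ?_
  filter_upwards [h.mem] with α hα using hpq α hα

lemma Carries.expect_C (h : Carries μ S) (t : ℝ) : h.expect (MvPolynomial.C t) = t := by
  have := h.prob
  simp [Carries.expect]

lemma Carries.dotProduct_mulVec_self (h : Carries μ S) {d : ℕ} (c : Mon σ d → ℝ) :
    c ⬝ᵥ (momentMatrix μ d).mulVec c = h.expect (polyOf c ^ 2) := by
  rw [h.dotProduct_mulVec]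
  simp [Carries.expect, sq]

lemma Carries.isHermitian (d : ℕ) : (momentMatrix μ d).IsHermitian := by
  ext a b
  simp [momentMatrix, mul_comm]

/-! ### Bounded sums of squares -/

/-- The polynomial `vᵀ G v`, where `v` is the vector of monomials. -/
def quadForm {d : ℕ} (G : Matrix (Mon σ d) (Mon σ d) ℝ) : MvPolynomial σ ℝ :=
  ∑ a, ∑ b, G a b • (MvPolynomial.monomial a.1 1 * MvPolynomial.monomial b.1 1)

lemma quadForm_add {d : ℕ} (G H : Matrix (Mon σ d) (Mon σ d) ℝ) :
    quadForm (G + H) = quadForm G + quadForm H := by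
  simp [quadForm, add_smul, Finset.sum_add_distrib]

lemma quadForm_zero {d : ℕ} : quadForm (0 : Matrix (Mon σ d) (Mon σ d) ℝ) = 0 := by
  simp [quadForm]

lemma polyOf_eq_sum_smul {d : ℕ} (c : Mon σ d → ℝ) :
    polyOf c = ∑ a, c a • MvPolynomial.monomial a.1 1 := by
  simp [polyOf, MvPolynomial.smul_monomial]

lemma quadForm_vecMulVec {d : ℕ} (c : Mon σ d → ℝ) :
    quadForm (Matrix.vecMulVec c c) = polyOf c ^ 2 := by
  rw [polyOf_eq_sum_smul, sq, Finset.sum_mul_sum, quadForm]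
  refine Finset.sum_congr rfl fun a _ => Finset.sum_congr rfl fun b _ => ?_
  rw [Matrix.vecMulVec_apply, smul_mul_smul_comm]

lemma quadForm_transpose_mul {d : ℕ} (R : Matrix (Mon σ d) (Mon σ d) ℝ) :
    quadForm (R.transpose * R) = ∑ i, polyOf (R i) ^ 2 := by
  have h : R.transpose * R = ∑ i, Matrix.vecMulVec (R i) (R i) := by
    ext a b
    simp [Matrix.mul_apply, Matrix.sum_apply, Matrix.vecMulVec_apply]
  rw [h]
  simp only [← quadForm_vecMulVec]
  exact map_sum (AddMonoidHom.mk' quadForm quadForm_add) _ _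

/-- A sum of squares with bounded expectation is, modulo derivable polynomials, a sum of few
squares of polynomials with bounded coefficients. -/
lemma exists_bounded_squares (hC : Carries μ S) {sys : PolySystem σ} {d k : ℕ} {δ : ℝ} (hδ : 0 < δ)
    (hspec : SpectrallyRich μ d δ) (hcomp : IsComplete sys μ d k)
    (h : List (MvPolynomial σ ℝ)) (hdeg : ∀ f ∈ h, f.totalDegree ≤ d) {τ : ℝ}
    (hτ : hC.expect (h.map (fun f => f ^ 2)).sum ≤ τ) :
    ∃ h' : List (MvPolynomial σ ℝ), h'.length = Fintype.card (Mon σ d) ∧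
      (∀ f ∈ h', f.totalDegree ≤ d ∧ CoeffsLE f (Real.sqrt (τ / δ))) ∧
      (h.map (fun f => f ^ 2)).sum - (h'.map (fun f => f ^ 2)).sum ∈ derivs sys.eqs (k + d) := by
  have hspec' : ∀ t, (∃ c, c ≠ 0 ∧ (momentMatrix μ d).mulVec c = t • c) → t ≠ 0 → δ ≤ t :=
    fun t ht ht0 => hspec t ((hasEigenvalue_iff _ _).2 ht) ht0
  -- G collects the Gram matrices c'c'ᵀ of the squares after their kernel parts are removed. Its
  -- size does not depend on the number of squares in `h`, so refactoring G leaves one square per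
  -- monomial.
  have key : ∃ G : Matrix (Mon σ d) (Mon σ d) ℝ, G.PosSemidef ∧
      δ * G.trace ≤ hC.expect (h.map (fun f => f ^ 2)).sum ∧
      (h.map (fun f => f ^ 2)).sum - quadForm G ∈ derivs sys.eqs (k + d) := by
    clear hτ
    induction h with
    | nil =>
      refine ⟨0, Matrix.PosSemidef.zero, by simp, ?_⟩
      rw [quadForm_zero]
      simp
    | cons f h ih =>
      obtain ⟨G, hG, htr, hmem⟩ := ih fun g hg => hdeg g (List.mem_cons_of_mem _ hg)
      have hf := hdeg f List.mem_cons_self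
      set c : Mon σ d → ℝ := fun m => MvPolynomial.coeff m.1 f with hc
      have hcf : polyOf c = f := polyOf_coeff hf
      obtain ⟨c', hc', hc'd⟩ := exists_sub_mem_ker _ (Carries.isHermitian (μ := μ) d) hspec' c
      have hker : polyOf c - polyOf c' ∈ derivs sys.eqs k := by
        rw [← polyOf_sub]
        exact hcomp _ (by rw [Matrix.mulVec_sub, hc', sub_self])
      have hsq : polyOf c ^ 2 - polyOf c' ^ 2 ∈ derivs sys.eqs (k + d) := by
        -- The difference c - c' has a derivation of degree k, and the cofactor c + c' adds at most
        -- d.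
        have : polyOf c ^ 2 - polyOf c' ^ 2 =
            (polyOf c + polyOf c') * (polyOf c - polyOf c') := by ring
        rw [this]
        refine mul_mem_derivs hker _ ?_
        have h1 := totalDegree_polyOf_le c
        have h2 := totalDegree_polyOf_le c'
        have h3 := MvPolynomial.totalDegree_add (polyOf c) (polyOf c')
        have h4 : max (polyOf c).totalDegree (polyOf c').totalDegree ≤ d := max_le h1 h2
        omega
      have hexp : hC.expect (polyOf c' ^ 2) = hC.expect (f ^ 2) := by
        have hh : hC.expect (polyOf c ^ 2) = c' ⬝ᵥ (momentMatrix μ d).mulVec c' := by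
          rw [hc', hC.dotProduct_mulVec, ← hC.dotProduct_mulVec_self, ← hc', hC.dotProduct_mulVec]
          congr 1
          funext α
          ring
        rw [← hC.dotProduct_mulVec_self, ← hh, hcf]
      refine ⟨Matrix.vecMulVec c' c' + G, ?_, ?_, ?_⟩
      · exact (by simpa using Matrix.posSemidef_vecMulVec_self_star c' :
          (Matrix.vecMulVec c' c').PosSemidef).add hG
      · rw [Matrix.trace_add, Matrix.trace_vecMulVec, mul_add, List.map_cons, List.sum_cons, map_add,
          ← hexp, ← hC.dotProduct_mulVec_self]
        linarith
      · rw [quadForm_add, quadForm_vecMulVec, List.map_cons, List.sum_cons, ← hcf]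
        have := add_mem hsq hmem
        convert this using 1
        ring
  obtain ⟨G, hG, htr, hmem⟩ := key
  obtain ⟨R, hR⟩ := exists_transpose_mul_self G hG
  refine ⟨(Finset.univ.toList).map fun i => polyOf (R i), ?_, ?_, ?_⟩
  · simp
  · intro f hf
    obtain ⟨i, -, rfl⟩ := List.mem_map.1 hf
    refine ⟨totalDegree_polyOf_le _, fun m => ?_⟩
    rw [coeff_polyOf]
    split_ifs with hm
    · refine Real.abs_le_sqrt ?_
      have h1 : R i ⟨m, hm⟩ ^ 2 ≤ G ⟨m, hm⟩ ⟨m, hm⟩ := by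
        rw [hR, Matrix.mul_apply]
        simp only [Matrix.transpose_apply, ← sq]
        exact Finset.single_le_sum (f := fun j => R j ⟨m, hm⟩ ^ 2) (fun _ _ => sq_nonneg _)
          (Finset.mem_univ i)
      have h2 : G ⟨m, hm⟩ ⟨m, hm⟩ ≤ G.trace :=
        Finset.single_le_sum (f := fun j => G j j) (fun j _ => hG.diag_nonneg)
          (Finset.mem_univ _)
      rw [le_div_iff₀ hδ]
      nlinarith
    · simp
  · rw [List.map_map, Finset.sum_map_toList, Function.comp_def]
    rwa [← quadForm_transpose_mul, ← hR]

variable {σ : Type} [Fintype σ] {μ : Measure (σ → ℝ)} {S : Set (σ → ℝ)}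

/-! ### Bounded derivations -/

/-- A derivation from integer polynomials can be chosen with bounded coefficients. -/
lemma exists_bounded_derivation {P : Finset (MvPolynomial σ ℝ)} {D : ℕ} {a β : ℝ} (ha : 1 ≤ a)
    (hP : ∀ p ∈ P, CoeffsLE p a) (hinteg : ∀ p ∈ P, ∀ m, ∃ z : ℤ, (z : ℝ) = MvPolynomial.coeff m p)
    {r : MvPolynomial σ ℝ} (hr : r ∈ derivs P D) (hβ : 0 ≤ β) (hrβ : CoeffsLE r β) :
    ∃ lam : MvPolynomial σ ℝ → MvPolynomial σ ℝ, r = ∑ p ∈ P, lam p * p ∧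
      (∀ p ∈ P, (lam p * p).totalDegree ≤ D) ∧
      ∀ p ∈ P, CoeffsLE (lam p) (cramerBound (Fintype.card (Mon σ D))
        (P.card * Fintype.card (Mon σ D)) a * β) := by
  obtain ⟨lam₀, hlam₀, hdeg₀⟩ := hr
  choose! z hz using hinteg
  -- The unknowns are the coefficients of the multipliers, one for each constraint and monomial
  -- whose product has degree at most D. Every solution thus satisfies the degree bound
  -- automatically.
  set ι := {x : P × Mon σ D // x.2.1.degree + x.1.1.totalDegree ≤ D} with hι
  set A : Matrix (Mon σ D) ι ℤ := Matrix.of fun m x =>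
    if x.1.2.1 ≤ m.1 then z x.1.1.1 (m.1 - x.1.2.1) else 0 with hA
  have hAcoeff : ∀ m x, (A m x : ℝ) =
      MvPolynomial.coeff m.1 (MvPolynomial.monomial x.1.2.1 1 * x.1.1.1) := by
    intro m x
    rw [MvPolynomial.coeff_monomial_mul']
    simp only [hA, Matrix.of_apply]
    split_ifs with h
    · rw [hz _ x.1.1.2, one_mul]
    · simp
  have hAle : ∀ m x, |(A m x : ℝ)| ≤ a := by
    intro m x
    simp only [hA, Matrix.of_apply]
    split_ifs with h
    · rw [hz _ x.1.1.2]
      exact hP _ x.1.1.2 _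
    · simp
      linarith
  -- the polynomial encoded by a vector of unknowns
  set lamOf : (ι → ℝ) → MvPolynomial σ ℝ → MvPolynomial σ ℝ := fun x p =>
    ∑ i : ι, if i.1.1.1 = p then MvPolynomial.monomial i.1.2.1 (x i) else 0 with hlamOf
  have hsum : ∀ x : ι → ℝ, ∑ p ∈ P, lamOf x p * p =
      ∑ i : ι, x i • (MvPolynomial.monomial i.1.2.1 1 * i.1.1.1) := by
    intro x
    simp only [hlamOf, Finset.sum_mul]
    rw [Finset.sum_comm]
    refine Finset.sum_congr rfl fun i _ => ?_
    rw [Finset.sum_eq_single i.1.1.1]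
    · simp [← smul_mul_assoc, MvPolynomial.smul_monomial]
    · intro p _ hp
      simp [Ne.symm hp]
    · intro h
      exact absurd i.1.1.2 h
  have hmul : ∀ (x : ι → ℝ) (m : Mon σ D), (A.map (Int.cast : ℤ → ℝ)).mulVec x m =
      MvPolynomial.coeff m.1 (∑ p ∈ P, lamOf x p * p) := by
    intro x m
    rw [hsum, MvPolynomial.coeff_sum]
    simp only [Matrix.mulVec, dotProduct, Matrix.map_apply, MvPolynomial.coeff_smul, smul_eq_mul]
    refine Finset.sum_congr rfl fun i _ => ?_
    rw [hAcoeff, mul_comm]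
  have hcoeff : ∀ (x : ι → ℝ) (p : P) (m : σ →₀ ℕ), MvPolynomial.coeff m (lamOf x p) =
      if h : m.degree + p.1.totalDegree ≤ D then
        x ⟨(p, ⟨m, by omega⟩), h⟩ else 0 := by
    intro x p m
    simp only [hlamOf, MvPolynomial.coeff_sum]
    split_ifs with h
    · rw [Finset.sum_eq_single (⟨(p, ⟨m, by omega⟩), h⟩ : ι)]
      · simp
      · intro i _ hi
        split_ifs with h1
        · rw [MvPolynomial.coeff_monomial, if_neg]
          intro h2
          exact hi (Subtype.ext (Prod.ext (Subtype.ext h1) (Subtype.ext h2)))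
        · simp
      · simp
    · refine Finset.sum_eq_zero fun i _ => ?_
      split_ifs with h1
      · rw [MvPolynomial.coeff_monomial, if_neg]
        intro h2
        apply h
        rw [← h2, ← h1]
        exact i.2
      · simp
  have hdegOf : ∀ (x : ι → ℝ), ∀ p ∈ P, (lamOf x p * p).totalDegree ≤ D := by
    intro x p hp
    by_cases h0 : lamOf x p = 0
    · simp [h0]
    refine (MvPolynomial.totalDegree_mul _ _).trans ?_
    obtain ⟨m₀, hm₀⟩ := MvPolynomial.ne_zero_iff.1 h0
    rw [hcoeff x ⟨p, hp⟩] at hm₀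
    have hpD : p.totalDegree ≤ D := by
      by_contra hcon
      simp only at hm₀
      rw [dif_neg (by omega)] at hm₀
      exact hm₀ rfl
    have : (lamOf x p).totalDegree ≤ D - p.totalDegree := by
      rw [totalDegree_le_iff]
      intro m hm
      rw [hcoeff x ⟨p, hp⟩] at hm
      by_contra hcon
      simp only at hm
      rw [dif_neg (by omega)] at hm
      exact hm rfl
    omega
  have hsol : ∃ x, (A.map (Int.cast : ℤ → ℝ)).mulVec x =
      fun m : Mon σ D => MvPolynomial.coeff m.1 r := by
    refine ⟨fun i => MvPolynomial.coeff i.1.2.1 (lam₀ i.1.1.1), ?_⟩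
    funext m
    rw [hmul, hlam₀]
    congr 1
    refine Finset.sum_congr rfl fun p hp => ?_
    -- For p = 0 the degree of the product says nothing about the multiplier, so coefficients may be
    -- lost in the truncation, without harm.
    by_cases hp0 : p = 0
    · simp [hp0]
    congr 1
    ext m'
    rw [hcoeff _ ⟨p, hp⟩]
    simp only
    split_ifs with h
    · rfl
    · by_contra hne
      apply h
      have h1 : lam₀ p ≠ 0 := by
        rintro h1
        rw [h1] at hne
        simp at hne
      have h2 := hdeg₀ p hp
      rw [MvPolynomial.totalDegree_mul_of_isDomain h1 hp0] at h2
      have := totalDegree_le_iff.1 (le_refl (lam₀ p).totalDegree) m' (Ne.symm hne)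
      omega
  obtain ⟨x, hx, hxb⟩ := exists_bounded_solution A ha hAle _ (fun m => hrβ m.1) hβ hsol
  have hrdeg : r.totalDegree ≤ D := by
    rw [hlam₀]
    exact MvPolynomial.totalDegree_finsetSum_le hdeg₀
  have hcard : Fintype.card ι ≤ P.card * Fintype.card (Mon σ D) := by
    refine (Fintype.card_subtype_le _).trans ?_
    rw [Fintype.card_prod, Fintype.card_coe]
  have hbd : cramerBound (Fintype.card (Mon σ D)) (Fintype.card ι) a * β ≤
      cramerBound (Fintype.card (Mon σ D)) (P.card * Fintype.card (Mon σ D)) a * β := by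
    gcongr
    exact cramerBound_mono ha hcard
  refine ⟨lamOf x, ?_, hdegOf x, ?_⟩
  · ext m
    by_cases hm : m.degree ≤ D
    · have := congrFun hx ⟨m, hm⟩
      rw [hmul] at this
      exact this.symm
    · have h1 : MvPolynomial.coeff m r = 0 := by
        by_contra h
        exact hm (totalDegree_le_iff.1 hrdeg m h)
      have h2 : MvPolynomial.coeff m (∑ p ∈ P, lamOf x p * p) = 0 := by
        by_contra h
        exact hm (totalDegree_le_iff.1 (MvPolynomial.totalDegree_finsetSum_le (hdegOf x)) m h)
      rw [h1, h2]
  · intro p hp m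
    rw [hcoeff x ⟨p, hp⟩]
    split_ifs with h
    · exact (hxb _).trans hbd
    · rw [abs_zero]
      have := cramerBound_nonneg (M := Fintype.card (Mon σ D))
        (N := P.card * Fintype.card (Mon σ D)) (a := a) (by linarith)
      positivity

/-! ### Coefficient bounds -/

lemma CoeffsLE.mono {p : MvPolynomial σ ℝ} {B B' : ℝ} (h : CoeffsLE p B) (hB : B ≤ B') :
    CoeffsLE p B' := fun m => (h m).trans hB

lemma CoeffsLE.nonneg {p : MvPolynomial σ ℝ} {B : ℝ} (h : CoeffsLE p B) : 0 ≤ B :=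
  (abs_nonneg _).trans (h 0)

lemma CoeffsLE.add {p q : MvPolynomial σ ℝ} {B B' : ℝ} (h : CoeffsLE p B) (h' : CoeffsLE q B') :
    CoeffsLE (p + q) (B + B') := fun m => by
  rw [MvPolynomial.coeff_add]
  exact (abs_add_le _ _).trans (add_le_add (h m) (h' m))

lemma CoeffsLE.sub {p q : MvPolynomial σ ℝ} {B B' : ℝ} (h : CoeffsLE p B) (h' : CoeffsLE q B') :
    CoeffsLE (p - q) (B + B') := fun m => by
  rw [MvPolynomial.coeff_sub]
  exact (abs_sub _ _).trans (add_le_add (h m) (h' m))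

lemma CoeffsLE.sum {ι : Type*} (s : Finset ι) {f : ι → MvPolynomial σ ℝ} {B : ℝ}
    (h : ∀ i ∈ s, CoeffsLE (f i) B) : CoeffsLE (∑ i ∈ s, f i) (s.card * B) := fun m => by
  rw [MvPolynomial.coeff_sum]
  refine (Finset.abs_sum_le_sum_abs _ _).trans ?_
  calc _ ≤ ∑ i ∈ s, B := Finset.sum_le_sum fun i hi => h i hi m
    _ = _ := by simp

lemma CoeffsLE.list_sum {l : List (MvPolynomial σ ℝ)} {B : ℝ} (h : ∀ f ∈ l, CoeffsLE f B) :
    CoeffsLE l.sum (l.length * B) := by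
  induction l with
  | nil => intro m; simp
  | cons f l ih =>
    rw [List.sum_cons, List.length_cons]
    have := (h f List.mem_cons_self).add (ih fun g hg => h g (List.mem_cons_of_mem _ hg))
    refine this.mono ?_
    push_cast
    linarith

lemma CoeffsLE.mul {p q : MvPolynomial σ ℝ} {d : ℕ} {B B' : ℝ} (hp : p.totalDegree ≤ d)
    (h : CoeffsLE p B) (h' : CoeffsLE q B') :
    CoeffsLE (p * q) (Fintype.card (Mon σ d) * (B * B')) := by
  have hB := h.nonneg
  have hB' := h'.nonneg
  conv_lhs => rw [← polyOf_coeff hp]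
  rw [polyOf, Finset.sum_mul]
  refine CoeffsLE.sum Finset.univ fun a _ => ?_
  intro m
  rw [MvPolynomial.coeff_monomial_mul']
  split_ifs with hm
  · rw [abs_mul]
    exact mul_le_mul (h _) (h' _) (abs_nonneg _) hB
  · rw [abs_zero]
    positivity

lemma coeffsLE_list_sum_sq {l : List (MvPolynomial σ ℝ)} {d : ℕ} {b : ℝ} (hb : 0 ≤ b)
    (h : ∀ f ∈ l, f.totalDegree ≤ d ∧ CoeffsLE f (Real.sqrt b)) :
    CoeffsLE (l.map fun f => f ^ 2).sum (l.length * (Fintype.card (Mon σ d) * b)) := by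
  have : CoeffsLE (l.map fun f => f ^ 2).sum
      ((l.map fun f => f ^ 2).length * (Fintype.card (Mon σ d) * b)) := by
    refine CoeffsLE.list_sum fun g hg => ?_
    obtain ⟨f, hf, rfl⟩ := List.mem_map.1 hg
    have := CoeffsLE.mul (h f hf).1 (h f hf).2 (h f hf).2
    rwa [← sq, ← sq, Real.sq_sqrt hb] at this
  simpa using this

variable {σ : Type} [Fintype σ] {μ : Measure (σ → ℝ)} {S : Set (σ → ℝ)}

/-! ### Small proofs from rich sets of solutions -/

/-- Constraints whose equations have integer coefficients and whose inequalities are linear, with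
all coefficients and the number of constraints bounded by `a` and `w`. -/
structure IsSimpleSystem (sys : PolySystem σ) (a : ℝ) (w : ℕ) : Prop where
  coeffs_eqs : ∀ p ∈ sys.eqs, CoeffsLE p a
  integral : ∀ p ∈ sys.eqs, ∀ m, ∃ z : ℤ, (z : ℝ) = MvPolynomial.coeff m p
  card_eqs : sys.eqs.card ≤ w
  degree_ineqs : ∀ q ∈ sys.ineqs, q.totalDegree ≤ 1
  coeffs_ineqs : ∀ q ∈ sys.ineqs, CoeffsLE q a
  card_ineqs : sys.ineqs.card ≤ 2

lemma totalDegree_le_of_sq {f : MvPolynomial σ ℝ} {d : ℕ} (h : (f ^ 2).totalDegree ≤ d) :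
    f.totalDegree ≤ d := by
  by_cases h0 : f = 0
  · simp [h0]
  · rw [sq, MvPolynomial.totalDegree_mul_of_isDomain h0 h0] at h
    omega

lemma totalDegree_le_of_sq_mul {f q : MvPolynomial σ ℝ} (hq : q ≠ 0) {d : ℕ}
    (h : (f ^ 2 * q).totalDegree ≤ d) : f.totalDegree ≤ d := by
  by_cases h0 : f = 0
  · simp [h0]
  · rw [MvPolynomial.totalDegree_mul_of_isDomain (pow_ne_zero 2 h0) hq] at h
    exact totalDegree_le_of_sq (by omega)

lemma list_sum_sq_eval_nonneg (l : List (MvPolynomial σ ℝ)) (α : σ → ℝ) :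
    0 ≤ MvPolynomial.eval α (l.map fun f => f ^ 2).sum := by
  rw [map_list_sum]
  refine List.sum_nonneg fun x hx => ?_
  simp only [List.map_map, List.mem_map, Function.comp_apply, map_pow] at hx
  obtain ⟨f, -, rfl⟩ := hx
  positivity

lemma totalDegree_list_sum_le {l : List (MvPolynomial σ ℝ)} {d : ℕ}
    (h : ∀ f ∈ l, f.totalDegree ≤ d) : l.sum.totalDegree ≤ d := by
  induction l with
  | nil => simp
  | cons f l ih =>
    rw [List.sum_cons]
    refine (MvPolynomial.totalDegree_add _ _).trans (max_le (h f List.mem_cons_self) ?_)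
    exact ih fun g hg => h g (List.mem_cons_of_mem _ hg)

lemma SoSProof.totalDegree_le {sys : PolySystem σ} {r : MvPolynomial σ ℝ} (π : SoSProof sys r)
    {d : ℕ} (hd : π.DegreeLE d) : r.totalDegree ≤ d := by
  rw [π.identity]
  refine (MvPolynomial.totalDegree_add _ _).trans (max_le
    ((MvPolynomial.totalDegree_add _ _).trans (max_le ?_ ?_)) ?_)
  · refine totalDegree_list_sum_le fun g hg => ?_
    obtain ⟨f, hf, rfl⟩ := List.mem_map.1 hg
    exact hd.1 f hf
  · refine MvPolynomial.totalDegree_finsetSum_le fun q hq => ?_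
    rw [← List.sum_map_mul_right]
    refine totalDegree_list_sum_le fun g hg => ?_
    obtain ⟨f, hf, rfl⟩ := List.mem_map.1 hg
    exact hd.2.1 q hq f hf
  · exact MvPolynomial.totalDegree_finsetSum_le hd.2.2

lemma SoSProof.eval_eq {sys : PolySystem σ} {r : MvPolynomial σ ℝ} (π : SoSProof sys r)
    {α : σ → ℝ} (hα : α ∈ sys.solutions) : MvPolynomial.eval α r =
      MvPolynomial.eval α (π.h.map fun f => f ^ 2).sum +
      ∑ q ∈ sys.ineqs, MvPolynomial.eval α ((π.s q).map fun f => f ^ 2).sum *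
        MvPolynomial.eval α q := by
  conv_lhs => rw [π.identity]
  rw [map_add, map_add, map_sum, map_sum, Finset.sum_eq_zero (s := sys.eqs)]
  · simp only [map_mul, add_zero]
  · intro p hp
    rw [map_mul, hα.1 p hp, mul_zero]

/-- Proofs of degree zero are trivial. -/
lemma smallProofs_zero {sys : PolySystem σ} {c : ℕ} (hc : 1 ≤ c) (hsol : sys.solutions.Nonempty) :
    SmallProofs c sys 0 := by
  rintro r B hB hr ⟨π, hπ⟩
  obtain ⟨α, hα⟩ := hsol
  obtain ⟨t, ht⟩ : ∃ t, r = MvPolynomial.C t :=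
    ⟨_, MvPolynomial.totalDegree_eq_zero_iff_eq_C.1 (Nat.le_zero.1 (π.totalDegree_le hπ))⟩
  have h0 : 0 ≤ t := by
    have h : t = MvPolynomial.eval α r := by rw [ht, MvPolynomial.eval_C]
    rw [h, π.eval_eq hα]
    refine add_nonneg (list_sum_sq_eval_nonneg _ _) (Finset.sum_nonneg fun q hq => ?_)
    exact mul_nonneg (list_sum_sq_eval_nonneg _ _) (hα.2 q hq)
  have htB : t ≤ B := by
    have := hr 0
    rw [ht, MvPolynomial.coeff_C] at this
    simpa using (le_abs_self _).trans this
  -- The degree allowed is c·0 = 0, so only constants are available. The coefficient √t stays below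
  -- B because t ≤ B and B ≥ 1.
  refine ⟨⟨[MvPolynomial.C (Real.sqrt t)], fun _ => [], fun _ => 0, ?_⟩, ?_, ?_, ?_⟩
  · simp [ht, ← map_pow, Real.sq_sqrt h0]
  · refine ⟨?_, by simp, by simp⟩
    intro f hf
    simp only [List.mem_singleton] at hf
    rw [hf, ← map_pow, MvPolynomial.totalDegree_C]
    simp
  · have hpow : (1 : ℝ) ≤ 2 ^ polySize c (Fintype.card σ) 0 := one_le_pow₀ (by norm_num)
    have hBB : B ≤ B * 2 ^ polySize c (Fintype.card σ) 0 := by nlinarith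
    refine ⟨?_, by simp, ?_⟩
    · intro f hf m
      simp only [List.mem_singleton] at hf
      rw [hf, MvPolynomial.coeff_C]
      split_ifs
      · rw [abs_of_nonneg (Real.sqrt_nonneg _)]
        refine le_trans ?_ hBB
        rw [Real.sqrt_le_left (by linarith)]
        nlinarith
      · rw [abs_zero]
        linarith
    · intro p _ m
      simp
      linarith
  · refine ⟨?_, by simp⟩
    simpa [polySize] using hc

/-- The squares are bounded first, through their expectations on S. The multipliers are then chosen
afresh for the remainder, whose derivability is inherited from the original proof. The degree k + 3d
covers the derivations of degree k + d + 1 and the products s²q of degree 2d + 1. -/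
lemma smallProofs_core (hC : Carries μ S) {sys : PolySystem σ} {a : ℝ} {w : ℕ} (ha : 1 ≤ a)
    (hsys : IsSimpleSystem sys a w) {d k D : ℕ} {δ ε E : ℝ} (hδ : 0 < δ) (hε : 0 < ε) (hd : 1 ≤ d)
    (hE : 1 ≤ E) (hδE : 1 / δ ≤ E) (hεE : 1 / ε ≤ E) (hrich : IsRich sys S μ d δ k ε)
    (hD : k + 3 * d ≤ D) {r : MvPolynomial σ ℝ} {B : ℝ} (hB : 1 ≤ B) (hr : CoeffsLE r B)
    (π : SoSProof sys r) (hπ : π.DegreeLE d) {X : ℝ}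
    (hX1 : Fintype.card (Mon σ d) * B * E ^ 2 ≤ X)
    (hX2 : cramerBound (Fintype.card (Mon σ D)) (sys.eqs.card * Fintype.card (Mon σ D)) a *
      (4 * Fintype.card (Mon σ d) ^ 4 * a * B * E ^ 2) ≤ X) :
    ∃ π' : SoSProof sys r, π'.DegreeLE D ∧ π'.CoeffsLE X ∧
      π'.LengthLE (Fintype.card (Mon σ d)) := by
  set N := Fintype.card (Mon σ d) with hN
  have hN1 : (1 : ℝ) ≤ N := by
    have : 0 < N := Fintype.card_pos_iff.2 ⟨⟨0, by simp⟩⟩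
    exact_mod_cast this
  set b : ℝ := N * B * E ^ 2 with hb
  have hE2 : 1 ≤ E ^ 2 := one_le_pow₀ hE
  have hNB : 1 ≤ N * B := by nlinarith
  have hb1 : 1 ≤ b := by rw [hb]; nlinarith
  have hBb : B ≤ b := by
    have : B ≤ N * B := by nlinarith
    rw [hb]; nlinarith
  have hrdeg := π.totalDegree_le hπ
  have hεS : ∀ q ∈ sys.ineqs, ∀ α ∈ S, ε < MvPolynomial.eval α q := hrich.robust
  have heval : ∀ α ∈ S, MvPolynomial.eval α (π.h.map fun f => f ^ 2).sum +
      ∑ q ∈ sys.ineqs, MvPolynomial.eval α ((π.s q).map fun f => f ^ 2).sum *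
        MvPolynomial.eval α q ≤ N * B := by
    intro α hα
    rw [← π.eval_eq (hrich.subset hα)]
    exact (le_abs_self _).trans (abs_eval_le hrdeg hr (hC.le_one α hα))
  have hsq0 : ∀ α ∈ S, ∀ q ∈ sys.ineqs, 0 ≤ MvPolynomial.eval α ((π.s q).map fun f => f ^ 2).sum *
        MvPolynomial.eval α q := fun α hα q hq =>
    mul_nonneg (list_sum_sq_eval_nonneg _ _) (hε.trans (hεS q hq α hα)).le
  -- expectations of the sums of squares
  have hEh : hC.expect (π.h.map fun f => f ^ 2).sum ≤ N * B * E := by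
    have h1 : hC.expect (π.h.map fun f => f ^ 2).sum ≤ N * B := by
      rw [← hC.expect_C (N * B)]
      refine hC.expect_mono fun α hα => ?_
      rw [MvPolynomial.eval_C]
      have h1 := heval α hα
      have h2 := Finset.sum_nonneg fun q hq => hsq0 α hα q hq
      linarith
    nlinarith
  have hEs : ∀ q ∈ sys.ineqs, hC.expect ((π.s q).map fun f => f ^ 2).sum ≤ N * B * E := by
    intro q hq
    rw [← hC.expect_C (N * B * E)]
    refine hC.expect_mono fun α hα => ?_
    rw [MvPolynomial.eval_C]
    have h1 := heval α hα
    have h2 := Finset.single_le_sum (fun q hq => hsq0 α hα q hq) hq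
    have h3 := list_sum_sq_eval_nonneg π.h α
    have h4 := list_sum_sq_eval_nonneg (π.s q) α
    have h5 := (hεS q hq α hα).le
    set y := MvPolynomial.eval α ((π.s q).map fun f => f ^ 2).sum with hy
    have h6 : y * ε ≤ N * B := by
      have : y * ε ≤ y * MvPolynomial.eval α q := mul_le_mul_of_nonneg_left h5 h4
      linarith
    -- This is the only use of robustness quantitatively: the slack turns a bound on y·q into a
    -- bound on y.
    have h7 : y ≤ N * B * (1 / ε) := by
      rw [mul_one_div, le_div_iff₀ hε]
      exact h6
    exact h7.trans (mul_le_mul_of_nonneg_left hεE (by linarith))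
  have hbδ : N * B * E / δ ≤ b := by
    rw [div_eq_mul_one_div, hb, sq, ← mul_assoc]
    exact mul_le_mul_of_nonneg_left hδE (by positivity)
  have hq0 : ∀ q ∈ sys.ineqs, q ≠ 0 := by
    rintro q hq rfl
    obtain ⟨α, hα⟩ := hrich.nonempty
    have := hεS 0 hq α hα
    simp at this
    linarith
  obtain ⟨h', hlen, hh', hmem⟩ := exists_bounded_squares hC hδ hrich.spectral hrich.complete π.h
    (fun f hf => totalDegree_le_of_sq (hπ.1 f hf)) hEh
  have hs : ∀ q, ∃ s' : List (MvPolynomial σ ℝ), q ∈ sys.ineqs → (s'.length = N ∧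
      (∀ f ∈ s', f.totalDegree ≤ d ∧ CoeffsLE f (Real.sqrt b)) ∧
      ((π.s q).map (fun f => f ^ 2)).sum - (s'.map (fun f => f ^ 2)).sum ∈
        derivs sys.eqs (k + d)) := by
    intro q
    by_cases hq : q ∈ sys.ineqs
    · obtain ⟨s', h1, h2, h3⟩ := exists_bounded_squares hC hδ hrich.spectral hrich.complete (π.s q)
        (fun f hf => totalDegree_le_of_sq_mul (hq0 q hq) (hπ.2.1 q hq f hf)) (hEs q hq)
      exact ⟨s', fun _ => ⟨h1, fun f hf => ⟨(h2 f hf).1, (h2 f hf).2.mono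
        (Real.sqrt_le_sqrt hbδ)⟩, h3⟩⟩
    · exact ⟨[], fun h => absurd h hq⟩
  choose s' hs' using hs
  have hh'b : ∀ f ∈ h', f.totalDegree ≤ d ∧ CoeffsLE f (Real.sqrt b) := fun f hf =>
    ⟨(hh' f hf).1, (hh' f hf).2.mono (Real.sqrt_le_sqrt hbδ)⟩
  set r' := r - (h'.map fun f => f ^ 2).sum -
    ∑ q ∈ sys.ineqs, ((s' q).map fun f => f ^ 2).sum * q with hr'
  have hr'mem : r' ∈ derivs sys.eqs D := by
    have e : r' = ((π.h.map fun f => f ^ 2).sum - (h'.map fun f => f ^ 2).sum) +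
        ∑ q ∈ sys.ineqs, q * (((π.s q).map fun f => f ^ 2).sum - ((s' q).map fun f => f ^ 2).sum) +
        ∑ p ∈ sys.eqs, π.lam p * p := by
      rw [hr']
      conv_lhs => rw [π.identity]
      simp only [mul_sub, Finset.sum_sub_distrib, mul_comm (G := MvPolynomial σ ℝ)]
      ring
    rw [e]
    refine add_mem (add_mem (derivs_mono (by omega) hmem) (Submodule.sum_mem _ fun q hq => ?_)) ?_
    · refine mul_mem_derivs (hs' q hq).2.2 q ?_
      have := hsys.degree_ineqs q hq
      omega
    · exact derivs_mono (by omega) ⟨π.lam, rfl, hπ.2.2⟩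
  -- With b = N·B·E², the remainder is made of r, the new squares, and at most two products with
  -- inequalities. Each contributes at most N³ab, which explains the factor 4.
  have hr'coeff : CoeffsLE r' (4 * N ^ 4 * a * B * E ^ 2) := by
    have h1 := coeffsLE_list_sum_sq (by linarith) hh'b
    rw [hlen] at h1
    have h2 : CoeffsLE (∑ q ∈ sys.ineqs, ((s' q).map fun f => f ^ 2).sum * q)
        (sys.ineqs.card * (N * (a * (N * (N * b))))) := by
      refine CoeffsLE.sum _ fun q hq => ?_
      have h3 := coeffsLE_list_sum_sq (by linarith) (hs' q hq).2.1
      rw [(hs' q hq).1] at h3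
      rw [mul_comm _ q]
      exact CoeffsLE.mul ((hsys.degree_ineqs q hq).trans hd) (hsys.coeffs_ineqs q hq) h3
    refine ((hr.sub h1).sub h2).mono ?_
    have hc : (sys.ineqs.card : ℝ) ≤ 2 := by exact_mod_cast hsys.card_ineqs
    have e : 4 * (N : ℝ) ^ 4 * a * B * E ^ 2 = 4 * (N ^ 3 * a * b) := by rw [hb]; ring
    rw [e]
    have hb0 : 0 ≤ b := by linarith
    have g1 : B ≤ N ^ 3 * a * b := by
      have : 1 ≤ (N : ℝ) ^ 3 * a := by
        have := one_le_pow₀ (n := 3) hN1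
        nlinarith
      nlinarith
    have g2 : (N : ℝ) * (N * b) ≤ N ^ 3 * a * b := by
      have h5 : (N : ℝ) ^ 2 ≤ N ^ 3 := pow_le_pow_right₀ hN1 (by norm_num)
      have h6 : (N : ℝ) ^ 2 * 1 ≤ N ^ 3 * a := mul_le_mul h5 ha (by norm_num) (by positivity)
      calc (N : ℝ) * (N * b) = (N ^ 2 * 1) * b := by ring
        _ ≤ _ := mul_le_mul_of_nonneg_right h6 hb0
    have g3 : (sys.ineqs.card : ℝ) * (N * (a * (N * (N * b)))) ≤ 2 * (N ^ 3 * a * b) := by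
      calc (sys.ineqs.card : ℝ) * (N * (a * (N * (N * b))))
          = sys.ineqs.card * (N ^ 3 * a * b) := by ring
        _ ≤ _ := by gcongr
    linarith
  obtain ⟨lam, hlam, hlamdeg, hlamb⟩ := exists_bounded_derivation ha hsys.coeffs_eqs hsys.integral
    hr'mem (by positivity) hr'coeff
  have hsqrtb : Real.sqrt b ≤ X := by
    refine le_trans ?_ hX1
    rw [Real.sqrt_le_left (by linarith)]
    nlinarith
  refine ⟨⟨h', s', lam, ?_⟩, ⟨?_, ?_, ?_⟩, ⟨?_, ?_, ?_⟩, ?_, ?_⟩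
  · rw [← hlam, hr']
    ring
  · intro f hf
    have h1 := (hh'b f hf).1
    have h2 := MvPolynomial.totalDegree_pow f 2
    omega
  · intro q hq f hf
    have h1 := ((hs' q hq).2.1 f hf).1
    have h2 := MvPolynomial.totalDegree_pow f 2
    have h3 := MvPolynomial.totalDegree_mul (f ^ 2) q
    have h4 := hsys.degree_ineqs q hq
    omega
  · exact hlamdeg
  · exact fun f hf => (hh'b f hf).2.mono hsqrtb
  · exact fun q hq f hf => ((hs' q hq).2.1 f hf).2.mono hsqrtb
  · exact fun p hp => (hlamb p hp).mono hX2
  · exact hlen.le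
  · exact fun q hq => (hs' q hq).1.le

/-! ### Asymptotics -/

/-- With all parameters at most y, or at most 2^y for a, the factorial and the N-th power each
contribute an exponent of order y². The total y + 4y² + 2y is at most 7y². -/
lemma cramerBound_le {M N y : ℕ} {a : ℝ} (hM : M ≤ y) (hN : N ≤ y) (hy : 1 ≤ y) (ha : 0 ≤ a)
    (hay : a ≤ 2 ^ y) : cramerBound M N a ≤ 2 ^ (7 * y ^ 2) := by
  have hy2 : y ≤ y ^ 2 := by nlinarith
  have h2 : ∀ n : ℕ, n ≤ y → ((n : ℝ) + 1) ≤ 2 ^ y := by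
    intro n hn
    have h3 : n + 1 ≤ 2 ^ n := Nat.lt_two_pow_self
    have h4 : 2 ^ n ≤ 2 ^ y := Nat.pow_le_pow_right (by norm_num) hn
    exact_mod_cast h3.trans h4
  have hfac : (N.factorial : ℝ) ≤ 2 ^ (y * y) := by
    have h3 : N.factorial ≤ N ^ N := Nat.factorial_le_pow N
    have h5 : N ^ N ≤ (2 ^ y) ^ y := by
      calc N ^ N ≤ (2 ^ y) ^ N := by
            gcongr
            exact (Nat.lt_two_pow_self).le.trans (Nat.pow_le_pow_right (by norm_num) hN)
        _ ≤ _ := Nat.pow_le_pow_right (by positivity) hN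
    rw [← pow_mul] at h5
    exact_mod_cast h3.trans h5
  have hpow : (((M : ℝ) + 1) * a ^ 2) ^ N ≤ 2 ^ (3 * y * y) := by
    have h6 : ((M : ℝ) + 1) * a ^ 2 ≤ 2 ^ (3 * y) := by
      calc ((M : ℝ) + 1) * a ^ 2 ≤ 2 ^ y * (2 ^ y) ^ 2 := by
            gcongr
            exact h2 M hM
        _ = _ := by rw [← pow_mul, ← pow_add]; congr 1; ring
    calc _ ≤ ((2 : ℝ) ^ (3 * y)) ^ N := by gcongr
      _ ≤ ((2 : ℝ) ^ (3 * y)) ^ y := pow_le_pow_right₀ (one_le_pow₀ (by norm_num)) hN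
      _ = _ := by rw [← pow_mul]
  unfold cramerBound
  calc _ ≤ 2 ^ y * 2 ^ (y * y) * 2 ^ (3 * y * y) * (2 ^ y * (2 : ℝ) ^ y) := by
        gcongr
        · exact h2 N hN
        · exact h2 M hM
    _ = 2 ^ (y + y * y + 3 * y * y + (y + y)) := by simp only [pow_add]
    _ ≤ _ := by
        refine pow_le_pow_right₀ (by norm_num) ?_
        nlinarith

/-- The step n + 1 ≤ n² needs two variables. With n = 1 the number of monomials grows with d while
n^d stays 1. -/
lemma card_mon_le_pow {d j : ℕ} (hσ : 2 ≤ Fintype.card σ) :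
    Fintype.card (Mon σ (j * d)) ≤ (Fintype.card σ ^ d) ^ (2 * j) := by
  refine (card_mon_le σ (j * d)).trans ?_
  set n := Fintype.card σ
  calc (n + 1) ^ (j * d) ≤ (n ^ 2) ^ (j * d) := by
        gcongr
        nlinarith
    _ = _ := by
        rw [← pow_mul, ← pow_mul]
        congr 1
        ring

lemma pow_bounds {n y N M Nc p₀ p : ℕ} (hy1 : 1 ≤ y) (hN : N ≤ y) (hM : M ≤ y) (hNc : Nc ≤ y)
    (hn : 2 * n ≤ y) (hp : 14 * y ^ 2 + 2 * p₀ ≤ p) :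
    (N : ℝ) * (2 ^ p₀) ^ 2 ≤ 2 ^ p ∧
      cramerBound M Nc (2 * n) * (4 * N ^ 4 * (2 * n)) * (2 ^ p₀) ^ 2 ≤ 2 ^ p := by
  have htwo : ∀ m : ℕ, m ≤ y → (m : ℝ) ≤ 2 ^ y := by
    intro m hm
    have : m ≤ 2 ^ y := hm.trans (Nat.lt_two_pow_self).le
    exact_mod_cast this
  have hay : (2 : ℝ) * n ≤ 2 ^ y := by
    have := htwo _ hn
    push_cast at this
    exact this
  have hK := cramerBound_le hM hNc hy1 (by positivity) hay
  have hyy : y ≤ y ^ 2 := by nlinarith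
  have hE : ((2 : ℝ) ^ p₀) ^ 2 = 2 ^ (2 * p₀) := by rw [← pow_mul, mul_comm]
  rw [hE]
  constructor
  · calc (N : ℝ) * 2 ^ (2 * p₀) ≤ 2 ^ y * 2 ^ (2 * p₀) := by
          gcongr
          exact htwo N hN
      _ = 2 ^ (y + 2 * p₀) := by rw [pow_add]
      _ ≤ _ := pow_le_pow_right₀ (by norm_num) (by omega)
  · calc _ ≤ (2 : ℝ) ^ (7 * y ^ 2) * (2 ^ 2 * (2 ^ y) ^ 4 * 2 ^ y) * 2 ^ (2 * p₀) := by
          gcongr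
          · norm_num
          · exact htwo N hN
      _ = 2 ^ (7 * y ^ 2 + (2 + y * 4 + y) + 2 * p₀) := by
          rw [← pow_mul (2 : ℝ) y 4]
          simp only [pow_add]
      _ ≤ _ := pow_le_pow_right₀ (by norm_num) (by omega)

lemma smallProofs_of_rich {c₀ : ℕ} {sys : PolySystem σ} {d : ℕ} (hσ : 2 ≤ Fintype.card σ)
    (hC : Carries μ S) (hsys : IsSimpleSystem sys (2 * Fintype.card σ) (3 * Fintype.card σ ^ 2))
    (hrich : RichUpTo c₀ sys S μ d) {c : ℕ} (hc : 6 * c₀ + 40 ≤ c) : SmallProofs c sys d := by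
  obtain ⟨δ, ε, k, hδ, hε, hδE, hεE, hk, hrich⟩ := hrich
  -- For d ≥ 1 the number n of variables is at most x = n^d, so that every size is a power of x;
  -- this fails for d = 0.
  rcases Nat.eq_zero_or_pos d with rfl | hd
  · exact smallProofs_zero (by omega) (hrich.nonempty.mono hrich.subset)
  rintro r B hB hr ⟨π, hπ⟩
  generalize hn : Fintype.card σ = n at *
  obtain ⟨x, hx⟩ : ∃ x, x = n ^ d := ⟨_, rfl⟩
  have hnx : n ≤ x := hx ▸ Nat.le_self_pow (by omega) n
  have hx2 : 2 ≤ x := hσ.trans hnx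
  -- The power x^(2(c₀+3)) counts the monomials of degree (c₀+3)d, and the extra x⁴ absorbs the 3n²
  -- constraints. Thus y dominates both the rows and the columns of the linear system.
  obtain ⟨y, hy⟩ : ∃ y, y = x ^ (2 * (c₀ + 3) + 4) := ⟨_, rfl⟩
  have hpw : ∀ i l : ℕ, i ≤ l → x ^ i ≤ x ^ l := fun i l h => Nat.pow_le_pow_right (by omega) h
  have hy1 : 1 ≤ y := hy ▸ Nat.one_le_pow _ _ (by omega)
  have hyx2 : x ^ 2 ≤ y := hy ▸ hpw 2 _ (by omega)
  have hN : Fintype.card (Mon σ d) ≤ x ^ 2 := by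
    have := card_mon_le_pow (d := d) (j := 1) (hn ▸ hσ)
    rw [hn, ← hx] at this
    simpa using this
  have hND : Fintype.card (Mon σ ((c₀ + 3) * d)) ≤ x ^ (2 * (c₀ + 3)) := by
    have := card_mon_le_pow (d := d) (j := c₀ + 3) (hn ▸ hσ)
    rwa [hn, ← hx] at this
  have hcols : sys.eqs.card * Fintype.card (Mon σ ((c₀ + 3) * d)) ≤ y := by
    calc _ ≤ (3 * n ^ 2) * x ^ (2 * (c₀ + 3)) := Nat.mul_le_mul hsys.card_eqs hND
      _ ≤ (x ^ 2 * x ^ 2) * x ^ (2 * (c₀ + 3)) := by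
          gcongr
          nlinarith
      _ = y := by rw [hy, ← pow_add, ← pow_add]; congr 1; ring
  have hexp : 14 * y ^ 2 + 2 * polySize c₀ n d ≤ polySize c n d := by
    have h1 : y ^ 2 ≤ x ^ c := by
      rw [hy, ← pow_mul]
      exact hpw _ _ (by omega)
    have h2 : x ^ c₀ ≤ x ^ c := hpw _ _ (by omega)
    unfold polySize
    rw [← hx]
    calc 14 * y ^ 2 + 2 * (c₀ * x ^ c₀) ≤ 14 * x ^ c + 2 * (c₀ * x ^ c) := by gcongr
      _ = (14 + 2 * c₀) * x ^ c := by ring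
      _ ≤ c * x ^ c := by gcongr; omega
  have h2n : 2 * n ≤ y := by
    refine le_trans ?_ hyx2
    nlinarith
  obtain ⟨hb1, hb2⟩ := pow_bounds hy1 (hN.trans hyx2) (hND.trans (hy ▸ hpw _ _ (by omega)))
    hcols h2n hexp
  have hlen : Fintype.card (Mon σ d) ≤ polySize c n d := by
    refine hN.trans ?_
    unfold polySize
    rw [← hx]
    calc x ^ 2 ≤ x ^ c := hpw _ _ (by omega)
      _ ≤ c * x ^ c := Nat.le_mul_of_pos_left _ (by omega)
  have ha1 : (1 : ℝ) ≤ 2 * n := by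
    have : (2 : ℝ) ≤ n := by exact_mod_cast hσ
    linarith
  have hDc : (c₀ + 3) * d ≤ c * d := Nat.mul_le_mul_right _ (by omega)
  obtain ⟨π', h1, h2, h3⟩ := smallProofs_core hC ha1 hsys hδ hε hd
    (one_le_pow₀ (by norm_num)) hδE hεE hrich
    (D := (c₀ + 3) * d) (by nlinarith) hB hr π hπ (X := B * 2 ^ polySize c n d)
    (by
      rw [mul_comm _ B, mul_assoc]
      exact mul_le_mul_of_nonneg_left hb1 (by linarith))
    (by
      have e : ∀ K N a E : ℝ, K * (4 * N ^ 4 * a * B * E ^ 2) =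
          B * (K * (4 * N ^ 4 * a) * E ^ 2) := by
        intros; ring
      rw [e]
      exact mul_le_mul_of_nonneg_left hb2 (by linarith))
  exact ⟨π', ⟨fun f hf => (h1.1 f hf).trans hDc, fun q hq f hf => (h1.2.1 q hq f hf).trans hDc,
    fun p hp => (h1.2.2 p hp).trans hDc⟩, h2, h3.1.trans hlen, fun q hq => (h3.2 q hq).trans hlen⟩

variable {σ : Type} [Fintype σ] {μ : Measure (σ → ℝ)} {S : Set (σ → ℝ)}

/-! ### Uniform distributions on finite sets -/

lemma integral_uniformOn (hS : S.Finite) (f : (σ → ℝ) → ℝ) :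
    ∫ α, f α ∂(ProbabilityTheory.uniformOn S) = (S.ncard : ℝ)⁻¹ * ∑ α ∈ hS.toFinset, f α := by
  have hcount : Measure.count S = (S.ncard : ENNReal) := by
    rw [Measure.count_apply_finite S hS, Set.ncard_eq_toFinset_card S hS]
  rw [ProbabilityTheory.uniformOn, ProbabilityTheory.cond, integral_smul_measure, hcount]
  have hset : ∫ α in S, f α ∂Measure.count = ∑ α ∈ hS.toFinset, f α := by
    have hinteg : ∀ s : Finset (σ → ℝ), IntegrableOn f s Measure.count := fun s => by
      rw [← (s : Set (σ → ℝ)).biUnion_of_singleton]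
      simp [integrableOn_finset_iUnion]
    have h1 := setIntegral_finset (μ := Measure.count) (f := f) hS.toFinset (hinteg _)
    rw [hS.coe_toFinset] at h1
    rw [h1]
    simp [measureReal_def]
  rw [hset]
  simp

lemma carries_uniformOn (hS : S.Finite) (hne : S.Nonempty) (hle : ∀ α ∈ S, ∀ i, |α i| ≤ 1) :
    Carries (ProbabilityTheory.uniformOn S) S where
  prob := ProbabilityTheory.isProbabilityMeasure_uniformOn hS hne
  mem := by
    rw [ae_iff]
    change ProbabilityTheory.uniformOn S Sᶜ = 0
    rw [ProbabilityTheory.uniformOn_eq_zero_iff hS]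
    simp
  le_one := hle
  full := by
    intro p hp α hα
    rw [ae_iff, ProbabilityTheory.uniformOn_eq_zero_iff hS] at hp
    by_contra h
    have : α ∈ S ∩ {a | ¬ MvPolynomial.eval a p = 0} := ⟨hα, h⟩
    rw [hp] at this
    exact this

/-! ### Boolean points -/

/-- The indicator vector of a set of variables. -/
def ind {σ : Type} (A : Finset σ) : σ → ℝ := fun i => if i ∈ A then 1 else 0

lemma abs_ind_le (A : Finset σ) (i : σ) : |ind A i| ≤ 1 := by
  unfold ind
  split_ifs <;> simp

lemma monEval_ind (A : Finset σ) (m : σ →₀ ℕ) :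
    monEval (ind A) m = if m.support ⊆ A then 1 else 0 := by
  unfold monEval ind
  split_ifs with h
  · refine Finset.prod_eq_one fun i _ => ?_
    split_ifs with hi
    · simp
    · have : m i = 0 := by
        by_contra h2
        exact hi (h (Finsupp.mem_support_iff.2 h2))
      simp [this]
  · obtain ⟨i, hi, hiA⟩ := Finset.not_subset.1 h
    refine Finset.prod_eq_zero (Finset.mem_univ i) ?_
    rw [if_neg hiA, zero_pow (Finsupp.mem_support_iff.1 hi)]

lemma finite_of_boolean (hbool : ∀ α ∈ S, ∃ A, α = ind A) : S.Finite :=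
  (Set.finite_range (ind : Finset σ → σ → ℝ)).subset fun α hα => by
    obtain ⟨A, rfl⟩ := hbool α hα
    exact ⟨A, rfl⟩

lemma ncard_le_of_boolean (hbool : ∀ α ∈ S, ∃ A, α = ind A) : S.ncard ≤ 2 ^ Fintype.card σ := by
  calc S.ncard ≤ (ind '' (Set.univ : Set (Finset σ))).ncard := by
        refine Set.ncard_le_ncard ?_ (Set.toFinite _)
        intro α hα
        obtain ⟨A, rfl⟩ := hbool α hα
        exact ⟨A, trivial, rfl⟩
    _ ≤ (Set.univ : Set (Finset σ)).ncard := Set.ncard_image_le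
    _ = _ := by rw [Set.ncard_univ, Nat.card_eq_fintype_card, Fintype.card_finset]

lemma carries_boolean (hne : S.Nonempty) (hbool : ∀ α ∈ S, ∃ A, α = ind A) :
    Carries (ProbabilityTheory.uniformOn S) S :=
  carries_uniformOn (finite_of_boolean hbool) hne fun α hα i => by
    obtain ⟨A, rfl⟩ := hbool α hα
    exact abs_ind_le A i

/-- A bound on the inverse of the least nonzero eigenvalue of an integral multiple of a moment
matrix. -/
lemma spectral_bound_le {L N y : ℕ} (hy : 1 ≤ y) (hN : N ≤ y) (hL : (L : ℝ) ≤ 2 ^ y) :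
    (L : ℝ) * (N * cramerBound N N L) ≤ 2 ^ (9 * y ^ 2) := by
  have h1 : (N : ℝ) ≤ 2 ^ y := by
    have : N ≤ 2 ^ y := hN.trans (Nat.lt_two_pow_self).le
    exact_mod_cast this
  have h2 := cramerBound_le hN hN hy (by positivity) hL
  have h3 := cramerBound_nonneg (M := N) (N := N) (a := L) (by positivity)
  calc (L : ℝ) * (N * cramerBound N N L) ≤ 2 ^ y * (2 ^ y * 2 ^ (7 * y ^ 2)) := by gcongr
    _ = 2 ^ (y + (y + 7 * y ^ 2)) := by rw [pow_add, pow_add]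
    _ ≤ _ := pow_le_pow_right₀ (by norm_num) (by nlinarith)

lemma spectrallyRich_of_integral_bound (h : Carries μ S) (hσ : 2 ≤ Fintype.card σ) {d L j : ℕ}
    (hj : 2 ≤ j) (hL : 1 ≤ L) (hLle : (L : ℝ) ≤ 2 ^ ((Fintype.card σ ^ d) ^ j))
    (hinteg : ∀ m : σ →₀ ℕ, m.degree ≤ 2 * d → ∃ z : ℤ, (z : ℝ) = L * ∫ α, monEval α m ∂μ)
    {c : ℕ} (hc : 9 + 2 * j ≤ c) :
    ∃ δ : ℝ, 0 < δ ∧ 1 / δ ≤ 2 ^ polySize c (Fintype.card σ) d ∧ SpectrallyRich μ d δ := by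
  set X := (L : ℝ) * (Fintype.card (Mon σ d) *
    cramerBound (Fintype.card (Mon σ d)) (Fintype.card (Mon σ d)) L) with hX
  have hpos : 0 < X := by
    have h1 : (1 : ℝ) ≤ L := by exact_mod_cast hL
    have h2 : 0 < Fintype.card (Mon σ d) := Fintype.card_pos_iff.2 ⟨⟨0, by simp⟩⟩
    have h3 : (0 : ℝ) < Fintype.card (Mon σ d) := by exact_mod_cast h2
    rw [hX]
    unfold cramerBound
    positivity
  refine ⟨1 / X, by positivity, ?_, h.spectrallyRich_of_integral d L hL hinteg⟩
  rw [one_div_one_div]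
  have hx : 1 ≤ Fintype.card σ ^ d := Nat.one_le_pow _ _ (by omega)
  have hN := card_mon_le_pow (d := d) (j := 1) hσ
  simp only [one_mul, mul_one] at hN
  unfold polySize
  generalize Fintype.card σ ^ d = x at *
  refine (spectral_bound_le (Nat.one_le_pow _ _ hx) (hN.trans (Nat.pow_le_pow_right hx hj))
    hLle).trans ?_
  refine pow_le_pow_right₀ (by norm_num) ?_
  rw [← pow_mul]
  exact Nat.mul_le_mul (by omega) (Nat.pow_le_pow_right hx (by omega))

/-- At Boolean points monomials take the values 0 and 1, so |S| times a moment is a count of points.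
As |S| ≤ 2^n, this multiplier is within the allowed bound once d ≥ 1. -/
lemma spectrallyRich_boolean (hne : S.Nonempty) (hbool : ∀ α ∈ S, ∃ A, α = ind A)
    (hσ : 2 ≤ Fintype.card σ) (d : ℕ) {c : ℕ} (hc : 13 ≤ c) :
    ∃ δ : ℝ, 0 < δ ∧ 1 / δ ≤ 2 ^ polySize c (Fintype.card σ) d ∧
      SpectrallyRich (ProbabilityTheory.uniformOn S) d δ := by
  have hC := carries_boolean hne hbool
  have hfin := finite_of_boolean hbool
  rcases Nat.eq_zero_or_pos d with rfl | hd
  · refine ⟨1, one_pos, ?_, hC.spectrallyRich_zero⟩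
    rw [one_div_one]
    exact one_le_pow₀ (by norm_num)
  have hpos : 1 ≤ S.ncard := (Set.ncard_pos hfin).2 hne
  refine spectrallyRich_of_integral_bound hC hσ (L := S.ncard) le_rfl hpos ?_ ?_ (by omega)
  · have h1 := ncard_le_of_boolean hbool
    have h2 : Fintype.card σ ≤ (Fintype.card σ ^ d) ^ 2 := by
      rw [← pow_mul]
      exact Nat.le_self_pow (by omega) _
    have h3 : S.ncard ≤ 2 ^ ((Fintype.card σ ^ d) ^ 2) :=
      h1.trans (Nat.pow_le_pow_right (by norm_num) h2)
    exact_mod_cast h3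
  · intro m _
    refine ⟨∑ α ∈ hfin.toFinset, if monEval α m = 0 then 0 else 1, ?_⟩
    have h0 : (S.ncard : ℝ) ≠ 0 := by
      have : (1 : ℝ) ≤ S.ncard := by exact_mod_cast hpos
      linarith
    rw [integral_uniformOn hfin, ← mul_assoc, mul_inv_cancel₀ h0, one_mul]
    push_cast
    refine Finset.sum_congr rfl fun α hα => ?_
    obtain ⟨A, rfl⟩ := hbool α (by simpa using hα)
    rw [monEval_ind]
    split_ifs <;> simp_all

/-- The eigenvalue equation, in terms of the values of the polynomial of an eigenvector. -/
lemma eigenvalue_mul_eval (hfin : S.Finite) (hC : Carries (ProbabilityTheory.uniformOn S) S)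
    {d : ℕ} {c : Mon σ d → ℝ} {t : ℝ}
    (hct : (momentMatrix (ProbabilityTheory.uniformOn S) d).mulVec c = t • c) (β : σ → ℝ) :
    t * MvPolynomial.eval β (polyOf c) = (S.ncard : ℝ)⁻¹ * ∑ α ∈ hfin.toFinset,
      (∑ m : Mon σ d, monEval β m.1 * monEval α m.1) * MvPolynomial.eval α (polyOf c) := by
  have h1 : ∀ m : Mon σ d, t * c m = (S.ncard : ℝ)⁻¹ * ∑ α ∈ hfin.toFinset,
      monEval α m.1 * MvPolynomial.eval α (polyOf c) := by
    intro m
    have := congrFun hct m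
    rw [hC.mulVec_apply, integral_uniformOn hfin] at this
    rw [this]
    simp
  calc t * MvPolynomial.eval β (polyOf c) = ∑ m : Mon σ d, (t * c m) * monEval β m.1 := by
        rw [eval_polyOf, Finset.mul_sum]
        exact Finset.sum_congr rfl fun m _ => by ring
    _ = _ := by
        simp only [h1, Finset.mul_sum, Finset.sum_mul]
        rw [Finset.sum_comm]
        exact Finset.sum_congr rfl fun α _ => Finset.sum_congr rfl fun m _ => by ring

/-- The eigenvalue equation expresses t·c through the values of the polynomial on S, so t ≠ 0 and
vanishing on S would force c = 0. -/
lemma exists_eval_ne_zero (hfin : S.Finite) (hC : Carries (ProbabilityTheory.uniformOn S) S)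
    {d : ℕ} {c : Mon σ d → ℝ} {t : ℝ} (ht : t ≠ 0) (hc : c ≠ 0)
    (hct : (momentMatrix (ProbabilityTheory.uniformOn S) d).mulVec c = t • c) :
    ∃ α ∈ S, MvPolynomial.eval α (polyOf c) ≠ 0 := by
  by_contra! hcon
  apply hc
  funext m
  have := congrFun hct m
  rw [hC.mulVec_apply, integral_uniformOn hfin, Finset.sum_eq_zero] at this
  · simpa [ht] using this
  · intro α hα
    rw [hcon α (by simpa using hα), mul_zero]

/-- At the all-ones point the moment matrix has all entries 1 and rank one, so its nonzero
eigenvalue is the number of monomials. This serves matchings on two vertices. -/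
lemma spectrallyRich_singleton (d : ℕ) :
    SpectrallyRich (ProbabilityTheory.uniformOn {ind (Finset.univ : Finset σ)}) d 1 := by
  intro t ht ht0
  obtain ⟨c, hc, hct⟩ := (hasEigenvalue_iff _ _).1 ht
  have hbool : ∀ α ∈ ({ind (Finset.univ : Finset σ)} : Set (σ → ℝ)), ∃ A, α = ind A :=
    fun α hα => ⟨_, hα⟩
  have hC := carries_boolean (Set.singleton_nonempty _) hbool
  have hfin := Set.finite_singleton (ind (Finset.univ : Finset σ))
  obtain ⟨α, hα, hne⟩ := exists_eval_ne_zero hfin hC ht0 hc hct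
  rw [Set.mem_singleton_iff] at hα
  subst hα
  have h := eigenvalue_mul_eval hfin hC hct (ind Finset.univ)
  have htf : hfin.toFinset = {ind (Finset.univ : Finset σ)} := by
    ext; simp
  rw [htf, Finset.sum_singleton, Set.ncard_singleton] at h
  simp only [Nat.cast_one, inv_one, one_mul, monEval_ind, Finset.subset_univ,
    if_true, mul_one, Finset.sum_const, Finset.card_univ, nsmul_eq_mul] at h
  have h2 := mul_right_cancel₀ hne h
  rw [h2]
  have h3 : 0 < Fintype.card (Mon σ d) := Fintype.card_pos_iff.2 ⟨⟨0, by simp⟩⟩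
  exact_mod_cast h3

lemma two_le_card_mon [Nonempty σ] {d : ℕ} (hd : 1 ≤ d) : 2 ≤ Fintype.card (Mon σ d) := by
  obtain ⟨i⟩ := ‹Nonempty σ›
  have : Nontrivial (Mon σ d) := ⟨⟨0, by simp⟩, ⟨Finsupp.single i 1, by simpa using hd⟩, by
    intro h
    have := congrArg (fun m : Mon σ d => m.1 i) h
    simp at this⟩
  exact Fintype.one_lt_card

/-- Passing to the values f0, f1 of the eigenpolynomial at the two points reduces the matrix to
½[[1,1],[1,N]]. Its smaller eigenvalue is at least determinant over trace, (N-1)/(2(N+1)), which is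
1/6 at N = 2 and larger beyond. This serves cliques on one vertex. -/
lemma spectrallyRich_pair [Nonempty σ] (d : ℕ) :
    SpectrallyRich (ProbabilityTheory.uniformOn {ind (∅ : Finset σ), ind Finset.univ}) d
      (1 / 6) := by
  intro t ht ht0
  obtain ⟨c, hc, hct⟩ := (hasEigenvalue_iff _ _).1 ht
  set S : Set (σ → ℝ) := {ind (∅ : Finset σ), ind Finset.univ} with hS
  have hbool : ∀ α ∈ S, ∃ A, α = ind A := by
    rintro α (rfl | rfl)
    exacts [⟨_, rfl⟩, ⟨_, rfl⟩]
  have hC := carries_boolean ⟨_, Or.inl rfl⟩ hbool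
  rcases Nat.eq_zero_or_pos d with rfl | hd
  · have := hC.spectrallyRich_zero t ht ht0
    linarith
  have hfin : S.Finite := finite_of_boolean hbool
  have hne : ind (∅ : Finset σ) ≠ ind Finset.univ := by
    intro h
    obtain ⟨i⟩ := ‹Nonempty σ›
    have := congrFun h i
    simp [ind] at this
  obtain ⟨α, hα, hneα⟩ := exists_eval_ne_zero hfin hC ht0 hc hct
  have htf : hfin.toFinset = {ind (∅ : Finset σ), ind Finset.univ} := by
    ext; simp [hS]
  have hcard : (S.ncard : ℝ) = 2 := by
    rw [hS, Set.ncard_pair hne]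
    norm_num
  have h0 := eigenvalue_mul_eval hfin hC hct (ind ∅)
  have h1 := eigenvalue_mul_eval hfin hC hct (ind Finset.univ)
  have hz : (∑ m : Mon σ d, if m.1 = 0 then (1 : ℝ) else 0) = 1 := by
    rw [Finset.sum_eq_single (⟨0, by simp⟩ : Mon σ d)]
    · simp
    · intro b _ hb
      rw [if_neg]
      intro h
      exact hb (Subtype.ext h)
    · simp
  rw [htf, Finset.sum_pair hne, hcard] at h0 h1
  simp only [monEval_ind, Finset.subset_univ, if_true, mul_one, Finset.subset_empty,
    Finsupp.support_eq_empty, Finset.sum_const, Finset.card_univ, nsmul_eq_mul, mul_ite,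
    mul_zero] at h0 h1
  simp only [hz, one_mul] at h0 h1
  have e0 : (∑ m : Mon σ d, if m.1 = 0 then if m.1 = 0 then (1 : ℝ) else 0 else 0) = 1 := by
    refine (Finset.sum_congr rfl fun m _ => ?_).trans hz
    split_ifs <;> rfl
  simp only [e0, one_mul] at h0 h1
  have hN : (2 : ℝ) ≤ Fintype.card (Mon σ d) := by exact_mod_cast two_le_card_mon hd
  set f0 := MvPolynomial.eval (ind (∅ : Finset σ)) (polyOf c)
  set f1 := MvPolynomial.eval (ind (Finset.univ : Finset σ)) (polyOf c)
  set N : ℝ := (Fintype.card (Mon σ d) : ℝ)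
  have ht1 := hC.eigenvalue_nonneg hc hct
  by_contra hlt
  push Not at hlt
  have g1 : f1 = (2 * t - 1) * f0 := by linarith
  have g0 : f0 ≠ 0 := by
    intro h
    have hf1 : f1 = 0 := by rw [g1, h, mul_zero]
    rcases hα with rfl | rfl
    exacts [hneα h, hneα hf1]
  have g2 : ((2 * t - N) * (2 * t - 1) - 1) * f0 = 0 := by
    have : (2 * t - N) * f1 = f0 := by linarith
    rw [g1] at this
    linarith
  rcases mul_eq_zero.1 g2 with h | h
  · nlinarith
  · exact g0 h

lemma const_le_two_pow_polySize [Nonempty σ] {c : ℕ} (hc : 3 ≤ c) (d : ℕ) {t : ℝ} (ht : t ≤ 8) :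
    t ≤ 2 ^ polySize c (Fintype.card σ) d := by
  have h1 : 3 ≤ polySize c (Fintype.card σ) d := by
    have : 0 < (Fintype.card σ ^ d) ^ c := by
      have := Fintype.card_pos (α := σ)
      positivity
    unfold polySize
    nlinarith
  calc t ≤ 2 ^ 3 := by norm_num; exact ht
    _ ≤ _ := pow_le_pow_right₀ (by norm_num) h1

/-- Assembling richness of a set of Boolean points. -/
lemma richUpTo_of_boolean [Nonempty σ] {sys : PolySystem σ} {d c k : ℕ} (hne : S.Nonempty)
    (hbool : ∀ α ∈ S, ∃ A, α = ind A) (hsub : S ⊆ sys.solutions) (hrob : IsRobust sys S (1 / 4))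
    (hk : k ≤ c * d) (hc : 13 ≤ c)
    (hcomp : ∀ f : MvPolynomial σ ℝ, f.totalDegree ≤ d →
      (∀ α ∈ S, MvPolynomial.eval α f = 0) → f ∈ derivs sys.eqs k)
    (hspec : 2 ≤ Fintype.card σ ∨
      SpectrallyRich (ProbabilityTheory.uniformOn S) d (1 / 6)) :
    RichUpTo c sys S (ProbabilityTheory.uniformOn S) d := by
  have hC := carries_boolean hne hbool
  have hspec' : ∃ δ : ℝ, 0 < δ ∧ 1 / δ ≤ 2 ^ polySize c (Fintype.card σ) d ∧
      SpectrallyRich (ProbabilityTheory.uniformOn S) d δ := by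
    rcases hspec with h | h
    · exact spectrallyRich_boolean hne hbool h d hc
    · by_cases hσ : 2 ≤ Fintype.card σ
      · exact spectrallyRich_boolean hne hbool hσ d hc
      · refine ⟨1 / 6, by norm_num, ?_, h⟩
        exact const_le_two_pow_polySize (by omega) d (by norm_num)
  obtain ⟨δ, hδ, hδle, hδs⟩ := hspec'
  refine ⟨δ, 1 / 4, k, hδ, by norm_num, hδle, ?_, hk, hne, hsub, hδs, ?_, hrob⟩
  · exact const_le_two_pow_polySize (by omega) d (by norm_num)
  · intro v hv
    exact hcomp _ (totalDegree_polyOf_le v) (hC.eq_zero_of_mulVec hv)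

variable {σ : Type} [Fintype σ]

/-! ### Multilinear reduction -/

/-- The squarefree monomial with the given set of variables. -/
def xset {σ : Type} (T : Finset σ) : MvPolynomial σ ℝ := ∏ i ∈ T, MvPolynomial.X i

lemma totalDegree_xset_le (T : Finset σ) : (xset T).totalDegree ≤ T.card := by
  refine (MvPolynomial.totalDegree_finsetProd _ _).trans ?_
  simp [MvPolynomial.totalDegree_X]

lemma eval_ind_xset (A T : Finset σ) :
    MvPolynomial.eval (ind A) (xset T) = if T ⊆ A then 1 else 0 := by
  rw [xset, map_prod]
  simp only [MvPolynomial.eval_X, ind]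
  split_ifs with h
  · exact Finset.prod_eq_one fun i hi => if_pos (h hi)
  · obtain ⟨i, hi, hiA⟩ := Finset.not_subset.1 h
    exact Finset.prod_eq_zero hi (if_neg hiA)

lemma eval_ind_sum_xset (g : Finset σ → ℝ) (A : Finset σ) :
    MvPolynomial.eval (ind A) (∑ T, g T • xset T) = ∑ T ∈ A.powerset, g T := by
  rw [map_sum]
  simp only [MvPolynomial.smul_eval, eval_ind_xset, mul_ite, mul_one, mul_zero]
  rw [← Finset.sum_filter]
  congr 1
  ext T
  simp

lemma X_mul_xset [DecidableEq σ] {i : σ} {T : Finset σ} (hi : i ∉ T) :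
    MvPolynomial.X i * xset T = xset (insert i T) := by
  rw [xset, xset, Finset.prod_insert hi]

variable {P : Finset (MvPolynomial σ ℝ)}

lemma boolean_mem (hP : booleanEqs σ ⊆ P) (i : σ) :
    (MvPolynomial.X i ^ 2 - MvPolynomial.X i : MvPolynomial σ ℝ) ∈ P :=
  hP (Finset.mem_image_of_mem _ (Finset.mem_univ i))

lemma totalDegree_boolean_le (i : σ) :
    (MvPolynomial.X i ^ 2 - MvPolynomial.X i : MvPolynomial σ ℝ).totalDegree ≤ 2 := by
  refine (MvPolynomial.totalDegree_sub _ _).trans (max_le ?_ ?_)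
  · rw [MvPolynomial.totalDegree_X_pow]
  · rw [MvPolynomial.totalDegree_X]
    norm_num

lemma X_mul_xset_sub_mem [DecidableEq σ] (hP : booleanEqs σ ⊆ P) (i : σ) (T : Finset σ) {k : ℕ}
    (hk : T.card + 1 ≤ k) :
    MvPolynomial.X i * xset T - xset (insert i T) ∈ derivs P k := by
  by_cases hi : i ∈ T
  · have e : MvPolynomial.X i * xset T - xset (insert i T) =
        xset (T.erase i) * (MvPolynomial.X i ^ 2 - MvPolynomial.X i) := by
      have h1 : xset T = MvPolynomial.X i * xset (T.erase i) := by
        rw [X_mul_xset (Finset.notMem_erase i T), Finset.insert_erase hi]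
      rw [Finset.insert_eq_of_mem hi, h1]
      ring
    rw [e]
    refine mul_mem_derivs_of_mem (boolean_mem hP i) _ ?_
    refine (MvPolynomial.totalDegree_mul _ _).trans ?_
    have h2 := totalDegree_xset_le (T.erase i)
    have h3 := totalDegree_boolean_le i
    rw [Finset.card_erase_of_mem hi] at h2
    have : 0 < T.card := Finset.card_pos.2 ⟨i, hi⟩
    omega
  · rw [X_mul_xset hi, sub_self]
    exact zero_mem _

lemma exists_eq_single_add {m : σ →₀ ℕ} (hm : m ≠ 0) :
    ∃ i m', m = Finsupp.single i 1 + m' := by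
  obtain ⟨j, hj⟩ := Finsupp.ne_iff.1 hm
  have hle : Finsupp.single j 1 ≤ m := by
    rw [Finsupp.single_le_iff]
    simp only [Finsupp.coe_zero, Pi.zero_apply] at hj
    omega
  obtain ⟨m', hm'⟩ := exists_add_of_le hle
  exact ⟨j, m', hm'⟩

lemma card_support_le_degree (m : σ →₀ ℕ) : m.support.card ≤ m.degree := by
  rw [Finsupp.degree_apply, Finset.card_eq_sum_ones]
  refine Finset.sum_le_sum fun i hi => ?_
  have := Finsupp.mem_support_iff.1 hi
  omega

/-- One variable is peeled off at a time; replacing x_i² by x_i never raises the degree, so the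
degree of the monomial itself is enough. -/
lemma monomial_sub_xset_mem (hP : booleanEqs σ ⊆ P) (m : σ →₀ ℕ) :
    MvPolynomial.monomial m 1 - xset m.support ∈ derivs P m.degree := by
  induction hd : m.degree generalizing m with
  | zero =>
    rw [Finsupp.degree_eq_zero_iff] at hd
    subst hd
    have : (MvPolynomial.monomial (0 : σ →₀ ℕ) (1 : ℝ)) - xset (0 : σ →₀ ℕ).support = 0 := by
      simp [xset]
    rw [this]
    exact zero_mem _
  | succ n ih =>
    have hm : m ≠ 0 := by
      rintro rfl
      simp at hd
    obtain ⟨i, m', rfl⟩ := exists_eq_single_add hm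
    have hd' : m'.degree = n := by
      rw [map_add, Finsupp.degree_single] at hd
      omega
    have h1 := ih m' hd'
    have hsupp : (Finsupp.single i 1 + m').support = insert i m'.support := by
      ext j
      by_cases hj : j = i
      · subst hj
        simp
      · simp [hj]
    have e : MvPolynomial.monomial (Finsupp.single i 1 + m') (1 : ℝ) =
        MvPolynomial.X i * MvPolynomial.monomial m' 1 := by
      rw [MvPolynomial.X, MvPolynomial.monomial_mul, one_mul]
    rw [e, hsupp]
    have h2 : MvPolynomial.X i * (MvPolynomial.monomial m' 1 - xset m'.support) ∈
        derivs P (n + 1) :=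
      mul_mem_derivs h1 _ (by rw [MvPolynomial.totalDegree_X]; omega)
    have h3 := X_mul_xset_sub_mem hP i m'.support (k := n + 1) (by
      have := card_support_le_degree m'
      omega)
    convert add_mem h2 h3 using 1
    ring

/-- Modulo derivable polynomials, every polynomial is multilinear with monomials in a given class
outside of which monomials are derivable. -/
lemma exists_multilinear (hP : booleanEqs σ ⊆ P) (K : Finset σ → Prop)
    (hK : ∀ T, ¬ K T → xset T ∈ derivs P T.card) {d : ℕ} {f : MvPolynomial σ ℝ}
    (hf : f.totalDegree ≤ d) : ∃ g : Finset σ → ℝ, (∀ T, g T ≠ 0 → K T ∧ T.card ≤ d) ∧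
      f - ∑ T, g T • xset T ∈ derivs P d := by
  set g₀ : Finset σ → ℝ := fun T =>
    ∑ m : Mon σ d, if m.1.support = T then MvPolynomial.coeff m.1 f else 0 with hg₀
  have hg₀d : ∀ T, g₀ T ≠ 0 → T.card ≤ d := by
    intro T hT
    obtain ⟨m, -, hm⟩ := Finset.exists_ne_zero_of_sum_ne_zero hT
    have : m.1.support = T := by
      by_contra h
      simp [h] at hm
    rw [← this]
    exact (card_support_le_degree _).trans m.2
  refine ⟨fun T => if K T then g₀ T else 0, ?_, ?_⟩
  · intro T hT
    by_cases h : K T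
    · simp only [h, if_true] at hT
      exact ⟨h, hg₀d T hT⟩
    · simp [h] at hT
  · have h1 : f - ∑ T, g₀ T • xset T ∈ derivs P d := by
      have e1 : ∑ T, g₀ T • xset T = ∑ m : Mon σ d, MvPolynomial.coeff m.1 f • xset m.1.support := by
        simp only [hg₀, Finset.sum_smul]
        rw [Finset.sum_comm]
        refine Finset.sum_congr rfl fun m _ => ?_
        simp [ite_smul]
      have e2 : f = ∑ m : Mon σ d, MvPolynomial.coeff m.1 f • MvPolynomial.monomial m.1 1 := by
        conv_lhs => rw [← polyOf_coeff hf, polyOf_eq_sum_smul]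
      have e3 : f - ∑ T, g₀ T • xset T = ∑ m : Mon σ d, (MvPolynomial.coeff m.1 f •
          MvPolynomial.monomial m.1 1 - MvPolynomial.coeff m.1 f • xset m.1.support) := by
        rw [e1, Finset.sum_sub_distrib, ← e2]
      rw [e3]
      refine Submodule.sum_mem _ fun m _ => ?_
      rw [← smul_sub]
      exact Submodule.smul_mem _ _ (derivs_mono m.2 (monomial_sub_xset_mem hP m.1))
    have h2 : ∑ T, g₀ T • xset T - ∑ T, (if K T then g₀ T else 0) • xset T ∈ derivs P d := by
      rw [← Finset.sum_sub_distrib]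
      refine Submodule.sum_mem _ fun T _ => ?_
      rw [← sub_smul]
      by_cases h : K T
      · simp [h]
      · by_cases h0 : g₀ T = 0
        · simp [h, h0]
        · exact Submodule.smul_mem _ _ (derivs_mono (hg₀d T h0) (hK T h))
    convert add_mem h1 h2 using 1
    ring

/-- Möbius inversion in a form that tests only points in the support of g: at a minimal set of the
support the sum collapses to one coefficient. This is what permits testing only at solutions, as
long as the surviving monomials are themselves indexed by solutions. -/
lemma eq_zero_of_sum_powerset {g : Finset σ → ℝ} (h : ∀ A, g A ≠ 0 → ∑ T ∈ A.powerset, g T = 0) :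
    g = 0 := by
  funext A
  induction hn : A.card using Nat.strong_induction_on generalizing A with
  | _ n ih =>
    by_contra hA
    have h1 := h A hA
    rw [Finset.sum_eq_single A] at h1
    · exact hA h1
    · intro T hT hne
      have hss : T ⊂ A := (Finset.mem_powerset.1 hT).ssubset_of_ne hne
      exact ih _ (hn ▸ Finset.card_lt_card hss) T rfl
    · intro h2
      exact absurd (Finset.mem_powerset_self A) h2

lemma exists_eq_ind (hP : booleanEqs σ ⊆ P) {α : σ → ℝ}
    (hα : ∀ p ∈ P, MvPolynomial.eval α p = 0) : ∃ A, α = ind A := by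
  refine ⟨Finset.univ.filter fun i => α i = 1, ?_⟩
  funext i
  have h := hα _ (boolean_mem hP i)
  simp only [map_sub, map_pow, MvPolynomial.eval_X] at h
  have h2 : α i * (α i - 1) = 0 := by linarith
  simp only [ind, Finset.mem_filter, Finset.mem_univ, true_and]
  split_ifs with h1
  · exact h1
  · rcases mul_eq_zero.1 h2 with h3 | h3
    · exact h3
    · exact absurd (by linarith) h1

lemma eval_ind_boolean (A : Finset σ) {p : MvPolynomial σ ℝ} (hp : p ∈ booleanEqs σ) :
    MvPolynomial.eval (ind A) p = 0 := by
  obtain ⟨i, -, rfl⟩ := Finset.mem_image.1 hp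
  simp only [map_sub, map_pow, MvPolynomial.eval_X, ind]
  split_ifs <;> simp

/-! ### Integral polynomials -/

/-- The polynomials with integer coefficients. -/
def integralPolys (σ : Type) : Subring (MvPolynomial σ ℝ) :=
  (MvPolynomial.map (Int.castRingHom ℝ)).range

lemma exists_int_coeff {p : MvPolynomial σ ℝ} (hp : p ∈ integralPolys σ) (m : σ →₀ ℕ) :
    ∃ z : ℤ, (z : ℝ) = MvPolynomial.coeff m p := by
  obtain ⟨q, rfl⟩ := hp
  exact ⟨MvPolynomial.coeff m q, by simp [MvPolynomial.coeff_map]⟩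

lemma X_mem_integralPolys (i : σ) : (MvPolynomial.X i : MvPolynomial σ ℝ) ∈ integralPolys σ :=
  ⟨MvPolynomial.X i, by simp⟩

lemma boolean_mem_integralPolys {p : MvPolynomial σ ℝ} (hp : p ∈ booleanEqs σ) :
    p ∈ integralPolys σ := by
  obtain ⟨i, -, rfl⟩ := Finset.mem_image.1 hp
  exact sub_mem (pow_mem (X_mem_integralPolys i) 2) (X_mem_integralPolys i)

lemma coeffsLE_monomial (m : σ →₀ ℕ) (t : ℝ) : CoeffsLE (MvPolynomial.monomial m t) |t| := by
  intro m'
  rw [MvPolynomial.coeff_monomial]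
  split_ifs <;> simp

lemma coeffsLE_X (i : σ) : CoeffsLE (MvPolynomial.X i : MvPolynomial σ ℝ) 1 := by
  simpa using! coeffsLE_monomial (Finsupp.single i 1) 1

lemma coeffsLE_X_sq (i : σ) : CoeffsLE (MvPolynomial.X i ^ 2 : MvPolynomial σ ℝ) 1 := by
  rw [MvPolynomial.X_pow_eq_monomial]
  simpa using coeffsLE_monomial (Finsupp.single i 2) 1

lemma coeffsLE_X_mul_X (i j : σ) :
    CoeffsLE (MvPolynomial.X i * MvPolynomial.X j : MvPolynomial σ ℝ) 1 := by
  rw [MvPolynomial.X, MvPolynomial.X, MvPolynomial.monomial_mul]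
  simpa using coeffsLE_monomial (Finsupp.single i 1 + Finsupp.single j 1) 1

lemma coeffsLE_C (t : ℝ) : CoeffsLE (MvPolynomial.C t : MvPolynomial σ ℝ) |t| :=
  coeffsLE_monomial 0 t

lemma coeffsLE_boolean {p : MvPolynomial σ ℝ} (hp : p ∈ booleanEqs σ) : CoeffsLE p 2 := by
  obtain ⟨i, -, rfl⟩ := Finset.mem_image.1 hp
  exact ((coeffsLE_X_sq i).sub (coeffsLE_X i)).mono (by norm_num)

lemma card_booleanEqs_le (σ : Type) [Fintype σ] : (booleanEqs σ).card ≤ Fintype.card σ :=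
  Finset.card_image_le

/-! ### Max-Clique and Max-CSP -/

section Clique

variable {n : ℕ} (G : SimpleGraph (Fin n))

lemma maxClique_isSimpleSystem (hn : 1 ≤ n) :
    IsSimpleSystem (maxClique G) (2 * Fintype.card (Fin n)) (3 * Fintype.card (Fin n) ^ 2) := by
  have hn' : (1 : ℝ) ≤ n := by exact_mod_cast hn
  constructor
  · intro p hp
    rcases Finset.mem_union.1 hp with hp | hp
    · refine (coeffsLE_boolean hp).mono ?_
      rw [Fintype.card_fin]
      linarith
    · obtain ⟨e, -, rfl⟩ := Finset.mem_image.1 hp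
      refine (coeffsLE_X_mul_X e.1 e.2).mono ?_
      rw [Fintype.card_fin]
      linarith
  · intro p hp m
    refine exists_int_coeff ?_ m
    rcases Finset.mem_union.1 hp with hp | hp
    · exact boolean_mem_integralPolys hp
    · obtain ⟨e, -, rfl⟩ := Finset.mem_image.1 hp
      exact mul_mem (X_mem_integralPolys _) (X_mem_integralPolys _)
  · refine (Finset.card_union_le _ _).trans ?_
    have h1 := card_booleanEqs_le (Fin n)
    have h2 : ((Finset.univ.filter fun e : Fin n × Fin n => e.1 ≠ e.2 ∧ ¬ G.Adj e.1 e.2).image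
      fun e => (MvPolynomial.X e.1 * MvPolynomial.X e.2 : MvPolynomial (Fin n) ℝ)).card ≤ n * n := by
      refine Finset.card_image_le.trans ((Finset.card_filter_le _ _).trans ?_)
      simp
    rw [Fintype.card_fin] at *
    nlinarith
  all_goals simp [maxClique]

lemma ind_mem_maxClique {A : Finset (Fin n)} :
    ind A ∈ (maxClique G).solutions ↔ ∀ i ∈ A, ∀ j ∈ A, i ≠ j → G.Adj i j := by
  constructor
  · intro h i hi j hj hij
    by_contra hadj
    have := h.1 (MvPolynomial.X i * MvPolynomial.X j) (Finset.mem_union_right _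
      (Finset.mem_image.2 ⟨(i, j), by simp [hij, hadj], rfl⟩))
    simp [ind, hi, hj] at this
  · intro h
    refine ⟨fun p hp => ?_, by simp [maxClique]⟩
    rcases Finset.mem_union.1 hp with hp | hp
    · exact eval_ind_boolean A hp
    · obtain ⟨e, he, rfl⟩ := Finset.mem_image.1 hp
      simp only [Finset.mem_filter, Finset.mem_univ, true_and] at he
      simp only [map_mul, MvPolynomial.eval_X, ind]
      by_cases h1 : e.1 ∈ A
      · by_cases h2 : e.2 ∈ A
        · exact absurd (h _ h1 _ h2 he.1) he.2
        · simp [h2]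
      · simp [h1]

/-- After reduction only monomials supported on cliques remain, and the indicator of each such
clique is a solution. Monomials on other sets are multiples of some x_i x_j with ij a non-edge. -/
lemma maxClique_complete {d : ℕ} {f : MvPolynomial (Fin n) ℝ} (hf : f.totalDegree ≤ d)
    (hS : ∀ α ∈ (maxClique G).solutions, MvPolynomial.eval α f = 0) :
    f ∈ derivs (maxClique G).eqs d := by
  have hP : booleanEqs (Fin n) ⊆ (maxClique G).eqs := Finset.subset_union_left
  obtain ⟨g, hg, hfg⟩ := exists_multilinear hP
    (fun A => ∀ i ∈ A, ∀ j ∈ A, i ≠ j → G.Adj i j) (fun T hT => by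
      push Not at hT
      obtain ⟨i, hi, j, hj, hij, hadj⟩ := hT
      have hj' : j ∈ T.erase i := Finset.mem_erase.2 ⟨Ne.symm hij, hj⟩
      have e : xset T = xset ((T.erase i).erase j) * (MvPolynomial.X i * MvPolynomial.X j) := by
        rw [mul_comm, mul_assoc, X_mul_xset (Finset.notMem_erase _ _), Finset.insert_erase hj',
          X_mul_xset (Finset.notMem_erase _ _), Finset.insert_erase hi]
      have hdeg := totalDegree_xset_le T
      rw [e] at hdeg ⊢
      exact mul_mem_derivs_of_mem (Finset.mem_union_right _
        (Finset.mem_image.2 ⟨(i, j), by simp [hij, hadj], rfl⟩)) _ hdeg) hf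
  have hg0 : g = 0 := by
    refine eq_zero_of_sum_powerset fun A hA => ?_
    have hsol := (ind_mem_maxClique G).2 (hg A hA).1
    have h1 := eval_eq_zero_of_mem_derivs hfg hsol.1
    rw [map_sub, hS _ hsol, eval_ind_sum_xset] at h1
    linarith
  simpa [hg0] using hfg

lemma maxClique_rich (hn : 1 ≤ n) {c : ℕ} (hc : 13 ≤ c) (d : ℕ) :
    RichUpTo c (maxClique G) (maxClique G).solutions
      (ProbabilityTheory.uniformOn (maxClique G).solutions) d := by
  have hne : Nonempty (Fin n) := ⟨⟨0, hn⟩⟩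
  have hbool : ∀ α ∈ (maxClique G).solutions, ∃ A, α = ind A := fun α hα =>
    exists_eq_ind Finset.subset_union_left hα.1
  refine richUpTo_of_boolean (k := d) ⟨ind ∅, (ind_mem_maxClique G).2 (by simp)⟩ hbool le_rfl ?_
    (Nat.le_mul_of_pos_left _ (by omega)) hc
    (fun f hf h => maxClique_complete G hf h) ?_
  · intro q hq
    simp [maxClique] at hq
  -- With one vertex both subsets are cliques, and the explicit two-point estimate applies.
  · rcases Nat.lt_or_ge n 2 with h | h
    · right
      have : n = 1 := by omega
      subst this
      have e : (maxClique G).solutions = {ind (∅ : Finset (Fin 1)), ind Finset.univ} := by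
        ext α
        constructor
        · intro hα
          obtain ⟨A, rfl⟩ := hbool α hα
          rcases A.eq_empty_or_nonempty with rfl | hA
          · exact Or.inl rfl
          · right
            obtain ⟨i, hi⟩ := hA
            have : A = Finset.univ := by
              ext j
              rw [Subsingleton.elim j i]
              exact ⟨fun _ => Finset.mem_univ _, fun _ => hi⟩
            rw [this]
            rfl
        · rintro (rfl | rfl) <;> rw [ind_mem_maxClique] <;> intro i _ j _ hij <;>
            exact absurd (Subsingleton.elim i j) hij
      rw [e]
      exact spectrallyRich_pair d
    · left
      simpa using h

lemma maxClique_smallProofs (hn : 2 ≤ n) {c : ℕ} (hc : 118 ≤ c) (d : ℕ) :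
    SmallProofs c (maxClique G) d := by
  refine smallProofs_of_rich (by simpa using hn) (carries_boolean
    ⟨ind ∅, (ind_mem_maxClique G).2 (by simp)⟩ fun α hα =>
      exists_eq_ind Finset.subset_union_left hα.1)
    (maxClique_isSimpleSystem G (by omega)) (maxClique_rich G (by omega) (c := 13) le_rfl d)
    (by omega)

lemma maxCSP_eq_maxClique_top (n : ℕ) : maxCSP n = maxClique (⊤ : SimpleGraph (Fin n)) := by
  simp [maxCSP, maxClique]

end Clique

variable {σ : Type} [Fintype σ]

/-! ### Balanced Separator -/

/-- A multilinear polynomial of degree less than `|E|` is annihilated by the alternating sum over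
the subcube spanned by `E`. -/
lemma alternating_sum_eq_zero [DecidableEq σ] {g : Finset σ → ℝ} {d : ℕ}
    (hg : ∀ T, g T ≠ 0 → T.card ≤ d) (A E : Finset σ) (hE : d < E.card) :
    ∑ B ∈ E.powerset, (-1 : ℝ) ^ B.card * ∑ T ∈ (A ∪ B).powerset, g T = 0 := by
  have h1 : ∀ B, ∑ T ∈ (A ∪ B).powerset, g T = ∑ T, if T ⊆ A ∪ B then g T else 0 := by
    intro B
    rw [← Finset.sum_filter]
    congr 1
    ext T
    simp only [Finset.mem_powerset, Finset.mem_filter, Finset.mem_univ, true_and]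
  simp only [h1, Finset.mul_sum]
  rw [Finset.sum_comm]
  refine Finset.sum_eq_zero fun T _ => ?_
  by_cases hT : g T = 0
  · simp [hT]
  -- Some direction e of the subcube is missing from T, and toggling e changes the sign but not the
  -- monomial, so the terms cancel in pairs.
  obtain ⟨e, heE, heT⟩ : ∃ e ∈ E, e ∉ T := by
    by_contra! hcon
    have := Finset.card_le_card (show E ⊆ T from hcon)
    have := hg T hT
    omega
  rw [← Finset.insert_erase heE, Finset.sum_powerset_insert (Finset.notMem_erase _ _),
    ← Finset.sum_add_distrib]
  refine Finset.sum_eq_zero fun B hB => ?_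
  have heB : e ∉ B := fun h => Finset.notMem_erase e E (Finset.mem_powerset.1 hB h)
  have hiff : T ⊆ A ∪ insert e B ↔ T ⊆ A ∪ B := by
    constructor
    · intro h x hx
      have hx' := h hx
      have hxe : x ≠ e := by
        rintro rfl
        exact heT hx
      simp only [Finset.mem_union, Finset.mem_insert] at hx' ⊢
      tauto
    · intro h x hx
      have hx' := h hx
      simp only [Finset.mem_union, Finset.mem_insert] at hx' ⊢
      tauto
  rw [Finset.card_insert_of_notMem heB, pow_succ]
  simp only [hiff]
  ring

/-- A multilinear polynomial of degree at most `d` that vanishes on `d + 1` consecutive slices of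
the cube is zero. -/
lemma eq_zero_of_vanish_slices {g : Finset σ → ℝ} {d l : ℕ} (hg : ∀ T, g T ≠ 0 → T.card ≤ d)
    (hl : l + d ≤ Fintype.card σ)
    (h : ∀ A : Finset σ, l ≤ A.card → A.card ≤ l + d → ∑ T ∈ A.powerset, g T = 0) : g = 0 := by
  have key : ∀ k (A : Finset σ), A.card + k = l → ∑ T ∈ A.powerset, g T = 0 := by
    intro k
    induction k using Nat.strong_induction_on with
    | _ k ih =>
      intro A hA
      rcases Nat.eq_zero_or_pos k with rfl | hk
      · exact h A (by omega) (by omega)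
      have hcompl : d + 1 ≤ Aᶜ.card := by
        rw [Finset.card_compl]
        omega
      -- In the alternating sum over d + 1 directions outside A, the empty set contributes the value
      -- at A. All other points are larger and have at most l + d elements, so their values vanish
      -- by hypothesis or by induction.
      obtain ⟨E, hEsub, hEcard⟩ := Finset.exists_subset_card_eq hcompl
      have halt := alternating_sum_eq_zero hg A E (by omega)
      rw [Finset.sum_eq_single ∅] at halt
      · simpa using halt
      · intro B hB hB0
        have hBE := Finset.mem_powerset.1 hB
        have hdisj : Disjoint A B := by
          rw [Finset.disjoint_left]
          intro x hxA hxB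
          exact (Finset.mem_compl.1 (hEsub (hBE hxB))) hxA
        have hcard : (A ∪ B).card = A.card + B.card := Finset.card_union_of_disjoint hdisj
        have hB1 : 0 < B.card := Finset.card_pos.2 (Finset.nonempty_of_ne_empty hB0)
        have hB2 : B.card ≤ d + 1 := hEcard ▸ Finset.card_le_card hBE
        have : ∑ T ∈ (A ∪ B).powerset, g T = 0 := by
          by_cases hlt : l ≤ (A ∪ B).card
          · exact h _ hlt (by omega)
          · exact ih (l - (A ∪ B).card) (by omega) _ (by omega)
        rw [this, mul_zero]
      · intro hne
        exact absurd (Finset.empty_mem_powerset E) hne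
  refine eq_zero_of_sum_powerset fun A hA => ?_
  have := hg A hA
  by_cases hlt : l ≤ A.card
  · exact h A hlt (by omega)
  · exact key (l - A.card) A (by omega)

lemma eval_ind_sum_X (A : Finset σ) :
    MvPolynomial.eval (ind A) (∑ i, MvPolynomial.X i : MvPolynomial σ ℝ) = A.card := by
  rw [map_sum]
  simp [ind]

section Separator

variable {n : ℕ}

lemma ind_mem_balancedSeparator {η : ℝ} {A : Finset (Fin n)} :
    ind A ∈ (balancedSeparator n η).solutions ↔
      (A.card : ℝ) ≤ 2 * n / 3 + η ∧ (n : ℝ) / 3 - η ≤ A.card := by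
  constructor
  · intro h
    have h1 := h.2 (MvPolynomial.C (2 * (n : ℝ) / 3 + η) - ∑ i, MvPolynomial.X i)
      (by simp [balancedSeparator])
    have h2 := h.2 (∑ i, MvPolynomial.X i - MvPolynomial.C ((n : ℝ) / 3 - η))
      (by simp [balancedSeparator])
    rw [map_sub, MvPolynomial.eval_C, eval_ind_sum_X] at h1 h2
    constructor <;> linarith
  · rintro ⟨h1, h2⟩
    refine ⟨fun p hp => eval_ind_boolean A hp, fun q hq => ?_⟩
    simp only [balancedSeparator, Finset.mem_insert, Finset.mem_singleton] at hq
    rcases hq with rfl | rfl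
    · rw [map_sub, MvPolynomial.eval_C, eval_ind_sum_X]
      linarith
    · rw [map_sub, MvPolynomial.eval_C, eval_ind_sum_X]
      linarith

lemma balancedSeparator_complete {η : ℝ} {d l : ℕ} {S : Set (Fin n → ℝ)} (hl : l + d ≤ n)
    (hS : ∀ A : Finset (Fin n), l ≤ A.card → A.card ≤ l + d → ind A ∈ S)
    {f : MvPolynomial (Fin n) ℝ} (hf : f.totalDegree ≤ d)
    (hfS : ∀ α ∈ S, MvPolynomial.eval α f = 0) :
    f ∈ derivs (balancedSeparator n η).eqs d := by
  obtain ⟨g, hg, hfg⟩ := exists_multilinear (P := (balancedSeparator n η).eqs) (le_refl _)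
    (fun _ => True) (fun T hT => absurd trivial hT) hf
  have hg0 : g = 0 := by
    refine eq_zero_of_vanish_slices (fun T hT => (hg T hT).2) (by simpa using hl) fun A h1 h2 => ?_
    have h3 := eval_eq_zero_of_mem_derivs hfg (α := ind A) (fun p hp => eval_ind_boolean A hp)
    rw [map_sub, hfS _ (hS A h1 h2), eval_ind_sum_xset] at h3
    linarith
  simpa [hg0] using hfg

lemma balancedSeparator_isSimpleSystem (hn : 2 ≤ n) {η : ℝ} (hη : 0 ≤ η) (hη' : η ≤ 1 / 2) :
    IsSimpleSystem (balancedSeparator n η) (2 * Fintype.card (Fin n))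
      (3 * Fintype.card (Fin n) ^ 2) := by
  have hn' : (2 : ℝ) ≤ n := by exact_mod_cast hn
  have hsum : CoeffsLE (∑ i, MvPolynomial.X i : MvPolynomial (Fin n) ℝ) n := by
    have := CoeffsLE.sum Finset.univ fun (i : Fin n) _ => coeffsLE_X i
    simpa using this
  have hsumdeg : (∑ i, MvPolynomial.X i : MvPolynomial (Fin n) ℝ).totalDegree ≤ 1 :=
    MvPolynomial.totalDegree_finsetSum_le fun i _ => by rw [MvPolynomial.totalDegree_X]
  constructor
  · intro p hp
    refine (coeffsLE_boolean hp).mono ?_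
    rw [Fintype.card_fin]
    linarith
  · intro p hp m
    exact exists_int_coeff (boolean_mem_integralPolys hp) m
  · have h1 := card_booleanEqs_le (Fin n)
    refine h1.trans ?_
    rw [Fintype.card_fin]
    nlinarith
  · intro q hq
    simp only [balancedSeparator, Finset.mem_insert, Finset.mem_singleton] at hq
    rcases hq with rfl | rfl
    · refine (MvPolynomial.totalDegree_sub _ _).trans (max_le ?_ hsumdeg)
      rw [MvPolynomial.totalDegree_C]
      norm_num
    · refine (MvPolynomial.totalDegree_sub _ _).trans (max_le hsumdeg ?_)
      rw [MvPolynomial.totalDegree_C]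
      norm_num
  · intro q hq
    simp only [balancedSeparator, Finset.mem_insert, Finset.mem_singleton] at hq
    rcases hq with rfl | rfl
    · refine ((coeffsLE_C _).sub hsum).mono ?_
      rw [Fintype.card_fin, abs_of_nonneg (by positivity)]
      linarith
    · refine (hsum.sub (coeffsLE_C _)).mono ?_
      rw [Fintype.card_fin, abs_of_nonneg (by linarith)]
      linarith
  · exact Finset.card_le_two

lemma balancedSeparator_bool {η : ℝ} {α : Fin n → ℝ}
    (hα : α ∈ (balancedSeparator n η).solutions) : ∃ A, α = ind A :=
  exists_eq_ind (P := (balancedSeparator n η).eqs) (le_refl _) hα.1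

lemma balancedSeparator_nonempty {d : ℕ} (h1 : 3 * d ≤ n) (h2 : 3 * d + 1 ≠ n) :
    (balancedSeparator n 0).solutions.Nonempty := by
  obtain ⟨A, -, hA⟩ := Finset.exists_subset_card_eq
    (s := (Finset.univ : Finset (Fin n))) (n := (n + 2) / 3) (by
      rw [Finset.card_univ, Fintype.card_fin]
      omega)
  refine ⟨ind A, ind_mem_balancedSeparator.2 ?_⟩
  have h3 : 3 * A.card ≤ 2 * n := by omega
  have h4 : n ≤ 3 * A.card := by omega
  have h3' : (3 : ℝ) * A.card ≤ 2 * n := by exact_mod_cast h3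
  have h4' : (n : ℝ) ≤ 3 * A.card := by exact_mod_cast h4
  constructor <;> linarith

lemma balancedSeparator_rich {d : ℕ} (hn : 1 ≤ n) (h1 : 3 * d ≤ n) (h2 : 3 * d + 1 ≠ n) {c : ℕ}
    (hc : 13 ≤ c) :
    RichUpTo c (balancedSeparator n (1 / 2)) (balancedSeparator n 0).solutions
      (ProbabilityTheory.uniformOn (balancedSeparator n 0).solutions) d := by
  have hne : Nonempty (Fin n) := ⟨⟨0, hn⟩⟩
  -- Here l = (n+2)/3 is n/3 rounded up, the lowest slice of solutions. The d + 1 slices from l on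
  -- stay below 2n/3 for all n ≥ 3d except n = 3d + 1.
  refine richUpTo_of_boolean (k := d) (balancedSeparator_nonempty h1 h2)
    (fun α hα => balancedSeparator_bool hα) ?_ ?_ (Nat.le_mul_of_pos_left _ (by omega)) hc
    (fun f hf h => balancedSeparator_complete (l := (n + 2) / 3) (by omega) (fun A g1 g2 => ?_)
      hf h) ?_
  · intro α hα
    obtain ⟨A, rfl⟩ := balancedSeparator_bool hα
    rw [ind_mem_balancedSeparator] at hα ⊢
    constructor <;> linarith [hα.1, hα.2]
  · intro q hq α hα
    obtain ⟨A, rfl⟩ := balancedSeparator_bool hα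
    rw [ind_mem_balancedSeparator] at hα
    simp only [balancedSeparator, Finset.mem_insert, Finset.mem_singleton] at hq
    rcases hq with rfl | rfl
    · rw [map_sub, MvPolynomial.eval_C, eval_ind_sum_X]
      linarith [hα.1, hα.2]
    · rw [map_sub, MvPolynomial.eval_C, eval_ind_sum_X]
      linarith [hα.1, hα.2]
  · rw [ind_mem_balancedSeparator]
    have h3 : 3 * A.card ≤ 2 * n := by omega
    have h4 : n ≤ 3 * A.card := by omega
    have h3' : (3 : ℝ) * A.card ≤ 2 * n := by exact_mod_cast h3
    have h4' : (n : ℝ) ≤ 3 * A.card := by exact_mod_cast h4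
    constructor <;> linarith
  · left
    rw [Fintype.card_fin]
    by_contra h
    omega

lemma balancedSeparator_smallProofs {d : ℕ} (hn : 2 ≤ n) (h1 : 3 * d ≤ n) (h2 : 3 * d + 1 ≠ n)
    {c : ℕ} (hc : 118 ≤ c) : SmallProofs c (balancedSeparator n (1 / 2)) d :=
  smallProofs_of_rich (by simpa using hn)
    (carries_boolean (balancedSeparator_nonempty h1 h2) fun _ hα => balancedSeparator_bool hα)
    (balancedSeparator_isSimpleSystem hn (by norm_num) le_rfl)
    (balancedSeparator_rich (by omega) h1 h2 (c := 13) le_rfl) (by omega)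

/-- The solutions that satisfy both inequalities strictly. -/
def strictSeparators (n : ℕ) : Set (Fin n → ℝ) :=
  ind '' {A : Finset (Fin n) | n < 3 * A.card ∧ 3 * A.card < 2 * n}

lemma strictSeparators_nonempty {d : ℕ} (h : 3 * (d + 2) ≤ n) : (strictSeparators n).Nonempty := by
  obtain ⟨A, -, hA⟩ := Finset.exists_subset_card_eq
    (s := (Finset.univ : Finset (Fin n))) (n := n / 3 + 1) (by
      rw [Finset.card_univ, Fintype.card_fin]
      omega)
  refine ⟨ind A, A, ⟨?_, ?_⟩, rfl⟩ <;> omega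

lemma strictSeparators_bool : ∀ α ∈ strictSeparators n, ∃ A, α = ind A := by
  rintro α ⟨A, -, rfl⟩
  exact ⟨A, rfl⟩

lemma strictSeparators_rich {d : ℕ} (h : 3 * (d + 2) ≤ n) {c : ℕ} (hc : 13 ≤ c) :
    RichUpTo c (balancedSeparator n 0) (strictSeparators n)
      (ProbabilityTheory.uniformOn (strictSeparators n)) d := by
  have hne : Nonempty (Fin n) := ⟨⟨0, by omega⟩⟩
  refine richUpTo_of_boolean (k := d) (strictSeparators_nonempty h) strictSeparators_bool ?_ ?_
    (Nat.le_mul_of_pos_left _ (by omega)) hc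
    (fun f hf h => balancedSeparator_complete (S := strictSeparators n)
      (l := n / 3 + 1) (by omega)
      (fun A g1 g2 => ⟨A, ⟨by omega, by omega⟩, rfl⟩) hf h) (Or.inl (by
        rw [Fintype.card_fin]; omega))
  · rintro α ⟨A, ⟨h1, h2⟩, rfl⟩
    rw [ind_mem_balancedSeparator]
    have h3' : (3 : ℝ) * A.card < 2 * n := by exact_mod_cast h2
    have h4' : (n : ℝ) < 3 * A.card := by exact_mod_cast h1
    constructor <;> linarith
  · rintro q hq α ⟨A, ⟨h1, h2⟩, rfl⟩
    -- By integrality a strict inequality has slack at least 1/3, which exceeds the required 1/4.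
    have h3' : (3 : ℝ) * A.card + 1 ≤ 2 * n := by exact_mod_cast h2
    have h4' : (n : ℝ) + 1 ≤ 3 * A.card := by exact_mod_cast h1
    simp only [balancedSeparator, Finset.mem_insert, Finset.mem_singleton] at hq
    rcases hq with rfl | rfl
    · rw [map_sub, MvPolynomial.eval_C, eval_ind_sum_X]
      linarith
    · rw [map_sub, MvPolynomial.eval_C, eval_ind_sum_X]
      linarith

lemma strictSeparators_smallProofs {d : ℕ} (h : 3 * (d + 2) ≤ n) {c : ℕ} (hc : 118 ≤ c) :
    SmallProofs c (balancedSeparator n 0) d :=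
  smallProofs_of_rich (by rw [Fintype.card_fin]; omega)
    (carries_boolean (strictSeparators_nonempty h) strictSeparators_bool)
    (balancedSeparator_isSimpleSystem (by omega) le_rfl (by norm_num))
    (strictSeparators_rich h (c := 13) le_rfl) (by omega)

end Separator

variable {σ : Type} [Fintype σ]

/-! ### Inclusion matrices of subsets -/

lemma sum_mem_eq_sum_notMem [DecidableEq σ] (F : Finset σ → Finset σ → ℝ) :
    ∑ B : Finset σ, ∑ l ∈ B, F B (B.erase l) = ∑ C : Finset σ, ∑ l ∈ Cᶜ, F (insert l C) C := by
  rw [Finset.sum_sigma', Finset.sum_sigma']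
  refine Finset.sum_nbij' (fun x => ⟨x.1.erase x.2, x.2⟩) (fun x => ⟨insert x.2 x.1, x.2⟩)
    ?_ ?_ ?_ ?_ ?_
  · rintro ⟨B, l⟩ h
    simp
  · rintro ⟨C, l⟩ h
    simp
  · rintro ⟨B, l⟩ h
    have : l ∈ B := by simpa using h
    simp [Finset.insert_erase this]
  · rintro ⟨C, l⟩ h
    have : l ∉ C := by simpa using h
    simp [Finset.erase_insert this]
  · rintro ⟨B, l⟩ h
    have : l ∈ B := by simpa using h
    simp [Finset.insert_erase this]

/-- The map from functions on `j`-sets to functions on `(j + 1)`-sets that sums over the subsets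
with one element less is injective in the lower half of the cube. -/
lemma eq_zero_of_sum_erase [DecidableEq σ] {φ : Finset σ → ℝ} {j : ℕ}
    (hφ : ∀ B, φ B ≠ 0 → B.card = j) (hj : 2 * j < Fintype.card σ)
    (h : ∀ A : Finset σ, ∑ i ∈ A, φ (A.erase i) = 0) : φ = 0 := by
  set D : Finset σ → ℝ := fun C => ∑ i ∈ Cᶜ, φ (insert i C) with hD
  -- The sl₂ commutation relation on the cube: removing then adding an element differs from adding
  -- then removing one by n - 2|B|. The latter composition is zero by hypothesis.
  have hcomm : ∀ B, ∑ l ∈ B, D (B.erase l) + (Fintype.card σ - 2 * B.card : ℝ) * φ B = 0 := by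
    intro B
    have h1 : ∑ i ∈ Bᶜ, ∑ l ∈ insert i B, φ ((insert i B).erase l) = 0 :=
      Finset.sum_eq_zero fun i _ => h _
    have h2 : ∀ i ∈ Bᶜ, ∑ l ∈ insert i B, φ ((insert i B).erase l) =
        φ B + ∑ l ∈ B, φ (insert i (B.erase l)) := by
      intro i hi
      have hi' : i ∉ B := Finset.mem_compl.1 hi
      rw [Finset.sum_insert hi', Finset.erase_insert hi']
      congr 1
      refine Finset.sum_congr rfl fun l hl => ?_
      rw [Finset.erase_insert_of_ne]
      rintro rfl
      exact hi' hl
    rw [Finset.sum_congr rfl h2, Finset.sum_add_distrib, Finset.sum_const, nsmul_eq_mul] at h1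
    have h3 : ∀ l ∈ B, D (B.erase l) = φ B + ∑ i ∈ Bᶜ, φ (insert i (B.erase l)) := by
      intro l hl
      have : (B.erase l)ᶜ = insert l Bᶜ := by
        ext x
        simp only [Finset.mem_compl, Finset.mem_erase, Finset.mem_insert]
        tauto
      simp only [hD]
      rw [this, Finset.sum_insert (by simpa using hl), Finset.insert_erase hl]
    rw [Finset.sum_congr rfl h3, Finset.sum_add_distrib, Finset.sum_const, nsmul_eq_mul,
      Finset.sum_comm]
    rw [Finset.card_compl, Nat.cast_sub (Finset.card_le_univ B)] at h1
    linarith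
  -- Removal and addition of an element are adjoint. Pairing the relation with φ gives |Dφ|² + (n -
  -- 2j)|φ|² = 0, where both terms are nonnegative.
  have hadj : ∑ B, φ B * ∑ l ∈ B, D (B.erase l) = ∑ C, D C * D C := by
    simp only [Finset.mul_sum]
    rw [sum_mem_eq_sum_notMem (fun B C => φ B * D C)]
    refine Finset.sum_congr rfl fun C _ => ?_
    conv_rhs => rw [hD]
    simp only
    rw [Finset.sum_mul]
  have hsum : ∑ C, D C * D C + (Fintype.card σ - 2 * j : ℝ) * ∑ B, φ B * φ B = 0 := by
    rw [← hadj, Finset.mul_sum, ← Finset.sum_add_distrib]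
    refine Finset.sum_eq_zero fun B _ => ?_
    by_cases hB : φ B = 0
    · simp [hB]
    · have := hcomm B
      rw [hφ B hB] at this
      calc _ = φ B * (∑ l ∈ B, D (B.erase l) + (Fintype.card σ - 2 * j : ℝ) * φ B) := by ring
        _ = 0 := by rw [this, mul_zero]
  have hpos : (0 : ℝ) < Fintype.card σ - 2 * j := by
    have : (2 * j : ℝ) < Fintype.card σ := by exact_mod_cast hj
    linarith
  have h4 : 0 ≤ ∑ C, D C * D C := Finset.sum_nonneg fun _ _ => mul_self_nonneg _
  have h5 : 0 ≤ ∑ B, φ B * φ B := Finset.sum_nonneg fun _ _ => mul_self_nonneg _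
  have h6 : ∑ B, φ B * φ B = 0 := by nlinarith
  funext B
  have := (Finset.sum_eq_zero_iff_of_nonneg (fun _ _ => mul_self_nonneg _)).1 h6 B
    (Finset.mem_univ _)
  simpa using this

/-- A set T of size e inside A survives the removal of i for exactly |A| - e choices of i. So values
on one slice determine those on the next by an inclusion sum. -/
lemma sum_erase_sum_powerset [DecidableEq σ] {g : Finset σ → ℝ} {e : ℕ}
    (hg : ∀ T, g T ≠ 0 → T.card = e) (A : Finset σ) :
    ∑ i ∈ A, ∑ T ∈ (A.erase i).powerset, g T = (A.card - e : ℝ) * ∑ T ∈ A.powerset, g T := by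
  have h1 : ∀ i ∈ A, ∑ T ∈ (A.erase i).powerset, g T =
      ∑ T ∈ A.powerset, if i ∉ T then g T else 0 := by
    intro i hi
    rw [← Finset.sum_filter]
    congr 1
    ext T
    simp only [Finset.mem_powerset, Finset.mem_filter]
    exact Finset.subset_erase
  rw [Finset.sum_congr rfl h1, Finset.sum_comm, Finset.mul_sum]
  refine Finset.sum_congr rfl fun T hT => ?_
  by_cases hT0 : g T = 0
  · simp [hT0]
  rw [← Finset.sum_filter, Finset.sum_const, nsmul_eq_mul]
  congr 1
  have : A.filter (fun i => i ∉ T) = A \ T := by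
    ext; simp
  have hTA := Finset.mem_powerset.1 hT
  rw [this, Finset.card_sdiff_of_subset hTA, Nat.cast_sub (Finset.card_le_card hTA), hg T hT0]

/-- A homogeneous multilinear polynomial of degree `e ≤ k` that vanishes on the slice `k` in the
lower half of the cube is zero. -/
lemma eq_zero_of_vanish_slice {g : Finset σ → ℝ} {e k : ℕ} (hg : ∀ T, g T ≠ 0 → T.card = e)
    (hek : e ≤ k) (hk : 2 * k ≤ Fintype.card σ)
    (h : ∀ A : Finset σ, A.card = k → ∑ T ∈ A.powerset, g T = 0) : g = 0 := by
  -- Vanishing descends from slice k to slice e: if the values on slice j + 1 are zero, those on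
  -- slice j lie in the kernel of the inclusion map, which is injective because 2j < n. At slice e
  -- the value at a set is its coefficient.
  have key : ∀ i j, j + i = k → e ≤ j → ∀ A : Finset σ, A.card = j → ∑ T ∈ A.powerset, g T = 0 := by
    intro i
    induction i with
    | zero =>
      intro j hj _ A hA
      exact h A (by omega)
    | succ i ih =>
      intro j hj hej A hA
      set φ : Finset σ → ℝ := fun B => if B.card = j then ∑ T ∈ B.powerset, g T else 0 with hφ
      have h0 : φ = 0 := by
        refine eq_zero_of_sum_erase (j := j) ?_ (by omega) ?_
        · intro B hB
          by_contra hne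
          simp [hφ, hne] at hB
        · intro B
          by_cases hB : B.card = j + 1
          · have h1 : ∀ i ∈ B, φ (B.erase i) = ∑ T ∈ (B.erase i).powerset, g T := by
              intro i hi
              simp only [hφ]
              rw [if_pos]
              rw [Finset.card_erase_of_mem hi, hB]
              omega
            rw [Finset.sum_congr rfl h1, sum_erase_sum_powerset hg,
              ih (j + 1) (by omega) (by omega) B hB, mul_zero]
          · refine Finset.sum_eq_zero fun i hi => ?_
            simp only [hφ]
            rw [if_neg]
            rw [Finset.card_erase_of_mem hi]
            have : 0 < B.card := Finset.card_pos.2 ⟨i, hi⟩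
            omega
      have := congrFun h0 A
      simpa [hφ, hA] using this
  exact eq_zero_of_sum_powerset fun A hA => key (k - e) e (by omega) le_rfl A (hg A hA)

/-! ### Max-Bisection -/

section Bisection

variable {n k : ℕ}

/-- The span of the squarefree monomials with support in a given family. -/
def xspan {σ : Type} (K : Set (Finset σ)) : Submodule ℝ (MvPolynomial σ ℝ) :=
  Submodule.span ℝ (xset '' K)

lemma xset_mem_xspan {K : Set (Finset σ)} {T : Finset σ} (hT : T ∈ K) : xset T ∈ xspan K :=
  Submodule.subset_span ⟨T, hT, rfl⟩

lemma exists_of_mem_xspan {K : Set (Finset σ)} {h : MvPolynomial σ ℝ} (hh : h ∈ xspan K) :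
    ∃ g : Finset σ → ℝ, (∀ T, g T ≠ 0 → T ∈ K) ∧ h = ∑ T, g T • xset T := by
  induction hh using Submodule.span_induction with
  | mem x hx =>
    obtain ⟨T, hT, rfl⟩ := hx
    refine ⟨fun U => if U = T then 1 else 0, fun U hU => ?_, ?_⟩
    · by_cases hUT : U = T
      · exact hUT ▸ hT
      · simp [hUT] at hU
    · simp
  | zero => exact ⟨0, by simp, by simp⟩
  | add x y _ _ hx hy =>
    obtain ⟨g, hg, rfl⟩ := hx
    obtain ⟨g', hg', rfl⟩ := hy
    refine ⟨g + g', fun T hT => ?_, ?_⟩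
    · by_cases h0 : g T = 0
      · refine hg' T ?_
        simpa [h0] using hT
      · exact hg T h0
    · simp [add_smul, Finset.sum_add_distrib]
  | smul a x _ hx =>
    obtain ⟨g, hg, rfl⟩ := hx
    refine ⟨a • g, fun T hT => hg T ?_, ?_⟩
    · intro h0
      simp [h0] at hT
    · simp [Finset.smul_sum, smul_smul]

lemma sum_xset_mem_xspan {K : Set (Finset σ)} {g : Finset σ → ℝ} (hg : ∀ T, g T ≠ 0 → T ∈ K) :
    ∑ T, g T • xset T ∈ xspan K := by
  refine Submodule.sum_mem _ fun T _ => ?_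
  by_cases h0 : g T = 0
  · simp [h0]
  · exact Submodule.smul_mem _ _ (xset_mem_xspan (hg T h0))

lemma bisection_boolean : booleanEqs (Fin n) ⊆ (maxBisection n).eqs := Finset.subset_union_left

/-- This is x_T times the constraint Σ x_i = k after reducing squares: the indices in T contribute
|T| x_T and the others enlarge T. -/
lemma bisection_lift (hn : n = 2 * k) (T : Finset (Fin n)) :
    ((k : ℝ) - T.card) • xset T - ∑ i ∈ Tᶜ, xset (insert i T) ∈
      derivs (maxBisection n).eqs (T.card + 1) := by
  have hk : (n : ℝ) / 2 = k := by
    rw [hn]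
    push_cast
    ring
  set lin : MvPolynomial (Fin n) ℝ := ∑ i, MvPolynomial.X i - MvPolynomial.C ((n : ℝ) / 2) with hlin
  have hmem : lin ∈ (maxBisection n).eqs := Finset.mem_union_right _ (by simp [hlin])
  have hdeg : lin.totalDegree ≤ 1 := by
    refine (MvPolynomial.totalDegree_sub_C_le _ _).trans ?_
    exact MvPolynomial.totalDegree_finsetSum_le fun i _ => by rw [MvPolynomial.totalDegree_X]
  have h1 : xset T * lin ∈ derivs (maxBisection n).eqs (T.card + 1) := by
    refine mul_mem_derivs_of_mem hmem _ ((MvPolynomial.totalDegree_mul _ _).trans ?_)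
    have := totalDegree_xset_le T
    omega
  have h2 : ∑ i, (MvPolynomial.X i * xset T - xset (insert i T)) ∈
      derivs (maxBisection n).eqs (T.card + 1) :=
    Submodule.sum_mem _ fun i _ => X_mul_xset_sub_mem bisection_boolean i T le_rfl
  have h3 : ∑ i, xset (insert i T) = (T.card : ℝ) • xset T + ∑ i ∈ Tᶜ, xset (insert i T) := by
    rw [← Finset.sum_add_sum_compl T]
    congr 1
    rw [Finset.sum_congr rfl fun i hi => by rw [Finset.insert_eq_of_mem hi], Finset.sum_const,
      Nat.cast_smul_eq_nsmul]
  have h4 : xset T * lin = ∑ i, MvPolynomial.X i * xset T - (k : ℝ) • xset T := by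
    rw [hlin, hk, mul_sub, Finset.mul_sum, mul_comm _ (MvPolynomial.C _), ← MvPolynomial.smul_eq_C_mul]
    simp only [mul_comm]
  rw [h4] at h1
  rw [Finset.sum_sub_distrib, h3] at h2
  convert sub_mem h2 h1 using 1
  rw [sub_smul]
  abel

/-- Downward induction from the full set. Beyond size k the factor k - |T| is nonzero, so x_T
reduces to larger sets, and the full set has no larger ones. -/
lemma bisection_high (hn : n = 2 * k) (T : Finset (Fin n)) (hT : k < T.card) :
    xset T ∈ derivs (maxBisection n).eqs (n + 1) := by
  induction hm : n - T.card generalizing T with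
  | zero =>
    have hle := Finset.card_le_univ T
    rw [Fintype.card_fin] at hle
    have hcard : T.card = n := by omega
    have huniv : Tᶜ = ∅ := by
      rw [← Finset.card_eq_zero, Finset.card_compl, Fintype.card_fin]
      omega
    have h := bisection_lift hn T
    rw [huniv, Finset.sum_empty, sub_zero, hcard] at h
    refine (Submodule.smul_mem_iff _ ?_).1 h
    have : (k : ℝ) < n := by exact_mod_cast hcard ▸ hT
    linarith
  | succ m ih =>
    have hle := Finset.card_le_univ T
    rw [Fintype.card_fin] at hle
    have h1 := derivs_mono (by omega : T.card + 1 ≤ n + 1) (bisection_lift hn T)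
    have h2 : ∑ i ∈ Tᶜ, xset (insert i T) ∈ derivs (maxBisection n).eqs (n + 1) := by
      refine Submodule.sum_mem _ fun i hi => ?_
      have hi' : i ∉ T := Finset.mem_compl.1 hi
      refine ih _ ?_ ?_ <;> rw [Finset.card_insert_of_notMem hi'] <;> omega
    have h3 := add_mem h1 h2
    rw [sub_add_cancel] at h3
    refine (Submodule.smul_mem_iff _ ?_).1 h3
    have : (k : ℝ) < T.card := by exact_mod_cast hT
    linarith

/-- Below size k the lifting identity can be solved for x_T and raises every monomial to the common
size e, without exceeding degree e. -/
lemma bisection_low (hn : n = 2 * k) {e : ℕ} (he : e ≤ k) (T : Finset (Fin n)) (hT : T.card ≤ e) :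
    xset T ∈ derivs (maxBisection n).eqs e ⊔ xspan {U | U.card = e} := by
  induction hm : e - T.card generalizing T with
  | zero =>
    exact Submodule.mem_sup_right (xset_mem_xspan (by simp; omega))
  | succ m ih =>
    have h1 : _ ∈ derivs (maxBisection n).eqs e ⊔ xspan {U | U.card = e} :=
      Submodule.mem_sup_left (derivs_mono (by omega : T.card + 1 ≤ e) (bisection_lift hn T))
    have h2 : ∑ i ∈ Tᶜ, xset (insert i T) ∈
        derivs (maxBisection n).eqs e ⊔ xspan {U | U.card = e} := by
      refine Submodule.sum_mem _ fun i hi => ?_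
      have hi' : i ∉ T := Finset.mem_compl.1 hi
      refine ih _ ?_ ?_ <;> rw [Finset.card_insert_of_notMem hi'] <;> omega
    have h3 := add_mem h1 h2
    rw [sub_add_cancel] at h3
    refine (Submodule.smul_mem_iff _ ?_).1 h3
    have : (T.card : ℝ) < k := by exact_mod_cast (by omega : T.card < k)
    linarith

lemma ind_mem_maxBisection (hn : n = 2 * k) {A : Finset (Fin n)} :
    ind A ∈ (maxBisection n).solutions ↔ A.card = k := by
  have hk : (n : ℝ) / 2 = k := by
    rw [hn]
    push_cast
    ring
  constructor
  · intro h
    have := h.1 (∑ i, MvPolynomial.X i - MvPolynomial.C ((n : ℝ) / 2))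
      (Finset.mem_union_right _ (by simp))
    rw [map_sub, eval_ind_sum_X, MvPolynomial.eval_C, hk] at this
    have h2 : (A.card : ℝ) = k := by linarith
    exact_mod_cast h2
  · intro h
    refine ⟨fun p hp => ?_, by simp [maxBisection]⟩
    rcases Finset.mem_union.1 hp with hp | hp
    · exact eval_ind_boolean A hp
    · rw [Finset.mem_singleton] at hp
      rw [hp, map_sub, eval_ind_sum_X, MvPolynomial.eval_C, hk, h, sub_self]

lemma maxBisection_complete (hn : n = 2 * k) {d : ℕ} {f : MvPolynomial (Fin n) ℝ}
    (hf : f.totalDegree ≤ d) (hS : ∀ α ∈ (maxBisection n).solutions, MvPolynomial.eval α f = 0) :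
    f ∈ derivs (maxBisection n).eqs (2 * d) := by
  obtain ⟨g, hg, hfg⟩ := exists_multilinear bisection_boolean
    (fun _ => True) (fun T hT => absurd trivial hT) hf
  have hmem : ∑ T, g T • xset T ∈
      derivs (maxBisection n).eqs (2 * d) ⊔ xspan {U | U.card = min d k} := by
    refine Submodule.sum_mem _ fun T _ => ?_
    by_cases h0 : g T = 0
    · simp [h0]
    have hTd := (hg T h0).2
    refine Submodule.smul_mem _ _ ?_
    by_cases hTk : T.card ≤ min d k
    · have h1 := bisection_low hn (min_le_right d k) T hTk
      exact sup_le_sup_right (derivs_mono (by omega)) _ h1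
    -- Here d ≥ |T| > k, so the degree n + 1 = 2k + 1 is below 2d; this case is the source of the
    -- factor 2.
    · exact Submodule.mem_sup_left (derivs_mono (by omega) (bisection_high hn T (by omega)))
  obtain ⟨a, ha, h, hh, hah⟩ := Submodule.mem_sup.1 hmem
  obtain ⟨g', hg', rfl⟩ := exists_of_mem_xspan hh
  have hfg' : f - ∑ T, g' T • xset T ∈ derivs (maxBisection n).eqs (2 * d) := by
    have := add_mem (derivs_mono (by omega : d ≤ 2 * d) hfg) ha
    rw [← hah] at this
    convert this using 1
    ring
  have hg0 : g' = 0 := by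
    refine eq_zero_of_vanish_slice (e := min d k) (k := k) (fun T hT => hg' T hT)
      (min_le_right _ _) (by rw [Fintype.card_fin]; omega) fun A hA => ?_
    have hsol := (ind_mem_maxBisection hn).2 hA
    have h3 := eval_eq_zero_of_mem_derivs hfg' hsol.1
    rw [map_sub, hS _ hsol, eval_ind_sum_xset] at h3
    linarith
  simpa [hg0] using hfg'

lemma maxBisection_nonempty (hn : n = 2 * k) : (maxBisection n).solutions.Nonempty := by
  obtain ⟨A, -, hA⟩ := Finset.exists_subset_card_eq
    (s := (Finset.univ : Finset (Fin n))) (n := k) (by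
      rw [Finset.card_univ, Fintype.card_fin]
      omega)
  exact ⟨ind A, (ind_mem_maxBisection hn).2 hA⟩

lemma maxBisection_rich (h2 : 2 ≤ n) (he : Even n) {c : ℕ} (hc : 13 ≤ c) (d : ℕ) :
    RichUpTo c (maxBisection n) (maxBisection n).solutions
      (ProbabilityTheory.uniformOn (maxBisection n).solutions) d := by
  obtain ⟨k, hk⟩ := he
  have hn : n = 2 * k := by omega
  have hne : Nonempty (Fin n) := ⟨⟨0, by omega⟩⟩
  refine richUpTo_of_boolean (k := 2 * d) (maxBisection_nonempty hn)
    (fun α hα => exists_eq_ind bisection_boolean hα.1) le_rfl ?_ (Nat.mul_le_mul_right _ (by omega))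
    hc (fun f hf h => maxBisection_complete hn hf h) (Or.inl (by simpa using h2))
  intro q hq
  simp [maxBisection] at hq

lemma maxBisection_isSimpleSystem (h2 : 2 ≤ n) (he : Even n) :
    IsSimpleSystem (maxBisection n) (2 * Fintype.card (Fin n))
      (3 * Fintype.card (Fin n) ^ 2) := by
  have hn' : (2 : ℝ) ≤ n := by exact_mod_cast h2
  obtain ⟨k, hk⟩ := he
  have hk' : (n : ℝ) / 2 = k := by
    rw [hk]
    push_cast
    ring
  constructor
  · intro p hp
    rcases Finset.mem_union.1 hp with hp | hp
    · refine (coeffsLE_boolean hp).mono ?_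
      rw [Fintype.card_fin]
      linarith
    · rw [Finset.mem_singleton] at hp
      have hsum := CoeffsLE.sum Finset.univ fun (i : Fin n) _ => coeffsLE_X i
      rw [hp]
      refine (hsum.sub (coeffsLE_C _)).mono ?_
      rw [abs_of_nonneg (by positivity), Fintype.card_fin, Finset.card_univ, Fintype.card_fin]
      linarith
  · intro p hp m
    refine exists_int_coeff ?_ m
    rcases Finset.mem_union.1 hp with hp | hp
    · exact boolean_mem_integralPolys hp
    · rw [Finset.mem_singleton] at hp
      rw [hp, hk']
      refine sub_mem (sum_mem fun i _ => X_mem_integralPolys i) ⟨MvPolynomial.C (k : ℤ), by simp⟩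
  · refine (Finset.card_union_le _ _).trans ?_
    have h1 := card_booleanEqs_le (Fin n)
    rw [Finset.card_singleton]
    rw [Fintype.card_fin] at *
    nlinarith
  all_goals simp [maxBisection]

lemma maxBisection_smallProofs (h2 : 2 ≤ n) (he : Even n) {c : ℕ} (hc : 118 ≤ c) (d : ℕ) :
    SmallProofs c (maxBisection n) d := by
  have hrich := maxBisection_rich h2 he (c := 13) le_rfl d
  obtain ⟨k, hk⟩ := he
  exact smallProofs_of_rich (by simpa using h2)
    (carries_boolean (maxBisection_nonempty (k := k) (by omega))
      fun α hα => exists_eq_ind bisection_boolean hα.1)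
    (maxBisection_isSimpleSystem h2 ⟨k, hk⟩) hrich (by omega)

end Bisection

/-! ### Matchings -/

section Matching

variable {n : ℕ}

/-- The edges are pairwise disjoint. -/
def IsM (T : Finset (Edge n)) : Prop :=
  ∀ e ∈ T, ∀ f ∈ T, e ≠ f → ∀ v, v ∈ e.1 → v ∉ f.1

lemma IsM.mono {T U : Finset (Edge n)} (h : IsM U) (hTU : T ⊆ U) : IsM T :=
  fun e he f hf => h e (hTU he) f (hTU hf)

/-- The vertices that are not covered by the edges in `T`. -/
def uncov (T : Finset (Edge n)) : Finset (Fin n) :=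
  Finset.univ.filter fun v => ∀ e ∈ T, v ∉ e.1

lemma mem_uncov {T : Finset (Edge n)} {v : Fin n} : v ∈ uncov T ↔ ∀ e ∈ T, v ∉ e.1 := by
  simp [uncov]

/-- The edge between two vertices. -/
def mkE (a b : Fin n) (h : a ≠ b) : Edge n := ⟨s(a, b), by simpa using h⟩

lemma mem_mkE {a b v : Fin n} {h : a ≠ b} : v ∈ (mkE a b h).1 ↔ v = a ∨ v = b := by
  simp [mkE]

lemma exists_mkE (e : Edge n) : ∃ a b, ∃ h : a ≠ b, e = mkE a b h := by
  obtain ⟨e, he⟩ := e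
  induction e using Sym2.ind with
  | _ a b => exact ⟨a, b, by simpa using he, rfl⟩

lemma card_uncov_insert {T : Finset (Edge n)} {e : Edge n} (he : e ∉ T) (h : IsM (insert e T)) :
    (uncov (insert e T)).card + 2 = (uncov T).card := by
  obtain ⟨a, b, hab, rfl⟩ := exists_mkE e
  have hv : ∀ v, v ∈ (mkE a b hab).1 → v ∈ uncov T := by
    intro v hv
    rw [mem_uncov]
    intro f hf
    refine h _ (Finset.mem_insert_self _ _) f (Finset.mem_insert_of_mem hf) ?_ v hv
    rintro rfl
    exact he hf
  have ha := hv a (mem_mkE.2 (Or.inl rfl))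
  have hb := hv b (mem_mkE.2 (Or.inr rfl))
  have hEq : uncov (insert (mkE a b hab) T) = ((uncov T).erase a).erase b := by
    ext v
    simp only [mem_uncov, Finset.mem_insert, Finset.mem_erase, forall_eq_or_imp, mem_mkE, not_or]
    tauto
  have hb' : b ∈ (uncov T).erase a := Finset.mem_erase.2 ⟨Ne.symm hab, hb⟩
  have h1 := Finset.card_erase_add_one hb'
  have h2 := Finset.card_erase_add_one ha
  rw [hEq]
  omega

lemma card_uncov {T : Finset (Edge n)} (h : IsM T) : (uncov T).card + 2 * T.card = n := by
  induction T using Finset.induction_on with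
  | empty => simp [uncov]
  | insert e T he ih =>
    have h1 := ih (h.mono (Finset.subset_insert _ _))
    have h2 := card_uncov_insert he h
    rw [Finset.card_insert_of_notMem he]
    omega

lemma IsM.insert_mkE {T : Finset (Edge n)} (h : IsM T) {a b : Fin n} (hab : a ≠ b)
    (ha : a ∈ uncov T) (hb : b ∈ uncov T) : IsM (insert (mkE a b hab) T) := by
  intro e he f hf hef v hve hvf
  rw [mem_uncov] at ha hb
  rcases Finset.mem_insert.1 he with he' | he'
  · rcases Finset.mem_insert.1 hf with hf' | hf'
    · exact hef (he'.trans hf'.symm)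
    · rw [he'] at hve
      rcases mem_mkE.1 hve with rfl | rfl
      exacts [ha f hf' hvf, hb f hf' hvf]
  · rcases Finset.mem_insert.1 hf with hf' | hf'
    · rw [hf'] at hvf
      rcases mem_mkE.1 hvf with rfl | rfl
      exacts [ha e he' hve, hb e he' hve]
    · exact h e he' f hf' hef v hve hvf

/-- Perfect matchings. -/
def IsPM (A : Finset (Edge n)) : Prop := IsM A ∧ uncov A = ∅

/-- The number of uncovered vertices is n - 2|T|, hence even; if it is not zero, two of them can be
joined. -/
lemma IsM.exists_isPM (hn : Even n) {T : Finset (Edge n)} (h : IsM T) : ∃ A, T ⊆ A ∧ IsPM A := by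
  induction hm : (uncov T).card using Nat.strong_induction_on generalizing T with
  | _ m ih =>
    by_cases h0 : uncov T = ∅
    · exact ⟨T, le_rfl, h, h0⟩
    have hc := card_uncov h
    have hpos : 0 < (uncov T).card := Finset.card_pos.2 (Finset.nonempty_of_ne_empty h0)
    obtain ⟨k, hk⟩ := hn
    obtain ⟨a, ha, b, hb, hab⟩ := Finset.one_lt_card.1 (by omega : 1 < (uncov T).card)
    have hT' := h.insert_mkE hab ha hb
    have hnot : mkE a b hab ∉ T := fun hmem =>
      (mem_uncov.1 ha) _ hmem (mem_mkE.2 (Or.inl rfl))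
    have hcard := card_uncov_insert hnot hT'
    obtain ⟨A, hA, hPM⟩ := ih _ (by omega) hT' rfl
    exact ⟨A, (Finset.subset_insert _ _).trans hA, hPM⟩

/-! #### The constraint system -/

lemma matching_boolean : booleanEqs (Edge n) ⊆ (matching n).eqs :=
  Finset.subset_union_left.trans Finset.subset_union_left

/-- The sum of the variables of the edges at `v`. -/
def starSum (v : Fin n) : MvPolynomial (Edge n) ℝ :=
  ∑ e ∈ Finset.univ.filter (fun e : Edge n => v ∈ e.1), MvPolynomial.X e

lemma starSum_sub_one_mem (v : Fin n) : starSum v - 1 ∈ (matching n).eqs :=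
  Finset.mem_union_left _ (Finset.mem_union_right _ (Finset.mem_image.2 ⟨v, Finset.mem_univ _, rfl⟩))

lemma X_mul_X_mem {e f : Edge n} (hef : e ≠ f) {v : Fin n} (he : v ∈ e.1) (hf : v ∈ f.1) :
    (MvPolynomial.X e * MvPolynomial.X f : MvPolynomial (Edge n) ℝ) ∈ (matching n).eqs :=
  Finset.mem_union_right _ (Finset.mem_image.2 ⟨(e, f), by simpa using ⟨hef, v, he, hf⟩, rfl⟩)

lemma matching_eqs_cases {p : MvPolynomial (Edge n) ℝ} (hp : p ∈ (matching n).eqs) :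
    p ∈ booleanEqs (Edge n) ∨ (∃ v, p = starSum v - 1) ∨
      ∃ e f : Edge n, e ≠ f ∧ (∃ v, v ∈ e.1 ∧ v ∈ f.1) ∧
        p = MvPolynomial.X e * MvPolynomial.X f := by
  rcases Finset.mem_union.1 hp with hp | hp
  · rcases Finset.mem_union.1 hp with hp | hp
    · exact Or.inl hp
    · obtain ⟨v, -, rfl⟩ := Finset.mem_image.1 hp
      exact Or.inr (Or.inl ⟨v, rfl⟩)
  · obtain ⟨e, he, rfl⟩ := Finset.mem_image.1 hp
    simp only [Finset.mem_filter, Finset.mem_univ, true_and] at he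
    exact Or.inr (Or.inr ⟨e.1, e.2, he.1, he.2, rfl⟩)

lemma totalDegree_starSum_sub_one_le (v : Fin n) : (starSum v - 1).totalDegree ≤ 1 := by
  refine (MvPolynomial.totalDegree_sub _ _).trans (max_le ?_ (by simp))
  exact MvPolynomial.totalDegree_finsetSum_le fun i _ => by rw [MvPolynomial.totalDegree_X]

lemma eval_ind_starSum (A : Finset (Edge n)) (v : Fin n) :
    MvPolynomial.eval (ind A) (starSum v) = (A.filter fun e => v ∈ e.1).card := by
  have hi : ∀ e, ind A e = if e ∈ A then (1 : ℝ) else 0 := fun e => by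
    unfold ind
    congr
  rw [starSum, map_sum]
  simp only [MvPolynomial.eval_X, hi]
  rw [Finset.sum_boole, Finset.filter_filter]
  congr 2
  ext e
  simp [and_comm]

lemma ind_mem_matching_of_isPM {A : Finset (Edge n)} (hA : IsPM A) :
    ind A ∈ (matching n).solutions := by
  refine ⟨fun p hp => ?_, by simp [matching]⟩
  rcases matching_eqs_cases hp with hp | ⟨v, rfl⟩ | ⟨e, f, hef, ⟨v, hve, hvf⟩, rfl⟩
  · exact eval_ind_boolean A hp
  · rw [map_sub, map_one, eval_ind_starSum]
    have hv : v ∉ uncov A := by simp [hA.2]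
    rw [mem_uncov] at hv
    push Not at hv
    obtain ⟨e, he, hve⟩ := hv
    have : (A.filter fun e => v ∈ e.1) = {e} := by
      ext f
      simp only [Finset.mem_filter, Finset.mem_singleton]
      constructor
      · rintro ⟨hf, hvf⟩
        by_contra hne
        exact hA.1 f hf e he hne v hvf hve
      · rintro rfl
        exact ⟨he, hve⟩
    rw [this]
    simp
  · simp only [map_mul, MvPolynomial.eval_X, ind]
    by_cases he : e ∈ A
    · by_cases hf : f ∈ A
      · exact absurd hvf (hA.1 e he f hf hef v hve)
      · simp [hf]
    · simp [he]

/-- Polynomials that vanish on all perfect matchings. -/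
def Van (h : MvPolynomial (Edge n) ℝ) : Prop := ∀ A, IsPM A → MvPolynomial.eval (ind A) h = 0

lemma van_of_mem_derivs {h : MvPolynomial (Edge n) ℝ} {k : ℕ} (hh : h ∈ derivs (matching n).eqs k) :
    Van h := fun _ hA => eval_eq_zero_of_mem_derivs hh (ind_mem_matching_of_isPM hA).1

lemma Van.sub {h h' : MvPolynomial (Edge n) ℝ} (hh : Van h) (hh' : Van h') : Van (h - h') :=
  fun A hA => by rw [map_sub, hh A hA, hh' A hA, sub_zero]

lemma Van.mul {h : MvPolynomial (Edge n) ℝ} (hh : Van h) (q : MvPolynomial (Edge n) ℝ) :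
    Van (q * h) := fun A hA => by rw [map_mul, hh A hA, mul_zero]

lemma xset_mem_of_not_isM {T : Finset (Edge n)} (hT : ¬ IsM T) {k : ℕ} (hk : T.card ≤ k) :
    xset T ∈ derivs (matching n).eqs k := by
  unfold IsM at hT
  push Not at hT
  obtain ⟨i, hi, j, hj, hij, v, hvi, hvj⟩ := hT
  have hj' : j ∈ T.erase i := Finset.mem_erase.2 ⟨Ne.symm hij, hj⟩
  have e : xset T = xset ((T.erase i).erase j) * (MvPolynomial.X i * MvPolynomial.X j) := by
    rw [mul_comm, mul_assoc, X_mul_xset (Finset.notMem_erase _ _), Finset.insert_erase hj',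
      X_mul_xset (Finset.notMem_erase _ _), Finset.insert_erase hi]
  have hdeg := (totalDegree_xset_le T).trans hk
  rw [e] at hdeg ⊢
  exact mul_mem_derivs_of_mem (X_mul_X_mem hij hvi hvj) _ hdeg

lemma starSum_mul_sub_mem (v : Fin n) {p : MvPolynomial (Edge n) ℝ} {k : ℕ}
    (hp : p.totalDegree + 1 ≤ k) : starSum v * p - p ∈ derivs (matching n).eqs k := by
  have : starSum v * p - p = p * (starSum v - 1) := by ring
  rw [this]
  refine mul_mem_derivs_of_mem (starSum_sub_one_mem v) _ ((MvPolynomial.totalDegree_mul _ _).trans ?_)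
  have := totalDegree_starSum_sub_one_le v
  omega

/-- This is x_T times the degree constraint at v. When v is uncovered, every term on the right has
one edge more than T. -/
lemma matching_lift (v : Fin n) (T : Finset (Edge n)) :
    xset T - ∑ e ∈ Finset.univ.filter (fun e : Edge n => v ∈ e.1), xset (insert e T) ∈
      derivs (matching n).eqs (T.card + 1) := by
  have h1 := starSum_mul_sub_mem v (p := xset T) (k := T.card + 1)
    (Nat.succ_le_succ (totalDegree_xset_le T))
  have h2 : ∑ e ∈ Finset.univ.filter (fun e : Edge n => v ∈ e.1),
      (MvPolynomial.X e * xset T - xset (insert e T)) ∈ derivs (matching n).eqs (T.card + 1) :=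
    Submodule.sum_mem _ fun e _ => X_mul_xset_sub_mem matching_boolean e T le_rfl
  rw [Finset.sum_sub_distrib, ← Finset.sum_mul] at h2
  convert sub_mem h2 h1 using 1
  rw [starSum]
  ring

/-- The matchings of size `m` that extend `B`. -/
def fam (B : Finset (Edge n)) (m : ℕ) : Set (Finset (Edge n)) := {T | B ⊆ T ∧ IsM T ∧ T.card = m}

lemma matching_low {B T : Finset (Edge n)} (hBT : B ⊆ T) {m : ℕ} (hT : T.card ≤ m)
    (hm : 2 * m ≤ n) : xset T ∈ derivs (matching n).eqs m ⊔ xspan (fam B m) := by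
  induction hj : m - T.card generalizing T with
  | zero =>
    by_cases h : IsM T
    · exact Submodule.mem_sup_right (xset_mem_xspan ⟨hBT, h, by omega⟩)
    · exact Submodule.mem_sup_left (xset_mem_of_not_isM h hT)
  | succ j ih =>
    by_cases h : IsM T
    · have hc := card_uncov h
      obtain ⟨v, hv⟩ := Finset.card_pos.1 (by omega : 0 < (uncov T).card)
      have h1 : _ ∈ derivs (matching n).eqs m ⊔ xspan (fam B m) :=
        Submodule.mem_sup_left (derivs_mono (by omega) (matching_lift v T))
      have h2 : ∑ e ∈ Finset.univ.filter (fun e : Edge n => v ∈ e.1), xset (insert e T) ∈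
          derivs (matching n).eqs m ⊔ xspan (fam B m) := by
        refine Submodule.sum_mem _ fun e he => ?_
        have hve : v ∈ e.1 := by simpa using he
        have heT : e ∉ T := fun hmem => (mem_uncov.1 hv) e hmem hve
        refine ih (hBT.trans (Finset.subset_insert _ _)) ?_ ?_ <;>
          rw [Finset.card_insert_of_notMem heT] <;> omega
      have h3 := add_mem h1 h2
      rwa [sub_add_cancel] at h3
    · exact Submodule.mem_sup_left (xset_mem_of_not_isM h hT)

/-- Monomials are raised to a common size, capped at n/2 because larger edge sets are not matchings.
A common size is needed so that permutations act transitively on those that remain. -/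
lemma matching_reduce {B T : Finset (Edge n)} (hBT : B ⊆ T) {m : ℕ} (hT : T.card ≤ m) :
    xset T ∈ derivs (matching n).eqs m ⊔ xspan (fam B (min m (n / 2))) := by
  by_cases h : T.card ≤ min m (n / 2)
  · have := matching_low hBT h (by omega)
    exact sup_le_sup_right (derivs_mono (min_le_left _ _)) _ this
  · refine Submodule.mem_sup_left (xset_mem_of_not_isM (fun hM => ?_) hT)
    have := card_uncov hM
    omega

/-! #### Permutations of the vertices -/

/-- The action of permutations of the vertices on edges. -/
def emap (π : Equiv.Perm (Fin n)) (e : Edge n) : Edge n :=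
  ⟨e.1.map π, by
    rw [Sym2.isDiag_map π.injective]
    exact e.2⟩

lemma emap_mkE (π : Equiv.Perm (Fin n)) {a b : Fin n} (h : a ≠ b) :
    emap π (mkE a b h) = mkE (π a) (π b) (fun h' => h (π.injective h')) := by
  apply Subtype.ext
  simp [emap, mkE]

lemma emap_mul (π ρ : Equiv.Perm (Fin n)) (e : Edge n) : emap (π * ρ) e = emap π (emap ρ e) := by
  obtain ⟨a, b, h, rfl⟩ := exists_mkE e
  simp [emap_mkE]

lemma emap_one (e : Edge n) : emap 1 e = e := by
  obtain ⟨a, b, h, rfl⟩ := exists_mkE e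
  simp [emap_mkE]

lemma emap_injective (π : Equiv.Perm (Fin n)) : Function.Injective (emap π) := by
  intro e f h
  have := congrArg (emap π⁻¹) h
  rwa [← emap_mul, ← emap_mul, inv_mul_cancel, emap_one, emap_one] at this

lemma mem_emap {π : Equiv.Perm (Fin n)} {e : Edge n} {v : Fin n} :
    v ∈ (emap π e).1 ↔ π⁻¹ v ∈ e.1 := by
  obtain ⟨a, b, h, rfl⟩ := exists_mkE e
  rw [emap_mkE, mem_mkE, mem_mkE, Equiv.Perm.inv_eq_iff_eq, Equiv.Perm.inv_eq_iff_eq]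

/-- The action on sets of edges. -/
def smap (π : Equiv.Perm (Fin n)) (T : Finset (Edge n)) : Finset (Edge n) := T.image (emap π)

lemma mem_smap {π : Equiv.Perm (Fin n)} {T : Finset (Edge n)} {e : Edge n} :
    e ∈ smap π T ↔ emap π⁻¹ e ∈ T := by
  constructor
  · intro h
    obtain ⟨f, hf, rfl⟩ := Finset.mem_image.1 h
    rwa [← emap_mul, inv_mul_cancel, emap_one]
  · intro h
    refine Finset.mem_image.2 ⟨_, h, ?_⟩
    rw [← emap_mul, mul_inv_cancel, emap_one]

lemma smap_mul (π ρ : Equiv.Perm (Fin n)) (T : Finset (Edge n)) :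
    smap (π * ρ) T = smap π (smap ρ T) := by
  ext e
  rw [mem_smap, mem_smap, mem_smap, mul_inv_rev, emap_mul]

lemma smap_one (T : Finset (Edge n)) : smap 1 T = T := by
  ext e
  rw [mem_smap, inv_one, emap_one]

lemma card_smap (π : Equiv.Perm (Fin n)) (T : Finset (Edge n)) : (smap π T).card = T.card :=
  Finset.card_image_of_injective _ (emap_injective π)

lemma smap_mono (π : Equiv.Perm (Fin n)) {T U : Finset (Edge n)} (h : T ⊆ U) :
    smap π T ⊆ smap π U := Finset.image_subset_image h

lemma IsM.smap {T : Finset (Edge n)} (h : IsM T) (π : Equiv.Perm (Fin n)) : IsM (smap π T) := by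
  intro e he f hf hef v hve hvf
  obtain ⟨e', he', rfl⟩ := Finset.mem_image.1 he
  obtain ⟨f', hf', rfl⟩ := Finset.mem_image.1 hf
  rw [mem_emap] at hve hvf
  exact h e' he' f' hf' (fun h' => hef (by rw [h'])) _ hve hvf

lemma isM_smap_iff {T : Finset (Edge n)} (π : Equiv.Perm (Fin n)) : IsM (smap π T) ↔ IsM T := by
  refine ⟨fun h => ?_, fun h => h.smap π⟩
  have := h.smap π⁻¹
  rwa [← smap_mul, inv_mul_cancel, smap_one] at this

lemma IsPM.smap {A : Finset (Edge n)} (h : IsPM A) (π : Equiv.Perm (Fin n)) :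
    IsPM (smap π A) := by
  refine ⟨h.1.smap π, ?_⟩
  rw [Finset.eq_empty_iff_forall_notMem]
  intro v hv
  rw [mem_uncov] at hv
  have : π⁻¹ v ∈ uncov A := by
    rw [mem_uncov]
    intro e he hve
    refine hv (emap π e) (Finset.mem_image_of_mem _ he) ?_
    rwa [mem_emap]
  rw [h.2] at this
  simp at this

/-- The action on polynomials. -/
def act (π : Equiv.Perm (Fin n)) : MvPolynomial (Edge n) ℝ →ₐ[ℝ] MvPolynomial (Edge n) ℝ :=
  MvPolynomial.rename (emap π)

lemma act_xset (π : Equiv.Perm (Fin n)) (T : Finset (Edge n)) :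
    act π (xset T) = xset (smap π T) := by
  rw [act, xset, map_prod, xset, smap, Finset.prod_image (fun a _ b _ h => emap_injective π h)]
  simp

lemma act_mul (π ρ : Equiv.Perm (Fin n)) (p : MvPolynomial (Edge n) ℝ) :
    act (π * ρ) p = act π (act ρ p) := by
  rw [act, act, act, MvPolynomial.rename_rename]
  congr 2
  funext e
  exact emap_mul π ρ e

lemma act_one (p : MvPolynomial (Edge n) ℝ) : act 1 p = p := by
  have : (emap 1 : Edge n → Edge n) = id := funext emap_one
  rw [act, this, MvPolynomial.rename_id, AlgHom.id_apply]

lemma Van.act {h : MvPolynomial (Edge n) ℝ} (hh : Van h) (π : Equiv.Perm (Fin n)) :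
    Van (act π h) := by
  intro A hA
  rw [SoS.act, MvPolynomial.eval_rename]
  have : ind A ∘ emap π = ind (smap π⁻¹ A) := by
    funext e
    simp only [Function.comp_apply, ind]
    congr 1
    rw [mem_smap, inv_inv]
  rw [this]
  exact hh _ (hA.smap _)

lemma emap_swap_of_notMem {a u : Fin n} {e : Edge n} (ha : a ∉ e.1) (hu : u ∉ e.1) :
    emap (Equiv.swap a u) e = e := by
  obtain ⟨x, y, h, rfl⟩ := exists_mkE e
  rw [mem_mkE, not_or] at ha hu
  rw [emap_mkE]
  apply Subtype.ext
  simp only [mkE]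
  rw [Equiv.swap_apply_of_ne_of_ne (Ne.symm ha.1) (Ne.symm hu.1),
    Equiv.swap_apply_of_ne_of_ne (Ne.symm ha.2) (Ne.symm hu.2)]

lemma emap_swap_self {a u : Fin n} {e : Edge n} (ha : a ∈ e.1) (hu : u ∈ e.1) (hau : a ≠ u) :
    emap (Equiv.swap a u) e = e := by
  obtain ⟨x, y, h, rfl⟩ := exists_mkE e
  rw [mem_mkE] at ha hu
  rw [emap_mkE]
  apply Subtype.ext
  simp only [mkE]
  rcases ha with rfl | rfl <;> rcases hu with rfl | rfl
  · exact absurd rfl hau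
  · rw [Equiv.swap_apply_left, Equiv.swap_apply_right, Sym2.eq_swap]
  · rw [Equiv.swap_apply_left, Equiv.swap_apply_right, Sym2.eq_swap]
  · exact absurd rfl hau

lemma smap_eq_self {π : Equiv.Perm (Fin n)} {T : Finset (Edge n)} (h : ∀ e ∈ T, emap π e = e) :
    smap π T = T := by
  rw [smap, Finset.image_congr (g := id) (fun e he => h e he), Finset.image_id]

end Matching

/-! ### Completeness for perfect matchings by symmetrization -/

section MatchingComplete

variable {n : ℕ}

lemma emap_eq_self {π : Equiv.Perm (Fin n)} {e : Edge n} (h : ∀ v ∈ e.1, π v = v) :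
    emap π e = e := by
  obtain ⟨x, y, hxy, rfl⟩ := exists_mkE e
  rw [emap_mkE]
  apply Subtype.ext
  simp only [mkE]
  rw [h x (mem_mkE.2 (Or.inl rfl)), h y (mem_mkE.2 (Or.inr rfl))]

lemma smap_eq_of_fix {π : Equiv.Perm (Fin n)} {B : Finset (Edge n)}
    (h : ∀ v, v ∉ uncov B → π v = v) : smap π B = B :=
  smap_eq_self fun e he => emap_eq_self fun v hv => h v fun hu => (mem_uncov.1 hu) e he hv

lemma smap_insert (π : Equiv.Perm (Fin n)) (e : Edge n) (T : Finset (Edge n)) :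
    smap π (insert e T) = insert (emap π e) (smap π T) := Finset.image_insert _ _ _

lemma smap_mem_fam {π : Equiv.Perm (Fin n)} {B T : Finset (Edge n)} {m : ℕ}
    (h : ∀ v, v ∉ uncov B → π v = v) (hT : T ∈ fam B m) : smap π T ∈ fam B m := by
  refine ⟨?_, hT.2.1.smap π, (card_smap π T).trans hT.2.2⟩
  have := smap_mono π hT.1
  rwa [smap_eq_of_fix h] at this

lemma act_mem_xspan {π : Equiv.Perm (Fin n)} {B : Finset (Edge n)} {m : ℕ}
    (h : ∀ v, v ∉ uncov B → π v = v) {p : MvPolynomial (Edge n) ℝ} (hp : p ∈ xspan (fam B m)) :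
    act π p ∈ xspan (fam B m) := by
  have hle : xspan (fam B m) ≤ (xspan (fam B m)).comap (act π).toLinearMap := by
    refine Submodule.span_le.2 ?_
    rintro _ ⟨T, hT, rfl⟩
    simp only [Submodule.comap_coe, Set.mem_preimage, AlgHom.toLinearMap_apply, SetLike.mem_coe]
    rw [act_xset]
    exact xset_mem_xspan (smap_mem_fam h hT)
  exact hle hp

lemma totalDegree_le_of_mem_xspan {σ : Type} [Fintype σ] {K : Set (Finset σ)} {m : ℕ}
    (hK : ∀ T ∈ K, T.card ≤ m) {p : MvPolynomial σ ℝ} (hp : p ∈ xspan K) : p.totalDegree ≤ m := by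
  obtain ⟨g, hg, rfl⟩ := exists_of_mem_xspan hp
  refine MvPolynomial.totalDegree_finsetSum_le fun T _ => ?_
  by_cases h0 : g T = 0
  · simp [h0]
  · exact (MvPolynomial.totalDegree_smul_le _ _).trans
      ((totalDegree_xset_le T).trans (hK T (hg T h0)))

/-! #### Exchanging two uncovered vertices -/

lemma X_mul_X_mul_xset_sub_mem (e f : Edge n) (T : Finset (Edge n)) {k : ℕ} (hk : T.card + 2 ≤ k) :
    MvPolynomial.X e * (MvPolynomial.X f * xset T) - xset (insert e (insert f T)) ∈
      derivs (matching n).eqs k := by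
  have h1 := X_mul_xset_sub_mem (P := (matching n).eqs) matching_boolean f T (k := T.card + 1) le_rfl
  have h2 := X_mul_xset_sub_mem (P := (matching n).eqs) matching_boolean e (insert f T) (k := k)
    (by have := Finset.card_insert_le f T; omega)
  have h3 := mul_mem_derivs h1 (MvPolynomial.X e) (l := k)
    (by rw [MvPolynomial.totalDegree_X]; omega)
  convert add_mem h3 h2 using 1
  ring

/-- If T already has an edge x at a or u, then either x is e or f, which saves one edge in the
union, or two distinct edges meet and the monomial is derivable. The saved edge drives the
induction. -/
lemma xset_insert_insert_mem {B T : Finset (Edge n)} {m : ℕ} (hT : T ∈ fam B m) {a u : Fin n}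
    {e f x : Edge n} (he : a ∈ e.1) (hf : u ∈ f.1) (hx : x ∈ T) (hxau : a ∈ x.1 ∨ u ∈ x.1) :
    xset (insert e (insert f T)) ∈ derivs (matching n).eqs (m + 2) ⊔
      xspan {U | insert e (insert f B) ⊆ U ∧ U.card ≤ m + 1} := by
  have hc1 := Finset.card_insert_le f T
  have hc2 := Finset.card_insert_le e (insert f T)
  have hc3 := Finset.card_insert_le e T
  have hTm := hT.2.2
  by_cases hM : IsM (insert e (insert f T))
  · refine Submodule.mem_sup_right (xset_mem_xspan
      ⟨Finset.insert_subset_insert _ (Finset.insert_subset_insert _ hT.1), ?_⟩)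
    have hxm : x ∈ insert e (insert f T) :=
      Finset.mem_insert_of_mem (Finset.mem_insert_of_mem hx)
    rcases hxau with ha | hu
    · have : x = e := by
        by_contra hne
        exact hM x hxm e (Finset.mem_insert_self _ _) hne a ha he
      rw [this] at hx
      rw [Finset.insert_eq_of_mem (Finset.mem_insert_of_mem hx)]
      omega
    · have : x = f := by
        by_contra hne
        exact hM x hxm f (Finset.mem_insert_of_mem (Finset.mem_insert_self _ _)) hne u hu hf
      rw [this] at hx
      rw [Finset.insert_eq_of_mem hx]
      omega
  · exact Submodule.mem_sup_left (xset_mem_of_not_isM hM (by omega))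

lemma swap_fix {B : Finset (Edge n)} {a u : Fin n} (ha : a ∈ uncov B) (hu : u ∈ uncov B) :
    ∀ v, v ∉ uncov B → Equiv.swap a u v = v := by
  intro v hv
  refine Equiv.swap_apply_of_ne_of_ne ?_ ?_ <;> rintro rfl <;> contradiction

/-- Either T touches a or u and both monomials gain from the saved edge, or T misses both vertices
and the transposition fixes it. -/
lemma xset_sub_swap_mem_of_ne {B T : Finset (Edge n)} {m : ℕ} (hT : T ∈ fam B m) {a u : Fin n}
    (ha : a ∈ uncov B) (hu : u ∈ uncov B) {e f : Edge n} (he : a ∈ e.1) (hf : u ∈ f.1) :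
    xset (insert e (insert f T)) - xset (insert e (insert f (smap (Equiv.swap a u) T))) ∈
      derivs (matching n).eqs (m + 2) ⊔
        xspan {U | insert e (insert f B) ⊆ U ∧ U.card ≤ m + 1} := by
  by_cases h : ∃ x ∈ T, a ∈ x.1 ∨ u ∈ x.1
  · obtain ⟨x, hx, hxau⟩ := h
    refine sub_mem (xset_insert_insert_mem hT he hf hx hxau)
      (xset_insert_insert_mem (smap_mem_fam (swap_fix ha hu) hT) he hf
        (Finset.mem_image_of_mem _ hx) ?_)
    rw [mem_emap, mem_emap, Equiv.swap_inv, Equiv.swap_apply_left, Equiv.swap_apply_right]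
    exact hxau.symm
  · push Not at h
    rw [smap_eq_self fun e he => emap_swap_of_notMem (h e he).1 (h e he).2, sub_self]
    exact zero_mem _

/-- When e joins a and u, any matching containing e is fixed by the transposition, as its other
edges avoid both vertices. -/
lemma xset_sub_swap_mem_of_eq {T : Finset (Edge n)} {a u : Fin n} (hau : a ≠ u) {e : Edge n}
    (hae : a ∈ e.1) (hue : u ∈ e.1) :
    xset (insert e T) - xset (insert e (smap (Equiv.swap a u) T)) ∈
      derivs (matching n).eqs (T.card + 1) := by
  have hsm : insert e (smap (Equiv.swap a u) T) = smap (Equiv.swap a u) (insert e T) := by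
    rw [smap_insert, emap_swap_self hae hue hau]
  rw [hsm]
  have hcard := Finset.card_insert_le e T
  by_cases hM : IsM (insert e T)
  · rw [smap_eq_self, sub_self]
    · exact zero_mem _
    intro f hf
    by_cases hfe : f = e
    · rw [hfe, emap_swap_self hae hue hau]
    · exact emap_swap_of_notMem
        (hM e (Finset.mem_insert_self _ _) f hf (Ne.symm hfe) a hae)
        (hM e (Finset.mem_insert_self _ _) f hf (Ne.symm hfe) u hue)
  · exact sub_mem (xset_mem_of_not_isM hM hcard)
      (xset_mem_of_not_isM (by rwa [isM_smap_iff]) (by rwa [card_smap]))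

/-- Polynomials spanned by sets that extend a matching `B` by at most `r` edges and that vanish on
all perfect matchings have derivations of degree `|B| + 3 r`. -/
def LocallyComplete (n r : ℕ) : Prop :=
  ∀ B : Finset (Edge n), IsM B → ∀ h ∈ xspan {T : Finset (Edge n) | B ⊆ T ∧ T.card ≤ B.card + r},
    Van h → h ∈ derivs (matching n).eqs (B.card + 3 * r)

/-- For e ≠ f the product reduces to monomials that contain B, e and f and have at most m + 1 ≤ (|B|
+ 2) + r edges. The induction hypothesis for B ∪ {e, f} then costs |B| + 2 + 3r, within |B| +
3(r+1). If B ∪ {e, f} is not a matching, these monomials are derivable outright. -/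
lemma X_mul_X_mul_sub_swap_mem {r : ℕ} (ih : LocallyComplete n r) {B : Finset (Edge n)} {m : ℕ}
    (hm : m ≤ B.card + (r + 1)) {a u : Fin n} (hau : a ≠ u) (ha : a ∈ uncov B) (hu : u ∈ uncov B)
    {e f : Edge n} (he : a ∈ e.1) (hf : u ∈ f.1) {h : MvPolynomial (Edge n) ℝ}
    (hh : h ∈ xspan (fam B m)) (hv : Van h) :
    MvPolynomial.X e * (MvPolynomial.X f * (h - act (Equiv.swap a u) h)) ∈
      derivs (matching n).eqs (B.card + 3 * (r + 1)) := by
  have key : ∀ M : Submodule ℝ (MvPolynomial (Edge n) ℝ), derivs (matching n).eqs (m + 2) ≤ M →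
      (∀ T ∈ fam B m, xset (insert e (insert f T)) -
        xset (insert e (insert f (smap (Equiv.swap a u) T))) ∈ M) →
      MvPolynomial.X e * (MvPolynomial.X f * (h - act (Equiv.swap a u) h)) ∈ M := by
    intro M hM hT
    have hle : xspan (fam B m) ≤ M.comap ((LinearMap.mulLeft ℝ (MvPolynomial.X e)) ∘ₗ
        (LinearMap.mulLeft ℝ (MvPolynomial.X f)) ∘ₗ
        (LinearMap.id - (act (Equiv.swap a u)).toLinearMap)) := by
      refine Submodule.span_le.2 ?_
      rintro _ ⟨T, hTf, rfl⟩
      simp only [Submodule.comap_coe, Set.mem_preimage, LinearMap.comp_apply,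
        LinearMap.mulLeft_apply, LinearMap.sub_apply, LinearMap.id_apply,
        AlgHom.toLinearMap_apply, SetLike.mem_coe]
      rw [act_xset]
      have h1 := hM (X_mul_X_mul_xset_sub_mem e f T (k := m + 2) (by rw [hTf.2.2]))
      have h2 := hM (X_mul_X_mul_xset_sub_mem e f (smap (Equiv.swap a u) T) (k := m + 2)
        (by rw [card_smap, hTf.2.2]))
      convert add_mem (sub_mem h1 h2) (hT T hTf) using 1
      ring
    exact hle hh
  by_cases hef : e = f
  · subst hef
    refine derivs_mono (by omega) (key (derivs (matching n).eqs (m + 2)) le_rfl fun T hT => ?_)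
    rw [Finset.insert_idem, Finset.insert_idem]
    exact derivs_mono (by rw [hT.2.2]; omega) (xset_sub_swap_mem_of_eq hau he hf)
  · have h1 := key _ le_sup_left fun T hT => xset_sub_swap_mem_of_ne hT ha hu he hf
    obtain ⟨y, hy, z, hz, hyz⟩ := Submodule.mem_sup.1 h1
    rw [← hyz]
    refine add_mem (derivs_mono (by omega) hy) ?_
    have hvz : Van z := by
      have h2 : Van (y + z) := hyz ▸ (((hv.sub (hv.act _)).mul _).mul _)
      have h3 := h2.sub (van_of_mem_derivs hy)
      rwa [add_sub_cancel_left] at h3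
    have heB : e ∉ insert f B := by
      rw [Finset.mem_insert, not_or]
      exact ⟨hef, fun hmem => (mem_uncov.1 ha) e hmem he⟩
    have hfB : f ∉ B := fun hmem => (mem_uncov.1 hu) f hmem hf
    have hcard : (insert e (insert f B)).card = B.card + 2 := by
      rw [Finset.card_insert_of_notMem heB, Finset.card_insert_of_notMem hfB]
    by_cases hM : IsM (insert e (insert f B))
    · have hsub : {U | insert e (insert f B) ⊆ U ∧ U.card ≤ m + 1} ⊆
          {U | insert e (insert f B) ⊆ U ∧ U.card ≤ (insert e (insert f B)).card + r} :=
        fun U hU => ⟨hU.1, hU.2.trans (by rw [hcard]; omega)⟩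
      have := ih _ hM z (Submodule.span_mono (Set.image_mono hsub) hz) hvz
      exact derivs_mono (by rw [hcard]; omega) this
    · have hle : xspan {U | insert e (insert f B) ⊆ U ∧ U.card ≤ m + 1} ≤
          derivs (matching n).eqs (B.card + 3 * (r + 1)) := by
        refine Submodule.span_le.2 ?_
        rintro _ ⟨U, hU, rfl⟩
        exact xset_mem_of_not_isM (fun h' => hM (h'.mono hU.1)) (hU.2.trans (by omega))
      exact hle hz

/-- Modulo the constraints, 1 is the product of the sums of the variables of the edges at a and at
u. Multiplying by it costs two degrees and exposes an edge at each vertex. -/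
lemma sub_swap_mem {r : ℕ} (ih : LocallyComplete n r) {B : Finset (Edge n)} {m : ℕ}
    (hm : m ≤ B.card + (r + 1)) {a u : Fin n} (hau : a ≠ u) (ha : a ∈ uncov B) (hu : u ∈ uncov B)
    {h : MvPolynomial (Edge n) ℝ} (hh : h ∈ xspan (fam B m)) (hv : Van h) :
    h - act (Equiv.swap a u) h ∈ derivs (matching n).eqs (B.card + 3 * (r + 1)) := by
  set p := h - act (Equiv.swap a u) h with hp
  have hpm : p.totalDegree ≤ m :=
    totalDegree_le_of_mem_xspan (fun T hT => hT.2.2.le)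
      (sub_mem hh (act_mem_xspan (swap_fix ha hu) hh))
  have hstar : (starSum u).totalDegree ≤ 1 :=
    MvPolynomial.totalDegree_finsetSum_le fun i _ => by rw [MvPolynomial.totalDegree_X]
  have h1 := starSum_mul_sub_mem u (p := p) (k := B.card + 3 * (r + 1)) (by omega)
  have h2 := starSum_mul_sub_mem a (p := starSum u * p) (k := B.card + 3 * (r + 1))
    (by have := MvPolynomial.totalDegree_mul (starSum u) p; omega)
  have h3 : starSum a * (starSum u * p) ∈ derivs (matching n).eqs (B.card + 3 * (r + 1)) := by
    rw [starSum, starSum, Finset.sum_mul, Finset.sum_mul]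
    refine Submodule.sum_mem _ fun e he => ?_
    rw [Finset.mul_sum]
    exact Submodule.sum_mem _ fun f hf =>
      X_mul_X_mul_sub_swap_mem ih hm hau ha hu (by simpa using he) (by simpa using hf) hh hv
  convert sub_mem (sub_mem h3 h2) h1 using 1
  ring

/-! #### Averaging -/

lemma ofSubtype_fix {B : Finset (Edge n)} (ρ : Equiv.Perm {v // v ∈ uncov B}) :
    ∀ v, v ∉ uncov B → Equiv.Perm.ofSubtype ρ v = v :=
  fun _ hv => Equiv.Perm.ofSubtype_apply_of_not_mem ρ hv

/-- Write the permutation as a product of transpositions and telescope; each intermediate image of h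
is again in the span and vanishes on all perfect matchings. -/
lemma sub_perm_mem {r : ℕ} (ih : LocallyComplete n r) {B : Finset (Edge n)} {m : ℕ}
    (hm : m ≤ B.card + (r + 1)) (ρ : Equiv.Perm {v // v ∈ uncov B})
    {h : MvPolynomial (Edge n) ℝ} (hh : h ∈ xspan (fam B m)) (hv : Van h) :
    h - act (Equiv.Perm.ofSubtype ρ) h ∈ derivs (matching n).eqs (B.card + 3 * (r + 1)) := by
  induction ρ using Equiv.Perm.swap_induction_on with
  | one =>
    rw [map_one, act_one, sub_self]
    exact zero_mem _
  | swap_mul f x y hxy hf =>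
    have h1 := sub_swap_mem ih hm (fun h' => hxy (Subtype.ext h')) x.2 y.2
      (act_mem_xspan (ofSubtype_fix f) hh) (hv.act (Equiv.Perm.ofSubtype f))
    rw [map_mul, Equiv.Perm.ofSubtype_swap_eq, act_mul]
    convert add_mem hf h1 using 1
    ring

/-- Transitivity on matchings of equal size that extend B: one edge outside B is moved onto its
target by two transpositions, then B is enlarged by that target. -/
lemma exists_perm_smap_eq {B T T' : Finset (Edge n)} (hT : IsM T) (hT' : IsM T') (hBT : B ⊆ T)
    (hBT' : B ⊆ T') (hc : T.card = T'.card) :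
    ∃ π : Equiv.Perm (Fin n), (∀ v, v ∉ uncov B → π v = v) ∧ smap π T = T' := by
  induction hj : T.card - B.card generalizing B T with
  | zero =>
    have h1 := Finset.eq_of_subset_of_card_le hBT (by omega)
    have h2 := Finset.eq_of_subset_of_card_le hBT' (by omega)
    exact ⟨1, fun v _ => rfl, by rw [smap_one, ← h1, h2]⟩
  | succ j ih =>
    obtain ⟨e, he, heB⟩ := Finset.exists_mem_notMem_of_card_lt_card (by omega : B.card < T.card)
    obtain ⟨e', he', heB'⟩ := Finset.exists_mem_notMem_of_card_lt_card (by omega : B.card < T'.card)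
    have huncov : ∀ {U : Finset (Edge n)} {x : Edge n}, IsM U → B ⊆ U → x ∈ U → x ∉ B →
        ∀ v ∈ x.1, v ∈ uncov B := by
      intro U x hU hBU hxU hxB v hv
      rw [mem_uncov]
      intro y hy
      exact hU x hxU y (hBU hy) (fun h' => hxB (h' ▸ hy)) v hv
    have hu := huncov hT hBT he heB
    have hu' := huncov hT' hBT' he' heB'
    obtain ⟨a, b, hab, rfl⟩ := exists_mkE e
    obtain ⟨a', b', hab', rfl⟩ := exists_mkE e'
    have ha := hu a (mem_mkE.2 (Or.inl rfl))
    have hb := hu b (mem_mkE.2 (Or.inr rfl))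
    have ha' := hu' a' (mem_mkE.2 (Or.inl rfl))
    have hb' := hu' b' (mem_mkE.2 (Or.inr rfl))
    -- The first transposition may displace b, so the second starts from its image.
    set c := Equiv.swap a a' b with hcdef
    have hcB : c ∈ uncov B := by
      rw [hcdef, Equiv.swap_apply_def]
      split_ifs <;> assumption
    set ρ := Equiv.swap c b' * Equiv.swap a a' with hρ
    have hρfix : ∀ v, v ∉ uncov B → ρ v = v := by
      intro v hv
      rw [hρ, Equiv.Perm.mul_apply, swap_fix ha ha' v hv, swap_fix hcB hb' v hv]
    have hρa : ρ a = a' := by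
      rw [hρ, Equiv.Perm.mul_apply, Equiv.swap_apply_left]
      refine Equiv.swap_apply_of_ne_of_ne ?_ hab'
      intro h'
      have : Equiv.swap a a' a = Equiv.swap a a' b := by rw [Equiv.swap_apply_left, ← hcdef, ← h']
      exact hab ((Equiv.swap a a').injective this)
    have hρb : ρ b = b' := by
      rw [hρ, Equiv.Perm.mul_apply, ← hcdef, Equiv.swap_apply_left]
    have hemap : emap ρ (mkE a b hab) = mkE a' b' hab' := by
      rw [emap_mkE]
      apply Subtype.ext
      simp only [mkE, hρa, hρb]
    have hsub : insert (mkE a' b' hab') B ⊆ smap ρ T := by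
      refine Finset.insert_subset (hemap ▸ Finset.mem_image_of_mem _ he) ?_
      have := smap_mono ρ hBT
      rwa [smap_eq_of_fix hρfix] at this
    obtain ⟨π, hπ, hπT⟩ := ih (hT.smap ρ) hsub (Finset.insert_subset he' hBT')
      (by rw [card_smap, hc]) (by rw [card_smap, Finset.card_insert_of_notMem heB']; omega)
    refine ⟨π * ρ, fun v hv => ?_, by rw [smap_mul, hπT]⟩
    rw [Equiv.Perm.mul_apply, hρfix v hv]
    refine hπ v fun h' => hv ?_
    rw [mem_uncov] at h' ⊢
    exact fun y hy => h' y (Finset.mem_insert_of_mem hy)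

/-- By transitivity all monomials of the family have the same orbit sum Z, so averaging h gives a
multiple of Z. This multiple vanishes on perfect matchings, whereas Z is positive on one that
extends the chosen monomial; the factor is therefore zero. -/
lemma sum_act_eq_zero (hn : Even n) {B : Finset (Edge n)} {m : ℕ} {h : MvPolynomial (Edge n) ℝ}
    (hh : h ∈ xspan (fam B m)) (hv : Van h) :
    ∑ ρ : Equiv.Perm {v // v ∈ uncov B}, act (Equiv.Perm.ofSubtype ρ) h = 0 := by
  obtain ⟨g, hg, rfl⟩ := exists_of_mem_xspan hh
  by_cases h0 : ∀ T, g T = 0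
  · simp [h0]
  push Not at h0
  obtain ⟨T₀, hT₀⟩ := h0
  have hT₀f := hg T₀ hT₀
  set Z : Finset (Edge n) → MvPolynomial (Edge n) ℝ := fun T =>
    ∑ ρ : Equiv.Perm {v // v ∈ uncov B}, xset (smap (Equiv.Perm.ofSubtype ρ) T) with hZ
  have hZeq : ∀ T, g T ≠ 0 → Z T = Z T₀ := by
    intro T hT
    have hTf := hg T hT
    obtain ⟨π, hπ, hπT⟩ := exists_perm_smap_eq hT₀f.2.1 hTf.2.1 hT₀f.1 hTf.1
      (hT₀f.2.2.trans hTf.2.2.symm)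
    have hmem : ∀ v, π v ∈ uncov B ↔ v ∈ uncov B := by
      intro v
      by_cases hvB : v ∈ uncov B
      · refine ⟨fun _ => hvB, fun _ => ?_⟩
        by_contra hπv
        have := π.injective (hπ _ hπv)
        rw [this] at hπv
        exact hπv hvB
      · rw [hπ v hvB]
    have hρ : Equiv.Perm.ofSubtype (π.subtypePerm hmem) = π :=
      Equiv.Perm.ofSubtype_subtypePerm hmem fun v hv => by
        by_contra hvB
        exact hv (hπ v hvB)
    rw [hZ]
    simp only
    rw [← Equiv.sum_comp (Equiv.mulRight (π.subtypePerm hmem))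
      (fun ρ => xset (smap (Equiv.Perm.ofSubtype ρ) T₀))]
    refine Finset.sum_congr rfl fun ρ _ => ?_
    rw [Equiv.coe_mulRight, map_mul, hρ, smap_mul, hπT]
  have hsum : ∑ ρ : Equiv.Perm {v // v ∈ uncov B},
      act (Equiv.Perm.ofSubtype ρ) (∑ T, g T • xset T) = (∑ T, g T) • Z T₀ := by
    have : ∀ ρ : Equiv.Perm {v // v ∈ uncov B}, act (Equiv.Perm.ofSubtype ρ) (∑ T, g T • xset T) =
        ∑ T, g T • xset (smap (Equiv.Perm.ofSubtype ρ) T) := by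
      intro ρ
      rw [map_sum]
      exact Finset.sum_congr rfl fun T _ => by rw [map_smul, act_xset]
    rw [Finset.sum_congr rfl fun ρ _ => this ρ, Finset.sum_comm, Finset.sum_smul]
    refine Finset.sum_congr rfl fun T _ => ?_
    rw [← Finset.smul_sum]
    by_cases hT : g T = 0
    · rw [hT, zero_smul, zero_smul]
    · rw [← hZeq T hT]
  obtain ⟨A, hTA, hA⟩ := hT₀f.2.1.exists_isPM hn
  have hpos : 0 < MvPolynomial.eval (ind A) (Z T₀) := by
    rw [hZ]
    simp only [map_sum]
    refine Finset.sum_pos' (fun ρ _ => ?_) ⟨1, Finset.mem_univ _, ?_⟩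
    · rw [eval_ind_xset]
      split_ifs <;> norm_num
    · rw [map_one, smap_one, eval_ind_xset, if_pos hTA]
      norm_num
  have hzero : MvPolynomial.eval (ind A) ((∑ T, g T) • Z T₀) = 0 := by
    rw [← hsum, map_sum]
    exact Finset.sum_eq_zero fun ρ _ => hv.act _ A hA
  rw [MvPolynomial.smul_eval] at hzero
  rw [hsum, (mul_eq_zero.1 hzero).resolve_right hpos.ne', zero_smul]

/-- Induction on r. After reduction to matchings of one size, the sum of z - πz over the
permutations of the uncovered vertices is a derivable polynomial. By the averaging lemma it equals a
nonzero multiple of z. For r = 0 only multiples of x_B occur, and a perfect matching containing B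
detects the factor. -/
lemma locallyComplete (hn : Even n) (r : ℕ) : LocallyComplete n r := by
  induction r with
  | zero =>
    intro B hB h hh hv
    have hset : {T : Finset (Edge n) | B ⊆ T ∧ T.card ≤ B.card + 0} = {B} := by
      ext T
      simp only [Set.mem_ofPred_eq, Set.mem_singleton_iff, add_zero]
      constructor
      · rintro ⟨h1, h2⟩
        exact (Finset.eq_of_subset_of_card_le h1 h2).symm
      · rintro rfl
        exact ⟨le_rfl, le_rfl⟩
    rw [hset, xspan, Set.image_singleton, Submodule.mem_span_singleton] at hh
    obtain ⟨t, rfl⟩ := hh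
    obtain ⟨A, hBA, hA⟩ := hB.exists_isPM hn
    have := hv A hA
    rw [MvPolynomial.smul_eval, eval_ind_xset, if_pos hBA, mul_one] at this
    rw [this, zero_smul]
    exact zero_mem _
  | succ r ih =>
    intro B hB h hh hv
    have hred : h ∈ derivs (matching n).eqs (B.card + (r + 1)) ⊔
        xspan (fam B (min (B.card + (r + 1)) (n / 2))) := by
      have hle : xspan {T : Finset (Edge n) | B ⊆ T ∧ T.card ≤ B.card + (r + 1)} ≤
          derivs (matching n).eqs (B.card + (r + 1)) ⊔
            xspan (fam B (min (B.card + (r + 1)) (n / 2))) := by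
        refine Submodule.span_le.2 ?_
        rintro _ ⟨T, hT, rfl⟩
        exact matching_reduce hT.1 hT.2
      exact hle hh
    obtain ⟨y, hy, z, hz, rfl⟩ := Submodule.mem_sup.1 hred
    refine add_mem (derivs_mono (by omega) hy) ?_
    have hvz : Van z := by
      have h3 := hv.sub (van_of_mem_derivs hy)
      rwa [add_sub_cancel_left] at h3
    have h1 : ∑ ρ : Equiv.Perm {v // v ∈ uncov B}, (z - act (Equiv.Perm.ofSubtype ρ) z) ∈
        derivs (matching n).eqs (B.card + 3 * (r + 1)) :=
      Submodule.sum_mem _ fun ρ _ => sub_perm_mem ih (min_le_left _ _) ρ hz hvz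
    rw [Finset.sum_sub_distrib, sum_act_eq_zero hn hz hvz, sub_zero, Finset.sum_const,
      ← Nat.cast_smul_eq_nsmul ℝ] at h1
    refine (Submodule.smul_mem_iff _ ?_).1 h1
    rw [Finset.card_univ]
    exact_mod_cast Fintype.card_ne_zero

lemma matching_complete (hn : Even n) {d : ℕ} {f : MvPolynomial (Edge n) ℝ}
    (hf : f.totalDegree ≤ d) (h : ∀ α ∈ (matching n).solutions, MvPolynomial.eval α f = 0) :
    f ∈ derivs (matching n).eqs (3 * d) := by
  obtain ⟨g, hg, hfg⟩ := exists_multilinear (P := (matching n).eqs) matching_boolean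
    (fun _ => True) (fun T hT => absurd trivial hT) hf
  have hv : Van f := fun A hA => h _ (ind_mem_matching_of_isPM hA)
  have hvg : Van (∑ T, g T • xset T) := by
    have := hv.sub (van_of_mem_derivs hfg)
    rwa [sub_sub_cancel] at this
  have h1 := locallyComplete hn d ∅ (by intro e he; simp at he) _
    (sum_xset_mem_xspan fun T hT => ⟨Finset.empty_subset _, by simpa using (hg T hT).2⟩) hvg
  rw [Finset.card_empty, zero_add] at h1
  have := add_mem (derivs_mono (by omega : d ≤ 3 * d) hfg) h1
  rwa [sub_add_cancel] at this

/-! #### Richness and small proofs -/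

lemma matching_nonempty (hn : Even n) : (matching n).solutions.Nonempty := by
  obtain ⟨A, -, hA⟩ := IsM.exists_isPM hn (T := ∅) (by intro e he; simp at he)
  exact ⟨_, ind_mem_matching_of_isPM hA⟩

lemma card_edge (n : ℕ) : Fintype.card (Edge n) = n.choose 2 := by
  have := Sym2.card_subtype_not_diag (α := Fin n)
  rw [Fintype.card_fin] at this
  rw [← this]

lemma le_card_edge (h4 : 4 ≤ n) : n ≤ Fintype.card (Edge n) := by
  rw [card_edge, Nat.choose_two_right, Nat.le_div_iff_mul_le (by norm_num)]
  exact Nat.mul_le_mul_left n (by omega)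

lemma matching_two_solutions : (matching 2).solutions = {ind Finset.univ} := by
  have hcard : Fintype.card (Edge 2) ≤ 1 := by rw [card_edge]; decide
  have hsub : Subsingleton (Edge 2) := Fintype.card_le_one_iff_subsingleton.1 hcard
  have key : ∀ α ∈ (matching 2).solutions, α = ind Finset.univ := by
    intro α hα
    obtain ⟨A, rfl⟩ := exists_eq_ind matching_boolean hα.1
    have h1 := hα.1 _ (starSum_sub_one_mem (0 : Fin 2))
    rw [map_sub, map_one, eval_ind_starSum] at h1
    have hA : A.Nonempty := by
      by_contra hne
      rw [Finset.not_nonempty_iff_eq_empty] at hne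
      simp [hne] at h1
    obtain ⟨e, he⟩ := hA
    congr
    exact Finset.eq_univ_iff_forall.2 fun f => Subsingleton.elim e f ▸ he
  obtain ⟨α, hα⟩ := matching_nonempty (n := 2) even_two
  have := key α hα
  subst this
  exact Set.Subset.antisymm key (Set.singleton_subset_iff.2 hα)

lemma matching_rich (h2 : 2 ≤ n) (hn : Even n) {c : ℕ} (hc : 13 ≤ c) (d : ℕ) :
    RichUpTo c (matching n) (matching n).solutions
      (ProbabilityTheory.uniformOn (matching n).solutions) d := by
  have hne : Nonempty (Edge n) := by
    refine ⟨mkE ⟨0, by omega⟩ ⟨1, by omega⟩ ?_⟩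
    simp
  refine richUpTo_of_boolean (k := 3 * d) (matching_nonempty hn)
    (fun α hα => exists_eq_ind matching_boolean hα.1) le_rfl ?_ (Nat.mul_le_mul_right _ (by omega))
    hc (fun f hf h => matching_complete hn hf h) ?_
  · intro q hq
    simp [matching] at hq
  · by_cases h4 : 4 ≤ n
    · exact Or.inl ((by omega : 2 ≤ n).trans (le_card_edge h4))
    · right
      obtain ⟨k, hk⟩ := hn
      have : n = 2 := by omega
      subst this
      rw [matching_two_solutions]
      intro t ht ht0
      have := spectrallyRich_singleton (σ := Edge 2) d t ht ht0
      linarith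

lemma matching_isSimpleSystem (h4 : 4 ≤ n) :
    IsSimpleSystem (matching n) (2 * Fintype.card (Edge n)) (3 * Fintype.card (Edge n) ^ 2) := by
  have hcard := le_card_edge h4
  have hν : (4 : ℝ) ≤ Fintype.card (Edge n) := by exact_mod_cast h4.trans hcard
  constructor
  · intro p hp
    rcases matching_eqs_cases hp with hp | ⟨v, rfl⟩ | ⟨e, f, -, -, rfl⟩
    · exact (coeffsLE_boolean hp).mono (by linarith)
    · have hsum := CoeffsLE.sum (Finset.univ.filter fun e : Edge n => v ∈ e.1)
        fun e _ => coeffsLE_X e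
      have hone : CoeffsLE (1 : MvPolynomial (Edge n) ℝ) |1| := coeffsLE_C 1
      refine (hsum.sub hone).mono ?_
      have hle : ((Finset.univ.filter fun e : Edge n => v ∈ e.1).card : ℝ) ≤
          Fintype.card (Edge n) := by exact_mod_cast Finset.card_le_univ _
      rw [abs_one]
      linarith
    · exact (coeffsLE_X_mul_X e f).mono (by linarith)
  · intro p hp m
    refine exists_int_coeff ?_ m
    rcases matching_eqs_cases hp with hp | ⟨v, rfl⟩ | ⟨e, f, -, -, rfl⟩
    · exact boolean_mem_integralPolys hp
    · exact sub_mem (sum_mem fun i _ => X_mem_integralPolys i) (one_mem _)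
    · exact mul_mem (X_mem_integralPolys e) (X_mem_integralPolys f)
  · have h1 := card_booleanEqs_le (Edge n)
    have h2 : (Finset.univ.image fun v : Fin n =>
        ∑ e ∈ Finset.univ.filter (fun e : Edge n => v ∈ e.1), (MvPolynomial.X e :
          MvPolynomial (Edge n) ℝ) - 1).card ≤ n :=
      Finset.card_image_le.trans (by rw [Finset.card_univ, Fintype.card_fin])
    have h3 : ((Finset.univ.filter fun p : Edge n × Edge n =>
        p.1 ≠ p.2 ∧ ∃ v, v ∈ p.1.1 ∧ v ∈ p.2.1).image fun p => (MvPolynomial.X p.1 *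
          MvPolynomial.X p.2 : MvPolynomial (Edge n) ℝ)).card ≤ Fintype.card (Edge n) ^ 2 :=
      Finset.card_image_le.trans ((Finset.card_le_univ _).trans
        (by rw [Fintype.card_prod, sq]))
    have h4 : (matching n).eqs.card ≤ _ := Finset.card_union_le _ _
    have h5 := Finset.card_union_le (booleanEqs (Edge n)) (Finset.univ.image fun v : Fin n =>
        ∑ e ∈ Finset.univ.filter (fun e : Edge n => v ∈ e.1), (MvPolynomial.X e :
          MvPolynomial (Edge n) ℝ) - 1)
    have h6 : Fintype.card (Edge n) ≤ Fintype.card (Edge n) ^ 2 := Nat.le_self_pow (by norm_num) _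
    omega
  all_goals simp [matching]

lemma matching_smallProofs (h4 : 4 ≤ n) (hn : Even n) {c : ℕ} (hc : 118 ≤ c) (d : ℕ) :
    SmallProofs c (matching n) d :=
  smallProofs_of_rich ((by omega : 2 ≤ n).trans (le_card_edge h4))
    (carries_boolean (matching_nonempty hn) fun α hα => exists_eq_ind matching_boolean hα.1)
    (matching_isSimpleSystem h4) (matching_rich (by omega) hn (c := 13) le_rfl d) (by omega)

end MatchingComplete

section Sphere

/-! ### The unit sphere -/

/-! #### Gaussian moments -/

/-- The integral of `r ^ k * exp (-r ^ 2)` over the positive half-line. -/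
def radialMoment (k : ℕ) : ℝ := ∫ r in Set.Ioi (0 : ℝ), r ^ k * Real.exp (-r ^ 2)

lemma radialMoment_eq (k : ℕ) : radialMoment k = 1 / 2 * Real.Gamma ((k + 1) / 2) := by
  have h := integral_rpow_mul_exp_neg_rpow (p := 2) (q := k) (by norm_num)
    (by have : (0 : ℝ) ≤ k := by positivity
        linarith)
  rw [← h, radialMoment]
  refine setIntegral_congr_fun measurableSet_Ioi fun x _ => ?_
  rw [Real.rpow_natCast, Real.rpow_ofNat]

lemma radialMoment_pos (k : ℕ) : 0 < radialMoment k := by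
  rw [radialMoment_eq]
  have := Real.Gamma_pos_of_pos (by positivity : (0 : ℝ) < (k + 1) / 2)
  positivity

lemma radialMoment_add_two (k : ℕ) :
    radialMoment (k + 2) = ((k + 1 : ℕ) : ℝ) / 2 * radialMoment k := by
  rw [radialMoment_eq, radialMoment_eq]
  have h : (((k + 2 : ℕ) : ℝ) + 1) / 2 = (k + 1) / 2 + 1 := by
    push_cast
    ring
  rw [h, Real.Gamma_add_one (by positivity)]
  push_cast
  ring

lemma radialMoment_add_two_mul (k t : ℕ) : 2 ^ t * radialMoment (k + 2 * t) =
    ((∏ i ∈ Finset.range t, (k + 1 + 2 * i) : ℕ) : ℝ) * radialMoment k := by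
  induction t with
  | zero => simp
  | succ t ih =>
    rw [Finset.prod_range_succ, show k + 2 * (t + 1) = k + 2 * t + 2 by ring, radialMoment_add_two,
      pow_succ]
    calc (2 : ℝ) ^ t * 2 * (((k + 2 * t + 1 : ℕ) : ℝ) / 2 * radialMoment (k + 2 * t))
        = ((k + 1 + 2 * t : ℕ) : ℝ) * (2 ^ t * radialMoment (k + 2 * t)) := by
          push_cast
          ring
      _ = _ := by
          rw [ih]
          push_cast
          ring

/-- The integral of `x ^ k * exp (-x ^ 2)` over the line. -/
def lineMoment (k : ℕ) : ℝ := ∫ x : ℝ, x ^ k * Real.exp (-x ^ 2)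

lemma lineMoment_odd {k : ℕ} (hk : Odd k) : lineMoment k = 0 := by
  have h := integral_neg_eq_self (fun x : ℝ => x ^ k * Real.exp (-x ^ 2)) volume
  have h2 : ∫ x : ℝ, (-x) ^ k * Real.exp (-(-x) ^ 2) = -lineMoment k := by
    rw [lineMoment, ← integral_neg]
    refine integral_congr_ae (Filter.Eventually.of_forall fun x => ?_)
    simp only
    rw [hk.neg_pow, neg_sq]
    ring
  rw [h2] at h
  change -lineMoment k = lineMoment k at h
  linarith

lemma lineMoment_two_mul (a : ℕ) : lineMoment (2 * a) = 2 * radialMoment (2 * a) := by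
  rw [radialMoment, ← integral_comp_abs (f := fun r => r ^ (2 * a) * Real.exp (-r ^ 2)), lineMoment]
  refine integral_congr_ae (Filter.Eventually.of_forall fun x => ?_)
  simp only
  rw [(even_two_mul a).pow_abs, sq_abs]

lemma lineMoment_eq (a : ℕ) : 2 ^ a * lineMoment (2 * a) =
    ((∏ i ∈ Finset.range a, (1 + 2 * i) : ℕ) : ℝ) * lineMoment 0 := by
  have h := radialMoment_add_two_mul 0 a
  have h0 := lineMoment_two_mul 0
  rw [mul_zero] at h0
  rw [zero_add, zero_add] at h
  rw [lineMoment_two_mul, h0]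
  linear_combination 2 * h

/-! #### Polar coordinates -/

variable {n : ℕ}

lemma monEval_smul {σ : Type} [Fintype σ] (t : ℝ) (α : σ → ℝ) (m : σ →₀ ℕ) :
    monEval (fun i => t * α i) m = t ^ m.degree * monEval α m := by
  rw [monEval, monEval]
  simp only [mul_pow]
  rw [Finset.prod_mul_distrib, Finset.prod_pow_eq_pow_sum, Finsupp.degree_eq_sum]

lemma integral_volumeIoiPow (k : ℕ) (f : ℝ → ℝ) :
    ∫ r : Set.Ioi (0 : ℝ), f r ∂(Measure.volumeIoiPow k) =
      ∫ r in Set.Ioi (0 : ℝ), r ^ k * f r := by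
  simp only [Measure.volumeIoiPow, ENNReal.ofReal]
  rw [integral_withDensity_eq_integral_smul,
    integral_subtype_comap measurableSet_Ioi fun a ↦ Real.toNNReal (a ^ k) • f a,
    setIntegral_congr_fun measurableSet_Ioi fun x hx ↦ ?_]
  · rw [NNReal.smul_def, Real.coe_toNNReal _ (pow_nonneg (Set.mem_Ioi.1 hx).le _), smul_eq_mul]
  · exact (measurable_subtype_coe.pow_const _).real_toNNReal

/-- Unnormalized moments of the surface measure. -/
def sphereMoment (n : ℕ) (m : Fin n →₀ ℕ) : ℝ :=
  ∫ s, monEval (fun i => s.1 i) m ∂(volume : Measure (EuclideanSpace ℝ (Fin n))).toSphere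

/-- Homogeneity separates the Gaussian integral of a monomial into its spherical moment and a radial
factor. The same integral also splits over the coordinates, which determines the spherical moment.
-/
lemma integral_polar (hn : 1 ≤ n) (m : Fin n →₀ ℕ) :
    ∫ x : EuclideanSpace ℝ (Fin n), monEval (fun i => x i) m * Real.exp (-‖x‖ ^ 2) =
      sphereMoment n m * radialMoment (n - 1 + m.degree) := by
  have : Nonempty (Fin n) := ⟨⟨0, hn⟩⟩
  set μ := (volume : Measure (EuclideanSpace ℝ (Fin n)))
  have hdim : Module.finrank ℝ (EuclideanSpace ℝ (Fin n)) = n := by simp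
  calc ∫ x : EuclideanSpace ℝ (Fin n), monEval (fun i => x i) m * Real.exp (-‖x‖ ^ 2) ∂μ
      = ∫ x : ({(0)}ᶜ : Set (EuclideanSpace ℝ (Fin n))),
          monEval (fun i => x.1 i) m * Real.exp (-‖x.1‖ ^ 2) ∂(μ.comap (↑)) := by
        rw [integral_subtype_comap (measurableSet_singleton _).compl
          fun x : EuclideanSpace ℝ (Fin n) => monEval (fun i => x i) m * Real.exp (-‖x‖ ^ 2),
          restrict_compl_singleton]
    _ = ∫ z, monEval (fun i => z.1.1 i) m * (z.2.1 ^ m.degree * Real.exp (-z.2.1 ^ 2))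
          ∂μ.toSphere.prod (.volumeIoiPow (n - 1)) := by
        have h := μ.measurePreserving_homeomorphUnitSphereProd.integral_comp
          (Homeomorph.measurableEmbedding _)
          (fun z => monEval (fun i => z.1.1 i) m * (z.2.1 ^ m.degree * Real.exp (-z.2.1 ^ 2)))
        rw [hdim] at h
        rw [← h]
        refine integral_congr_ae (Filter.Eventually.of_forall fun x => ?_)
        simp only [homeomorphUnitSphereProd_apply_snd_coe, homeomorphUnitSphereProd_apply_fst_coe]
        have hx : ‖x.1‖ ≠ 0 := norm_ne_zero_iff.2 x.2
        have h1 : monEval (fun i => (‖x.1‖⁻¹ • x.1) i) m =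
            ‖x.1‖⁻¹ ^ m.degree * monEval (fun i => x.1 i) m := by
          rw [← monEval_smul]
          rfl
        rw [h1, inv_pow]
        field_simp
    _ = sphereMoment n m * ∫ r : Set.Ioi (0 : ℝ), (r : ℝ) ^ m.degree * Real.exp (-(r : ℝ) ^ 2)
          ∂(.volumeIoiPow (n - 1)) :=
        integral_prod_mul (fun s : Metric.sphere (0 : EuclideanSpace ℝ (Fin n)) 1 =>
          monEval (fun i => s.1 i) m)
          (fun r : Set.Ioi (0 : ℝ) => (r : ℝ) ^ m.degree * Real.exp (-(r : ℝ) ^ 2))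
    _ = _ := by
        rw [integral_volumeIoiPow (n - 1) fun r => r ^ m.degree * Real.exp (-r ^ 2), radialMoment]
        congr 2
        funext r
        rw [pow_add, mul_assoc]

lemma integral_gaussian (m : Fin n →₀ ℕ) :
    ∫ x : EuclideanSpace ℝ (Fin n), monEval (fun i => x i) m * Real.exp (-‖x‖ ^ 2) =
      ∏ i, lineMoment (m i) := by
  rw [← (PiLp.volume_preserving_toLp (Fin n)).integral_comp
    (MeasurableEquiv.toLp 2 (Fin n → ℝ)).measurableEmbedding]
  simp only [lineMoment]
  rw [← integral_fintype_prod_volume_eq_prod fun i (x : ℝ) => x ^ m i * Real.exp (-x ^ 2)]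
  refine integral_congr_ae (Filter.Eventually.of_forall fun x => ?_)
  simp only
  rw [Finset.prod_mul_distrib, ← Real.exp_sum, Finset.sum_neg_distrib, EuclideanSpace.norm_sq_eq]
  simp [monEval]

lemma sphereMoment_mul_radialMoment (hn : 1 ≤ n) (m : Fin n →₀ ℕ) :
    sphereMoment n m * radialMoment (n - 1 + m.degree) = ∏ i, lineMoment (m i) := by
  rw [← integral_polar hn, integral_gaussian]

lemma sphereMoment_odd (hn : 1 ≤ n) {m : Fin n →₀ ℕ} {i : Fin n} (hi : Odd (m i)) :
    sphereMoment n m = 0 := by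
  have h := sphereMoment_mul_radialMoment hn m
  rw [Finset.prod_eq_zero (Finset.mem_univ i) (lineMoment_odd hi)] at h
  exact (mul_eq_zero.1 h).resolve_right (radialMoment_pos _).ne'

/-- The product of the odd numbers below `2 a`. -/
def oddProd (a : ℕ) : ℕ := ∏ j ∈ Finset.range a, (1 + 2 * j)

/-- The powers of 2 produced by the radial and the one-dimensional recursions agree, since both
count half of the degree, and they cancel. -/
lemma sphereMoment_even (hn : 1 ≤ n) {m : Fin n →₀ ℕ} {a : Fin n → ℕ} (ha : ∀ i, m i = 2 * a i) :
    ((∏ j ∈ Finset.range (∑ i, a i), (n + 2 * j) : ℕ) : ℝ) * sphereMoment n m =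
      ((∏ i, oddProd (a i) : ℕ) : ℝ) * sphereMoment n 0 := by
  have hdeg : m.degree = 2 * ∑ i, a i := by
    rw [Finsupp.degree_eq_sum, Finset.mul_sum]
    exact Finset.sum_congr rfl fun i _ => ha i
  have h0 := sphereMoment_mul_radialMoment hn (0 : Fin n →₀ ℕ)
  have h1 := sphereMoment_mul_radialMoment hn m
  have h2 := radialMoment_add_two_mul (n - 1) (∑ i, a i)
  rw [Nat.sub_add_cancel hn] at h2
  rw [hdeg] at h1
  have h3 : (2 : ℝ) ^ (∑ i, a i) * ∏ i, lineMoment (m i) =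
      ((∏ i, oddProd (a i) : ℕ) : ℝ) * ∏ i : Fin n, lineMoment 0 := by
    rw [← Finset.prod_pow_eq_pow_sum, ← Finset.prod_mul_distrib, Nat.cast_prod,
      ← Finset.prod_mul_distrib]
    exact Finset.prod_congr rfl fun i _ => by rw [ha i, lineMoment_eq, oddProd]
  have h4 : sphereMoment n 0 * radialMoment (n - 1) = ∏ i : Fin n, lineMoment 0 := by simpa using h0
  have hR := radialMoment_pos (n - 1)
  refine mul_right_cancel₀ hR.ne' ?_
  rw [← h4, ← h1] at h3
  linear_combination h3 - sphereMoment n m * h2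

/-! #### The uniform measure -/

lemma mem_unitVector_solutions {α : Fin n → ℝ} :
    α ∈ (unitVector n).solutions ↔ ∑ i, α i ^ 2 = 1 := by
  simp [unitVector, PolySystem.solutions, sub_eq_zero]

lemma sum_sq_of_sphere (s : Metric.sphere (0 : EuclideanSpace ℝ (Fin n)) 1) :
    ∑ i, s.1 i ^ 2 = 1 := by
  have h := EuclideanSpace.real_norm_sq_eq s.1
  rw [← h, norm_eq_of_mem_sphere s, one_pow]

lemma measurable_coords : Measurable
    fun (x : Metric.sphere (0 : EuclideanSpace ℝ (Fin n)) 1) (i : Fin n) => x.1 i := by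
  have : Continuous
      fun (x : Metric.sphere (0 : EuclideanSpace ℝ (Fin n)) 1) (i : Fin n) => x.1 i := by fun_prop
  exact this.measurable

/-- The surface measure charges every nonempty open set, so a continuous function that vanishes
almost everywhere vanishes everywhere on the sphere. -/
lemma carries_sphereUniform (hn : 1 ≤ n) : Carries (sphereUniform n) (unitVector n).solutions := by
  have : Nonempty (Fin n) := ⟨⟨0, hn⟩⟩
  set ν := (volume : Measure (EuclideanSpace ℝ (Fin n))).toSphere with hν
  have hν0 : ν Set.univ ≠ 0 := by
    rw [Ne, Measure.measure_univ_eq_zero]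
    exact Measure.toSphere_ne_zero _
  have hνtop : ν Set.univ ≠ ⊤ := measure_ne_top _ _
  have hae : ∀ p : Metric.sphere (0 : EuclideanSpace ℝ (Fin n)) 1 → Prop,
      (∀ᵐ x ∂((ν Set.univ)⁻¹ • ν), p x) ↔ ∀ᵐ x ∂ν, p x := fun p =>
    Measure.ae_ennreal_smul_measure_iff (ENNReal.inv_ne_zero.2 hνtop)
  have hmap : ∀ p : (Fin n → ℝ) → Prop, MeasurableSet {x | p x} →
      ((∀ᵐ α ∂(sphereUniform n), p α) ↔ ∀ᵐ x ∂ν, p fun i => x.1 i) := fun p hp =>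
    (ae_map_iff measurable_coords.aemeasurable hp).trans (hae _)
  refine ⟨⟨?_⟩, ?_, ?_, ?_⟩
  · rw [sphereUniform, Measure.map_apply measurable_coords MeasurableSet.univ, Set.preimage_univ,
      Measure.smul_apply, smul_eq_mul, ENNReal.inv_mul_cancel hν0 hνtop]
  · refine (hmap _ ?_).2 (Filter.Eventually.of_forall fun x =>
      mem_unitVector_solutions.2 (sum_sq_of_sphere x))
    have : {x : Fin n → ℝ | x ∈ (unitVector n).solutions} = {x | ∑ i, x i ^ 2 = 1} := by
      ext
      exact mem_unitVector_solutions
    rw [this]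
    exact (isClosed_eq (by fun_prop) continuous_const).measurableSet
  · intro α hα i
    rw [mem_unitVector_solutions] at hα
    have := Finset.single_le_sum (fun j _ => sq_nonneg (α j)) (Finset.mem_univ i)
    rw [hα] at this
    exact abs_le_one_iff_mul_self_le_one.2 (by rwa [← sq])
  · intro p hp α hα
    rw [mem_unitVector_solutions] at hα
    have hcont := MvPolynomial.continuous_eval p
    have h1 := (hmap (fun α => MvPolynomial.eval α p = 0)
      (isClosed_eq hcont continuous_const).measurableSet).1 hp
    have hcont2 : Continuous fun x : Metric.sphere (0 : EuclideanSpace ℝ (Fin n)) 1 =>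
        MvPolynomial.eval (fun i => x.1 i) p := hcont.comp (by fun_prop)
    have h2 := (Continuous.ae_eq_iff_eq ν hcont2 continuous_const).1 h1
    have hmem : WithLp.toLp 2 α ∈ Metric.sphere (0 : EuclideanSpace ℝ (Fin n)) 1 := by
      rw [mem_sphere_zero_iff_norm, EuclideanSpace.norm_eq]
      simp [hα]
    exact congrFun h2 ⟨_, hmem⟩

lemma integral_sphereUniform (m : Fin n →₀ ℕ) :
    ∫ α, monEval α m ∂(sphereUniform n) = sphereMoment n m / sphereMoment n 0 := by
  have hcont : Continuous fun α : Fin n → ℝ => monEval α m := by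
    unfold monEval
    fun_prop
  rw [sphereUniform, integral_map measurable_coords.aemeasurable hcont.aestronglyMeasurable,
    integral_smul_measure]
  have h0 : sphereMoment n 0 =
      ((volume : Measure (EuclideanSpace ℝ (Fin n))).toSphere Set.univ).toReal := by
    simp [sphereMoment, monEval, Measure.real]
  rw [h0, ENNReal.toReal_inv, smul_eq_mul, sphereMoment, div_eq_inv_mul]

lemma sphereMoment_zero_pos (hn : 1 ≤ n) : 0 < sphereMoment n 0 := by
  have h := sphereMoment_mul_radialMoment hn (0 : Fin n →₀ ℕ)
  have hpos : 0 < ∏ i : Fin n, lineMoment ((0 : Fin n →₀ ℕ) i) :=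
    Finset.prod_pos fun i _ => by
      have := lineMoment_two_mul 0
      rw [mul_zero] at this
      rw [Finsupp.coe_zero, Pi.zero_apply, this]
      have := radialMoment_pos 0
      positivity
  rw [← h] at hpos
  exact pos_of_mul_pos_left hpos (radialMoment_pos _).le

lemma integral_sphereUniform_odd (hn : 1 ≤ n) {m : Fin n →₀ ℕ} {i : Fin n} (hi : Odd (m i)) :
    ∫ α, monEval α m ∂(sphereUniform n) = 0 := by
  rw [integral_sphereUniform, sphereMoment_odd hn hi, zero_div]

lemma integral_sphereUniform_even (hn : 1 ≤ n) {m : Fin n →₀ ℕ} {a : Fin n → ℕ}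
    (ha : ∀ i, m i = 2 * a i) :
    ((∏ j ∈ Finset.range (∑ i, a i), (n + 2 * j) : ℕ) : ℝ) *
      ∫ α, monEval α m ∂(sphereUniform n) = ((∏ i, oddProd (a i) : ℕ) : ℝ) := by
  rw [integral_sphereUniform, mul_div_assoc', sphereMoment_even hn ha,
    mul_div_cancel_right₀ _ (sphereMoment_zero_pos hn).ne']

/-- A nonzero moment has all exponents even, and its denominator divides ∏(n + 2j) over fewer than
or exactly d factors. The full product of d factors is thus a common multiple. -/
lemma exists_int_sphereUniform (hn : 1 ≤ n) {d : ℕ} {m : Fin n →₀ ℕ} (hm : m.degree ≤ 2 * d) :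
    ∃ z : ℤ, (z : ℝ) = ((∏ j ∈ Finset.range d, (n + 2 * j) : ℕ) : ℝ) *
      ∫ α, monEval α m ∂(sphereUniform n) := by
  by_cases h : ∃ i, Odd (m i)
  · obtain ⟨i, hi⟩ := h
    exact ⟨0, by rw [integral_sphereUniform_odd hn hi, mul_zero, Int.cast_zero]⟩
  · push Not at h
    have h' : ∀ i, ∃ a, m i = 2 * a := fun i => by
      obtain ⟨a, ha⟩ := Nat.not_odd_iff_even.1 (h i)
      exact ⟨a, by omega⟩
    choose a ha using h'
    have hdeg : m.degree = 2 * ∑ i, a i := by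
      rw [Finsupp.degree_eq_sum, Finset.mul_sum]
      exact Finset.sum_congr rfl fun i _ => ha i
    obtain ⟨q, hq⟩ := Finset.prod_dvd_prod_of_subset (Finset.range (∑ i, a i)) (Finset.range d)
      (fun j => n + 2 * j) (Finset.range_subset_range.2 (by omega))
    refine ⟨(q * ∏ i, oddProd (a i) : ℕ), ?_⟩
    have := integral_sphereUniform_even hn ha
    rw [hq, Int.cast_natCast, Nat.cast_mul, Nat.cast_mul, ← this]
    ring

lemma prod_le_two_pow (h2 : 2 ≤ n) (d : ℕ) :
    ((∏ j ∈ Finset.range d, (n + 2 * j) : ℕ) : ℝ) ≤ 2 ^ ((n ^ d) ^ 3) := by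
  rcases Nat.eq_zero_or_pos d with rfl | hd
  · simp
  have hx : d + 1 ≤ n ^ d := Nat.succ_le_of_lt ((Nat.lt_pow_self (by norm_num : 1 < 2)).trans_le
    (Nat.pow_le_pow_left h2 d))
  have hnx : n ≤ n ^ d := Nat.le_self_pow (by omega) n
  set x := n ^ d with hxdef
  have h1 : ∏ j ∈ Finset.range d, (n + 2 * j) ≤ (4 * x) ^ d := by
    have := Finset.prod_le_pow_card (Finset.range d) (fun j => n + 2 * j) (4 * x) fun j hj => by
      have := Finset.mem_range.1 hj
      omega
    rwa [Finset.card_range] at this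
  have h3 : 4 * x ≤ 2 ^ (x + 2) := by
    have : x < 2 ^ x := Nat.lt_pow_self (by norm_num)
    rw [pow_add]
    omega
  have h4 : (x + 2) * d ≤ x ^ 3 := by
    have hx2 : 2 ≤ x := h2.trans hnx
    calc (x + 2) * d ≤ (x * x) * x := Nat.mul_le_mul (by nlinarith) (by omega)
      _ = x ^ 3 := by ring
  have h5 : ∏ j ∈ Finset.range d, (n + 2 * j) ≤ 2 ^ (x ^ 3) :=
    h1.trans ((Nat.pow_le_pow_left h3 d).trans (by
      rw [← pow_mul]
      exact Nat.pow_le_pow_right (by norm_num) h4))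
  exact_mod_cast h5

lemma spectrallyRich_of_eigenvectors {σ : Type} [Fintype σ] {μ : Measure (σ → ℝ)} {d : ℕ} {δ : ℝ}
    (h : ∀ (t : ℝ) (c : Mon σ d → ℝ), c ≠ 0 → (momentMatrix μ d).mulVec c = t • c → t ≠ 0 → δ ≤ t) :
    SpectrallyRich μ d δ := by
  intro t ht ht0
  obtain ⟨c, hc, hct⟩ := (hasEigenvalue_iff _ _).1 ht
  exact h t c hc hct ht0

/-- On the points ±1 a moment depends only on parity, so the matrix consists of two all-ones blocks
and a nonzero eigenvalue is the size of a parity class. -/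
lemma spectrallyRich_sphere_one (d : ℕ) : SpectrallyRich (sphereUniform 1) d 1 := by
  have hmom : ∀ k : ℕ, ∀ m : Fin 1 →₀ ℕ, m 0 = k →
      ∫ α, monEval α m ∂(sphereUniform 1) = if Even k then 1 else 0 := by
    intro k m hm
    split_ifs with hk
    · obtain ⟨a, ha⟩ := hk
      have h := integral_sphereUniform_even (n := 1) le_rfl (m := m) (a := fun _ => a)
        (fun i => by rw [Subsingleton.elim i 0, hm]; omega)
      simp only [Finset.univ_unique, Finset.sum_singleton, Finset.prod_singleton] at h
      have hpos : ((oddProd a : ℕ) : ℝ) ≠ 0 := by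
        rw [Nat.cast_ne_zero, oddProd, Finset.prod_ne_zero_iff]
        intro j _
        omega
      exact mul_left_cancel₀ hpos (h.trans (mul_one _).symm)
    · exact integral_sphereUniform_odd le_rfl (i := 0) (by rw [hm]; exact Nat.not_even_iff_odd.1 hk)
  have hentry : ∀ a b : Mon (Fin 1) d, momentMatrix (sphereUniform 1) d a b =
      if Even (a.1 0 + b.1 0) then 1 else 0 := by
    intro a b
    rw [← hmom _ (a.1 + b.1) (Finsupp.add_apply _ _ _)]
    simp only [momentMatrix, Matrix.of_apply, monEval_add]
  refine spectrallyRich_of_eigenvectors fun t c hc hct ht0 => ?_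
  have hrow : ∀ a, t * c a = ∑ b, if Even (a.1 0 + b.1 0) then c b else 0 := by
    intro a
    have := congrFun hct a
    simp only [Pi.smul_apply, smul_eq_mul] at this
    rw [← this, Matrix.mulVec, dotProduct]
    refine Finset.sum_congr rfl fun b _ => ?_
    rw [hentry]
    split_ifs <;> simp
  obtain ⟨a, ha⟩ := Function.ne_iff.1 hc
  have hsame : ∀ b : Mon (Fin 1) d, Even (a.1 0 + b.1 0) → c b = c a := by
    intro b hab
    refine mul_left_cancel₀ ht0 ?_
    rw [hrow, hrow]
    refine Finset.sum_congr rfl fun e _ => ?_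
    have : Even (b.1 0 + e.1 0) ↔ Even (a.1 0 + e.1 0) := by
      rw [Nat.even_add] at hab ⊢
      rw [Nat.even_add]
      tauto
    simp only [this]
  have h := hrow a
  have h2 : (∑ b : Mon (Fin 1) d, if Even (a.1 0 + b.1 0) then c b else 0) =
      ((Finset.univ.filter fun b : Mon (Fin 1) d => Even (a.1 0 + b.1 0)).card : ℝ) * c a := by
    rw [← Finset.sum_filter, Finset.sum_congr rfl fun b hb => hsame b (Finset.mem_filter.1 hb).2,
      Finset.sum_const, nsmul_eq_mul]
  rw [h2] at h
  rw [mul_right_cancel₀ ha h]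
  have hmem : a ∈ Finset.univ.filter fun b : Mon (Fin 1) d => Even (a.1 0 + b.1 0) := by simp
  exact_mod_cast Finset.card_pos.2 ⟨a, hmem⟩

/-! #### Completeness -/

lemma eval_smul_of_isHomogeneous {σ : Type} [Fintype σ] {F : MvPolynomial σ ℝ} {k : ℕ}
    (hF : F.IsHomogeneous k) (t : ℝ) (α : σ → ℝ) :
    MvPolynomial.eval (fun i => t * α i) F = t ^ k * MvPolynomial.eval α F := by
  rw [MvPolynomial.eval_eq', MvPolynomial.eval_eq', Finset.mul_sum]
  refine Finset.sum_congr rfl fun m hm => ?_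
  have hdeg : m.degree = k := by
    have := hF (MvPolynomial.mem_support_iff.1 hm)
    rw [← this]
    exact DFunLike.congr_fun Finsupp.degree_eq_weight_one m
  have := monEval_smul t α m
  rw [monEval, monEval, hdeg] at this
  rw [this]
  ring

/-- A homogeneous polynomial that vanishes on the sphere is zero. -/
lemma eq_zero_of_isHomogeneous (hn : 1 ≤ n) {F : MvPolynomial (Fin n) ℝ} {k : ℕ}
    (hF : F.IsHomogeneous k)
    (h : ∀ α ∈ (unitVector n).solutions, MvPolynomial.eval α F = 0) : F = 0 := by
  have hnz : ∀ α : Fin n → ℝ, α ≠ 0 → MvPolynomial.eval α F = 0 := by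
    intro α hα
    have hpos : 0 < ∑ i, α i ^ 2 := by
      obtain ⟨i, hi⟩ := Function.ne_iff.1 hα
      exact Finset.sum_pos' (fun i _ => sq_nonneg _) ⟨i, Finset.mem_univ _, by
        have : α i ≠ 0 := hi
        positivity⟩
    have h1 := h (fun i => (√(∑ i, α i ^ 2))⁻¹ * α i) (by
      rw [mem_unitVector_solutions]
      simp only [mul_pow]
      rw [← Finset.mul_sum, inv_pow, Real.sq_sqrt hpos.le, inv_mul_cancel₀ hpos.ne'])
    rw [eval_smul_of_isHomogeneous hF] at h1
    refine (mul_eq_zero.1 h1).resolve_left (pow_ne_zero _ (inv_ne_zero ?_))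
    exact (Real.sqrt_pos.2 hpos).ne'
  -- Scaling says nothing at the origin; the factor x_0 vanishes there and can be cancelled
  -- afterwards.
  have hmul : MvPolynomial.X ⟨0, hn⟩ * F = 0 := by
    refine MvPolynomial.funext fun α => ?_
    rw [map_mul, MvPolynomial.eval_X, map_zero]
    by_cases hα : α = 0
    · simp [hα]
    · rw [hnz α hα, mul_zero]
  exact (mul_eq_zero.1 hmul).resolve_left (MvPolynomial.X_ne_zero _)

lemma sum_X_sq_mul_sub_mem {H : MvPolynomial (Fin n) ℝ} {k : ℕ} (hH : H.totalDegree + 2 ≤ k) :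
    (∑ i, MvPolynomial.X i ^ 2) * H - H ∈ derivs (unitVector n).eqs k := by
  have e : (∑ i, MvPolynomial.X i ^ 2) * H - H = H * (∑ i, MvPolynomial.X i ^ 2 - 1) := by ring
  rw [e]
  refine mul_mem_derivs_of_mem (Finset.mem_singleton_self _) _
    ((MvPolynomial.totalDegree_mul _ _).trans ?_)
  have h1 : (∑ i, MvPolynomial.X i ^ 2 - 1 : MvPolynomial (Fin n) ℝ).totalDegree ≤ 2 := by
    refine (MvPolynomial.totalDegree_sub _ _).trans (max_le ?_ (by simp))
    exact MvPolynomial.totalDegree_finsetSum_le fun i _ => by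
      rw [MvPolynomial.totalDegree_X_pow]
  omega

/-- Multiplying a component by Σ x_i² raises its degree by two without changing it modulo the
equation, so all components of one parity collapse into one. -/
lemma exists_homogeneous_pair (d : ℕ) {f : MvPolynomial (Fin n) ℝ} (hf : f.totalDegree ≤ d + 1) :
    ∃ F H : MvPolynomial (Fin n) ℝ, F.IsHomogeneous (d + 1) ∧ H.IsHomogeneous d ∧
      f - (F + H) ∈ derivs (unitVector n).eqs (d + 1) := by
  have hsplit : ∀ (k : ℕ) {f : MvPolynomial (Fin n) ℝ}, f.totalDegree ≤ k + 1 →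
      ∃ F g : MvPolynomial (Fin n) ℝ, F.IsHomogeneous (k + 1) ∧ g.totalDegree ≤ k ∧ f = F + g := by
    intro k f hf
    refine ⟨MvPolynomial.homogeneousComponent (k + 1) f,
      ∑ i ∈ Finset.range (k + 1), MvPolynomial.homogeneousComponent i f,
      MvPolynomial.homogeneousComponent_isHomogeneous _ _, ?_, ?_⟩
    · refine MvPolynomial.totalDegree_finsetSum_le fun i hi => ?_
      have := (MvPolynomial.homogeneousComponent_isHomogeneous i f).totalDegree_le
      have := Finset.mem_range.1 hi
      omega
    · rw [add_comm, ← Finset.sum_range_succ]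
      conv_lhs => rw [← MvPolynomial.sum_homogeneousComponent f]
      refine Finset.sum_subset (Finset.range_subset_range.2 (by omega)) fun i _ hi => ?_
      refine MvPolynomial.homogeneousComponent_eq_zero _ _ ?_
      have := Finset.mem_range.not.1 hi
      omega
  induction d generalizing f with
  | zero =>
    obtain ⟨F, g, hF, hg, rfl⟩ := hsplit 0 hf
    refine ⟨F, g, hF, (MvPolynomial.totalDegree_zero_iff_isHomogeneous _).1 (by omega), ?_⟩
    rw [sub_self]
    exact zero_mem _
  | succ d ih =>
    obtain ⟨F₀, g, hF₀, hg, rfl⟩ := hsplit (d + 1) hf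
    obtain ⟨F, H, hF, hH, hFH⟩ := ih hg
    refine ⟨F₀ + (∑ i, MvPolynomial.X i ^ 2) * H, F, hF₀.add ?_, hF, ?_⟩
    · have h2 : (∑ i, MvPolynomial.X i ^ 2 : MvPolynomial (Fin n) ℝ).IsHomogeneous 2 :=
        MvPolynomial.IsHomogeneous.sum _ _ _ fun i _ => MvPolynomial.isHomogeneous_X_pow i 2
      have := h2.mul hH
      rwa [show 2 + d = d + 1 + 1 by ring] at this
    · have h1 := sum_X_sq_mul_sub_mem (H := H) (k := d + 1 + 1)
        (by have := hH.totalDegree_le; omega)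
      convert sub_mem (derivs_mono (by omega : d + 1 ≤ d + 1 + 1) hFH) h1 using 1
      ring

lemma unitVector_nonempty (hn : 1 ≤ n) : (unitVector n).solutions.Nonempty := by
  refine ⟨fun i => if i = ⟨0, hn⟩ then 1 else 0, mem_unitVector_solutions.2 ?_⟩
  simp

/-- The antipodal map changes the relative sign of F and H, so both vanish on the sphere and hence
identically. The reduction to F + H is then itself the derivation, of degree d. -/
lemma unitVector_complete (hn : 1 ≤ n) {d : ℕ} {f : MvPolynomial (Fin n) ℝ}
    (hf : f.totalDegree ≤ d) (h : ∀ α ∈ (unitVector n).solutions, MvPolynomial.eval α f = 0) :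
    f ∈ derivs (unitVector n).eqs d := by
  cases d with
  | zero =>
    have : f = 0 := eq_zero_of_isHomogeneous hn
      ((MvPolynomial.totalDegree_zero_iff_isHomogeneous _).1 (by omega)) h
    rw [this]
    exact zero_mem _
  | succ d =>
    obtain ⟨F, H, hF, hH, hFH⟩ := exists_homogeneous_pair d hf
    have hsum : ∀ α ∈ (unitVector n).solutions,
        MvPolynomial.eval α F + MvPolynomial.eval α H = 0 := by
      intro α hα
      have := eval_eq_zero_of_mem_derivs hFH hα.1
      rw [map_sub, h α hα, map_add] at this
      linarith
    have hdiff : ∀ α ∈ (unitVector n).solutions,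
        MvPolynomial.eval α F - MvPolynomial.eval α H = 0 := by
      intro α hα
      have hα' : (fun i => (-1 : ℝ) * α i) ∈ (unitVector n).solutions := by
        rw [mem_unitVector_solutions] at hα ⊢
        simpa using hα
      have := hsum _ hα'
      rw [eval_smul_of_isHomogeneous hF, eval_smul_of_isHomogeneous hH, pow_succ] at this
      have h2 : (-1 : ℝ) ^ d * (MvPolynomial.eval α F - MvPolynomial.eval α H) = 0 := by
        linear_combination -this
      exact (mul_eq_zero.1 h2).resolve_left (pow_ne_zero _ (by norm_num))
    have hF0 : F = 0 := eq_zero_of_isHomogeneous hn hF fun α hα => by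
      linarith [hsum α hα, hdiff α hα]
    have hH0 : H = 0 := eq_zero_of_isHomogeneous hn hH fun α hα => by
      linarith [hsum α hα, hdiff α hα]
    rwa [hF0, hH0, add_zero, sub_zero] at hFH

/-! #### Richness and small proofs -/

lemma unitVector_rich (hn : 1 ≤ n) {c : ℕ} (hc : 15 ≤ c) (d : ℕ) :
    RichUpTo c (unitVector n) (unitVector n).solutions (sphereUniform n) d := by
  have : Nonempty (Fin n) := ⟨⟨0, hn⟩⟩
  have hC := carries_sphereUniform hn
  have hspec : ∃ δ : ℝ, 0 < δ ∧ 1 / δ ≤ 2 ^ polySize c (Fintype.card (Fin n)) d ∧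
      SpectrallyRich (sphereUniform n) d δ := by
    by_cases h2 : 2 ≤ n
    · refine spectrallyRich_of_integral_bound hC (by simpa using h2) (j := 3)
        (L := ∏ j ∈ Finset.range d, (n + 2 * j)) (by norm_num) ?_ ?_
        (fun m hm => exists_int_sphereUniform hn hm) (by omega)
      · exact Nat.one_le_iff_ne_zero.2 (Finset.prod_ne_zero_iff.2 fun j _ => by omega)
      · rw [Fintype.card_fin]
        exact prod_le_two_pow h2 d
    · have : n = 1 := by omega
      subst this
      exact ⟨1, one_pos, const_le_two_pow_polySize (by omega) d (by norm_num),
        spectrallyRich_sphere_one d⟩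
  obtain ⟨δ, hδ, hδle, hδs⟩ := hspec
  refine ⟨δ, 1, d, hδ, one_pos, hδle, ?_, Nat.le_mul_of_pos_left _ (by omega),
    unitVector_nonempty hn, le_rfl, hδs, ?_, ?_⟩
  · exact const_le_two_pow_polySize (by omega) d (by norm_num)
  · intro v hv
    exact unitVector_complete hn (totalDegree_polyOf_le v) (hC.eq_zero_of_mulVec hv)
  · intro q hq
    simp [unitVector] at hq

lemma unitVector_isSimpleSystem (hn : 1 ≤ n) :
    IsSimpleSystem (unitVector n) (2 * Fintype.card (Fin n)) (3 * Fintype.card (Fin n) ^ 2) := by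
  have hn' : (1 : ℝ) ≤ n := by exact_mod_cast hn
  constructor
  · intro p hp
    rw [unitVector, Finset.mem_singleton] at hp
    have hsum := CoeffsLE.sum Finset.univ fun (i : Fin n) _ => coeffsLE_X_sq i
    have hone : CoeffsLE (1 : MvPolynomial (Fin n) ℝ) |1| := coeffsLE_C 1
    rw [hp]
    refine (hsum.sub hone).mono ?_
    rw [abs_one, Fintype.card_fin, Finset.card_univ, Fintype.card_fin]
    linarith
  · intro p hp m
    refine exists_int_coeff ?_ m
    rw [unitVector, Finset.mem_singleton] at hp
    rw [hp]
    exact sub_mem (sum_mem fun i _ => pow_mem (X_mem_integralPolys i) 2) (one_mem _)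
  · rw [unitVector, Finset.card_singleton, Fintype.card_fin]
    nlinarith
  all_goals simp [unitVector]

lemma unitVector_smallProofs (h2 : 2 ≤ n) {c : ℕ} (hc : 130 ≤ c) (d : ℕ) :
    SmallProofs c (unitVector n) d :=
  smallProofs_of_rich (by simpa using h2) (carries_sphereUniform (by omega))
    (unitVector_isSimpleSystem (by omega)) (unitVector_rich (by omega) (c := 15) le_rfl d) (by omega)

end Sphere

end SoS

end

theorem corollary3p4 : ∃ c : ℕ,
    -- Max-CSP
    ((∀ n d : ℕ, 1 ≤ n → SoS.RichUpTo c (SoS.maxCSP n) (SoS.maxCSP n).solutions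
        (ProbabilityTheory.uniformOn (SoS.maxCSP n).solutions) d) ∧
      ∀ n d : ℕ, 2 ≤ n → SoS.SmallProofs c (SoS.maxCSP n) d) ∧
    -- Max-Clique
    ((∀ (n d : ℕ) (G : SimpleGraph (Fin n)), 1 ≤ n →
        SoS.RichUpTo c (SoS.maxClique G) (SoS.maxClique G).solutions
          (ProbabilityTheory.uniformOn (SoS.maxClique G).solutions) d) ∧
      ∀ (n d : ℕ) (G : SimpleGraph (Fin n)), 2 ≤ n → SoS.SmallProofs c (SoS.maxClique G) d) ∧
    -- Balanced Separator: the whole solution set, for the inequalities perturbed by `1/2`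
    ((∀ n d : ℕ, 1 ≤ n → 3 * d ≤ n → 3 * d + 1 ≠ n →
        SoS.RichUpTo c (SoS.balancedSeparator n (1 / 2)) (SoS.balancedSeparator n 0).solutions
          (ProbabilityTheory.uniformOn (SoS.balancedSeparator n 0).solutions) d) ∧
      ∀ n d : ℕ, 2 ≤ n → 3 * d ≤ n → 3 * d + 1 ≠ n →
        SoS.SmallProofs c (SoS.balancedSeparator n (1 / 2)) d) ∧
    -- Balanced Separator: a set of solutions, for the unperturbed inequalities
    ((∀ n d : ℕ, 3 * (d + 2) ≤ n → ∃ S : Set (Fin n → ℝ),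
        SoS.RichUpTo c (SoS.balancedSeparator n 0) S (ProbabilityTheory.uniformOn S) d) ∧
      ∀ n d : ℕ, 3 * (d + 2) ≤ n → SoS.SmallProofs c (SoS.balancedSeparator n 0) d) ∧
    -- Matching
    ((∀ n d : ℕ, 2 ≤ n → Even n → SoS.RichUpTo c (SoS.matching n) (SoS.matching n).solutions
        (ProbabilityTheory.uniformOn (SoS.matching n).solutions) d) ∧
      ∀ n d : ℕ, 4 ≤ n → Even n → SoS.SmallProofs c (SoS.matching n) d) ∧
    -- Max-Bisection
    ((∀ n d : ℕ, 2 ≤ n → Even n →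
        SoS.RichUpTo c (SoS.maxBisection n) (SoS.maxBisection n).solutions
          (ProbabilityTheory.uniformOn (SoS.maxBisection n).solutions) d) ∧
      ∀ n d : ℕ, 2 ≤ n → Even n → SoS.SmallProofs c (SoS.maxBisection n) d) ∧
    -- Unit-Vector
    ((∀ n d : ℕ, 1 ≤ n → SoS.RichUpTo c (SoS.unitVector n) (SoS.unitVector n).solutions
        (SoS.sphereUniform n) d) ∧
      ∀ n d : ℕ, 2 ≤ n → SoS.SmallProofs c (SoS.unitVector n) d) := by
  -- The sphere is rich with constant 15, and 6·15 + 40 = 130. The Boolean systems need 13 for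
  -- richness and 118 for small proofs.
  refine ⟨130, ⟨fun n d hn => ?_, fun n d hn => ?_⟩,
    ⟨fun n d G hn => SoS.maxClique_rich G hn (by norm_num) d,
      fun n d G hn => SoS.maxClique_smallProofs G hn (by norm_num) d⟩,
    ⟨fun n d hn h1 h2 => SoS.balancedSeparator_rich hn h1 h2 (by norm_num),
      fun n d hn h1 h2 => SoS.balancedSeparator_smallProofs hn h1 h2 (by norm_num)⟩,
    ⟨fun n d h => ⟨SoS.strictSeparators n, SoS.strictSeparators_rich h (by norm_num)⟩,
      fun n d h => SoS.strictSeparators_smallProofs h (by norm_num)⟩,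
    ⟨fun n d h2 he => SoS.matching_rich h2 he (by norm_num) d,
      fun n d h4 he => SoS.matching_smallProofs h4 he (by norm_num) d⟩,
    ⟨fun n d h2 he => SoS.maxBisection_rich h2 he (by norm_num) d,
      fun n d h2 he => SoS.maxBisection_smallProofs h2 he (by norm_num) d⟩,
    ⟨fun n d hn => SoS.unitVector_rich hn (by norm_num) d,
      fun n d hn => SoS.unitVector_smallProofs hn (by norm_num) d⟩⟩
  · rw [SoS.maxCSP_eq_maxClique_top]
    exact SoS.maxClique_rich _ hn (by norm_num) d
  · rw [SoS.maxCSP_eq_maxClique_top]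
    exact SoS.maxClique_smallProofs _ hn (by norm_num) d
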